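/- **Conventions.** All monoidal categories and functors are strict symmetric monoidal. A *CD-category* is a symmetric monoidal category in which every object carries a commutative comonoid (copy, del), compatibly with $\otimes$ and $I$; a *hypergraph category* is a CD-category in which every object moreover carries a commutative monoid (compare, omni), compatibly with $\otimes$ and $I$, such that the special Frobenius equations hold. CD-functors and hypergraph functors are symmetric monoidal functors preserving these structures. $\mathsf{Mat}$ is the hypergraph category of finite sets and matrices with entries in $\mathbb R_{\ge 0}$, $\mathsf{FinStoch}$ the CD-category of finite sets and (column-)stochastic matrices, and $\mathsf{FinProjStoch}$ is the quotient of $\mathsf{Mat}$ that identifies $f$ with $\lambda f$ for all $\lambda\in\mathbb R_{>0}$; write $\mathsf{Mat}\xrightarrow{q}\mathsf{FinProjStoch}\xleftarrow{i}\mathsf{FinStoch}$ for the functors $f\mapsto[f]$. In a hypergraph category the *graph* of $f\colon X\to Y$ is the morphism $I\to X\otimes Y$ obtained by bending its input wire, i.e. $(\mathrm{id}_X\otimes f)\circ\mathrm{copy}_X\circ\mathrm{omni}_X$. **Graphs and syntax.** An *ordered DAG* (resp. *ordered undirected graph*) is a finite directed (resp. simple undirected) graph with a total order on its vertices (such that $a\to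 b$ implies $a<b$ in the directed case); morphisms are monotone maps on vertices under which the endpoints of an edge are sent to the endpoints of an edge or to the same vertex. The one-vertex graph is denoted by $\bullet$. For an ordered DAG $\mathcal G$, $\mathsf{CDSyn}_{\mathcal G}$ and $\mathsf{Syn}_{\mathcal G}$ are the free CD-category and the free hypergraph category on the objects $V_{\mathcal G}$ and one generator $\mathrm{pa}(v)\to v$ for each vertex $v$, and $\star_{\mathcal G}\colon\mathsf{CDSyn}_{\mathcal G}\to\mathsf{Syn}_{\mathcal G}$ is the functor that is the identity on generators. For an ordered undirected graph $\mathcal H$, $\mathsf{Syn}_{\mathcal H}$ is the free hypergraph category on the objects $V_{\mathcal H}$ and one generator $I\to C$ for each nonempty clique $C$ (sets of vertices are identified with the tensor product of their elements in increasing order). $\mathsf V_{\mathcal G}$ and $\mathsf V_{\mathcal H}$ are the free symmetric monoidal categories on the vertices; a monotone map $\alpha\colon V'\to V$ induces $\mathsf V_\alpha\colon \mathsf V_{V}\to\mathsf V_{V'}$, $v\mapsto\bigotimes_{\alpha(v')=v}v'$. The *copy-composition* of a set $S$ of generators of $\mathsf{CDSyn}_{\mathcal G}$ has as inputs the vertices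 that are inputs, but not outputs, of elements of $S$, and as outputs those of $S$. It is $\mathrm{id}_I$ for $S=\emptyset$; otherwise, if $\phi\in S$ is the generator with the biggest output, it is obtained from the copy-composition of $S\setminus\{\phi\}$ by copying its inputs and outputs, as well as the remaining inputs, and feeding them into $\phi$. The *compare-composition* of a finite collection of factors, i.e. of morphisms $I\to C$ with $C$ a set of vertices, is $\mathrm{id}_I$ for the empty collection, and otherwise is obtained from one of the factors and the compare-composition of the others by comparing all the wires labelled by the same vertex. Let $!_{\mathcal G}\colon\mathsf{CDSyn}_\bullet\to\mathsf{CDSyn}_{\mathcal G}$ be the CD-functor sending $\bullet$ to $\bigotimes_v v$ and the unique generator to the copy-composition $c_{\mathcal G}$ of all generators, $\tilde !_{\mathcal G}\colon\mathsf{Syn}_\bullet\to\mathsf{Syn}_{\mathcal G}$ the hypergraph functor sending $\bullet$ to $\bigotimes_v v$ and the unique generator to $\star_{\mathcal G}(c_{\mathcal G})$, and $!_{\mathcal H}\colon\mathsf{Syn}_\bullet\to\mathsf{Syn}_{\mathcal H}$ the hypergraph functor sending $\bullet$ to $\bigotimes_v v$ and the unique generator to the compare-composition of all generators. Let $\star\colon\mathsf{CDSyn}_\bullet\to\mathsf{Syn}_\bullet$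 send the unique generator to the unique generator. **Networks.** An object of $\mathbf{BN}$ is a triple $(\omega,\mathcal G,\tau)$ of a CD-functor $\omega\colon\mathsf{CDSyn}_\bullet\to\mathsf{FinStoch}$, an ordered DAG $\mathcal G$ and a symmetric monoidal functor $\tau\colon\mathsf V_{\mathcal G}\to\mathsf{FinStoch}$ for which there is a CD-functor $F\colon\mathsf{CDSyn}_{\mathcal G}\to\mathsf{FinStoch}$ with $F\circ{!_{\mathcal G}}=\omega$ and $F|_{\mathsf V_{\mathcal G}}=\tau$. An object of $\mathbf{MN}$ is a triple $(\omega,\mathcal H,\tau)$ of a CD-functor $\omega$ as above, an ordered undirected graph $\mathcal H$ and a symmetric monoidal functor $\tau\colon\mathsf V_{\mathcal H}\to\mathsf{FinStoch}$ for which there is a hypergraph functor $\Phi\colon\mathsf{Syn}_{\mathcal H}\to\mathsf{Mat}$ with $q\circ\Phi\circ{!_{\mathcal H}}\circ\star=i\circ\omega$ and $q\circ\Phi|_{\mathsf V_{\mathcal H}}=i\circ\tau$. We then say that $F$ (resp. $\Phi$) witnesses the triple. In both categories, a morphism from $(\omega,\mathcal K,\tau)$ to $(\omega',\mathcal K',\tau')$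 is a triple $(\alpha,\eta,\hat\eta)$ of a morphism of graphs $\alpha\colon\mathcal K'\to\mathcal K$ and monoidal, not necessarily natural, transformations $\eta\colon\tau\to\tau'\circ\mathsf V_\alpha$ and $\hat\eta\colon\omega\to\omega'$ such that $\hat\eta_\bullet\circ\omega(s)=\omega'(s)$, where $s\colon I\to\bullet$ is the unique generator, and such that $\eta$ and $\hat\eta$ coincide as transformations between functors on $\mathsf V_\bullet$. Composition is component-wise. **Moralisation.** The moralisation $\mathrm{Mor}(\mathcal G)$ of an ordered DAG $\mathcal G$ has the same ordered vertices, two different vertices being adjacent if there is an edge between them in $\mathcal G$ or they are both parents of the same vertex. Let $m\colon\mathsf{Syn}_{\mathrm{Mor}(\mathcal G)}\to\mathsf{Syn}_{\mathcal G}$ be the hypergraph functor that is the identity on vertices and sends the generator of a clique $C$ to the graph of the generator $\mathrm{pa}(v)\to v$ if $C=\{v\}\cup\mathrm{pa}(v)$ for some vertex $v$, and to $\mathrm{omni}_C$ otherwise. For a CD-functor $F\colon\mathsf{CDSyn}_{\mathcal G}\to\mathsf{FinStoch}$ let $\tilde F\colon\mathsf{Syn}_{\mathcal G}\to\mathsf{Mat}$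 be the hypergraph functor defined as $F$ on objects and generators. **Theorem.** 1. For each ordered DAG $\mathcal G$ and each set $S$ of its generators, the graph of the copy-composition of $S$ (taken in $\mathsf{Syn}_{\mathcal G}$, with its outputs suitably reordered) equals the compare-composition, in any order, of the graphs of the elements of $S$. 2. For each ordered DAG $\mathcal G$, $m$ is a hypergraph functor and $m\circ{!_{\mathrm{Mor}(\mathcal G)}}=\tilde !_{\mathcal G}$. 3. If $F$ witnesses that $(\omega,\mathcal G,\tau)$ is an object of $\mathbf{BN}$, then $\tilde F\circ m$ witnesses that $(\omega,\mathrm{Mor}(\mathcal G),\tau)$ is an object of $\mathbf{MN}$. 4. Each morphism $\alpha\colon\mathcal G\to\mathcal G'$ of ordered DAGs is also a morphism $\mathrm{Mor}(\mathcal G)\to\mathrm{Mor}(\mathcal G')$, and there is a functor $\mathrm{Mor}\colon\mathbf{BN}\to\mathbf{MN}$ with $(\omega,\mathcal G,\tau)\mapsto(\omega,\mathrm{Mor}(\mathcal G),\tau)$ on objects and $(\alpha,\eta,\hat\eta)\mapsto(\alpha,\eta,\hat\eta)$ on morphisms. -/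

import Mathlib

open CategoryTheory
open scoped NNReal

universe w v u

namespace PGM

/-! ### Strict symmetric monoidal, CD- and hypergraph categories

All monoidal categories and functors are strict, so that the associativity and unit laws hold as
equalities of objects. Equations between morphisms whose (equal) types are written differently are
stated with `HEq`. -/

/-- A strict symmetric monoidal category. -/
class StrictSMC (C : Type u) extends Category.{v} C where
  tensorObj : C → C → C
  unit : C
  tensorObj_assoc : ∀ X Y Z : C, tensorObj (tensorObj X Y) Z = tensorObj X (tensorObj Y Z)
  unit_tensorObj : ∀ X : C, tensorObj unit X = X
  tensorObj_unit : ∀ X : C, tensorObj X unit = X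
  tensorHom : ∀ {X Y X' Y' : C}, (X ⟶ Y) → (X' ⟶ Y') → (tensorObj X X' ⟶ tensorObj Y Y')
  tensorHom_id : ∀ X Y : C, tensorHom (𝟙 X) (𝟙 Y) = 𝟙 (tensorObj X Y)
  tensorHom_comp : ∀ {X Y Z X' Y' Z' : C} (f : X ⟶ Y) (g : Y ⟶ Z) (f' : X' ⟶ Y') (g' : Y' ⟶ Z'),
    tensorHom (f ≫ g) (f' ≫ g') = tensorHom f f' ≫ tensorHom g g'
  tensorHom_assoc : ∀ {X Y X' Y' X'' Y'' : C} (f : X ⟶ Y) (f' : X' ⟶ Y') (f'' : X'' ⟶ Y''),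
    HEq (tensorHom (tensorHom f f') f'') (tensorHom f (tensorHom f' f''))
  unit_tensorHom : ∀ {X Y : C} (f : X ⟶ Y), HEq (tensorHom (𝟙 unit) f) f
  tensorHom_unit : ∀ {X Y : C} (f : X ⟶ Y), HEq (tensorHom f (𝟙 unit)) f
  braid : ∀ X Y : C, tensorObj X Y ⟶ tensorObj Y X
  braid_naturality : ∀ {X Y X' Y' : C} (f : X ⟶ Y) (f' : X' ⟶ Y'),
    tensorHom f f' ≫ braid Y Y' = braid X X' ≫ tensorHom f' f
  braid_braid : ∀ X Y : C, braid X Y ≫ braid Y X = 𝟙 (tensorObj X Y)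
  hexagon : ∀ X Y Z : C, HEq (braid X (tensorObj Y Z))
    (tensorHom (braid X Y) (𝟙 Z) ≫ eqToHom (tensorObj_assoc Y X Z) ≫ tensorHom (𝟙 Y) (braid X Z))

infix:70 " ⊠ " => StrictSMC.tensorObj
infix:70 " ⊠ₕ " => StrictSMC.tensorHom

section

variable {C : Type u} [StrictSMC.{v} C]

/-- The identity between equal objects, on the left of a morphism and on its right. -/
def castHom {X X' Y Y' : C} (hX : X = X') (hY : Y = Y') (f : X ⟶ Y) : X' ⟶ Y' :=
  eqToHom hX.symm ≫ f ≫ eqToHom hY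

theorem castHom_heq {X X' Y Y' : C} (hX : X = X') (hY : Y = Y') (f : X ⟶ Y) :
    HEq (castHom hX hY f) f := by
  subst hX hY; simp [castHom]

theorem comp_heq_comp {X X' Y Y' Z Z' : C} (hX : X = X') (hY : Y = Y') (hZ : Z = Z')
    {f : X ⟶ Y} {f' : X' ⟶ Y'} {g : Y ⟶ Z} {g' : Y' ⟶ Z'} (hf : HEq f f') (hg : HEq g g') :
    HEq (f ≫ g) (f' ≫ g') := by
  subst hX hY hZ hf hg; rfl

theorem tensorHom_heq {X X' Y Y' Z Z' W W' : C} (hX : X = X') (hY : Y = Y') (hZ : Z = Z')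
    (hW : W = W') {f : X ⟶ Y} {f' : X' ⟶ Y'} {g : Z ⟶ W} {g' : Z' ⟶ W'} (hf : HEq f f')
    (hg : HEq g g') : HEq (f ⊠ₕ g) (f' ⊠ₕ g') := by
  subst hX hY hZ hW hf hg; rfl

theorem braid_heq {X X' Y Y' : C} (hX : X = X') (hY : Y = Y') :
    HEq (StrictSMC.braid X Y) (StrictSMC.braid X' Y') := by
  subst hX hY; rfl

theorem id_heq {X X' : C} (hX : X = X') : HEq (𝟙 X) (𝟙 X') := by
  subst hX; rfl

theorem eqToHom_heq {X X' Y Y' : C} (h : X = X') (h' : Y = Y') (e : X = Y) :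
    HEq (eqToHom h) (eqToHom h') := by
  subst h h' e; rfl

theorem interchange_dom (A B B' D : C) :
    (A ⊠ B) ⊠ (B' ⊠ D) = (A ⊠ (B ⊠ B')) ⊠ D := by
  rw [StrictSMC.tensorObj_assoc, StrictSMC.tensorObj_assoc, StrictSMC.tensorObj_assoc]

/-- The middle-four exchange `(A ⊗ B) ⊗ (B' ⊗ D) ⟶ (A ⊗ B') ⊗ (B ⊗ D)`. -/
def interchange (A B B' D : C) : (A ⊠ B) ⊠ (B' ⊠ D) ⟶ (A ⊠ B') ⊠ (B ⊠ D) :=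
  eqToHom (interchange_dom A B B' D) ≫ ((𝟙 A ⊠ₕ StrictSMC.braid B B') ⊠ₕ 𝟙 D) ≫
    eqToHom (interchange_dom A B' B D).symm

theorem interchange_heq {A A' B B' E E' D D' : C} (hA : A = A') (hB : B = B') (hE : E = E')
    (hD : D = D') : HEq (interchange A B E D) (interchange A' B' E' D') := by
  subst hA hB hE hD; rfl

end

/-- A CD-category: each object carries a commutative comonoid (`copy`, `del`), and these respect
the monoidal structure. -/
class CDCat (C : Type u) [StrictSMC.{v} C] where
  copy : ∀ X : C, X ⟶ X ⊠ X
  del : ∀ X : C, X ⟶ StrictSMC.unit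
  copy_comm : ∀ X : C, copy X ≫ StrictSMC.braid X X = copy X
  copy_assoc : ∀ X : C, HEq (copy X ≫ (copy X ⊠ₕ 𝟙 X)) (copy X ≫ (𝟙 X ⊠ₕ copy X))
  copy_del : ∀ X : C, HEq (copy X ≫ (del X ⊠ₕ 𝟙 X)) (𝟙 X)
  copy_tensor : ∀ X Y : C, copy (X ⊠ Y) = (copy X ⊠ₕ copy Y) ≫ interchange X X Y Y
  copy_unit : HEq (copy (StrictSMC.unit : C)) (𝟙 (StrictSMC.unit : C))
  del_tensor : ∀ X Y : C, HEq (del (X ⊠ Y)) (del X ⊠ₕ del Y)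
  del_unit : del (StrictSMC.unit : C) = 𝟙 StrictSMC.unit

/-- A hypergraph category: a CD-category where each object also carries a commutative monoid
(`compare`, `omni`), these respect the monoidal structure, and the monoid and the comonoid on an
object satisfy the laws of special Frobenius algebras. -/
class HypCat (C : Type u) [StrictSMC.{v} C] [CDCat C] where
  compare : ∀ X : C, X ⊠ X ⟶ X
  omni : ∀ X : C, StrictSMC.unit ⟶ X
  compare_comm : ∀ X : C, StrictSMC.braid X X ≫ compare X = compare X
  compare_assoc : ∀ X : C,
    HEq ((compare X ⊠ₕ 𝟙 X) ≫ compare X) ((𝟙 X ⊠ₕ compare X) ≫ compare X)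
  omni_compare : ∀ X : C, HEq ((omni X ⊠ₕ 𝟙 X) ≫ compare X) (𝟙 X)
  compare_tensor : ∀ X Y : C,
    compare (X ⊠ Y) = interchange X Y X Y ≫ (compare X ⊠ₕ compare Y)
  compare_unit : HEq (compare (StrictSMC.unit : C)) (𝟙 (StrictSMC.unit : C))
  omni_tensor : ∀ X Y : C, HEq (omni (X ⊠ Y)) (omni X ⊠ₕ omni Y)
  omni_unit : omni (StrictSMC.unit : C) = 𝟙 StrictSMC.unit
  special : ∀ X : C, CDCat.copy X ≫ compare X = 𝟙 X
  frobenius_left : ∀ X : C,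
    (CDCat.copy X ⊠ₕ 𝟙 X) ≫ eqToHom (StrictSMC.tensorObj_assoc X X X) ≫ (𝟙 X ⊠ₕ compare X)
      = compare X ≫ CDCat.copy X
  frobenius_right : ∀ X : C,
    (𝟙 X ⊠ₕ CDCat.copy X) ≫ eqToHom (StrictSMC.tensorObj_assoc X X X).symm ≫ (compare X ⊠ₕ 𝟙 X)
      = compare X ≫ CDCat.copy X

/-- The graph `I ⟶ X ⊗ Y` of a morphism `f : X ⟶ Y` in a hypergraph category, obtained by bending
the input wire. -/
def graph {C : Type u} [StrictSMC.{v} C] [CDCat C] [HypCat C] {X Y : C} (f : X ⟶ Y) :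
    (StrictSMC.unit : C) ⟶ X ⊠ Y :=
  HypCat.omni X ≫ CDCat.copy X ≫ (𝟙 X ⊠ₕ f)

/-- A functor is (strict) symmetric monoidal. -/
structure IsSymFunctor {C : Type*} [StrictSMC C] {D : Type*} [StrictSMC D] (F : C ⥤ D) :
    Prop where
  obj_unit : F.obj StrictSMC.unit = StrictSMC.unit
  obj_tensor : ∀ X Y : C, F.obj (X ⊠ Y) = F.obj X ⊠ F.obj Y
  map_tensor : ∀ {X Y X' Y' : C} (f : X ⟶ Y) (f' : X' ⟶ Y'),
    HEq (F.map (f ⊠ₕ f')) (F.map f ⊠ₕ F.map f')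
  map_braid : ∀ X Y : C, HEq (F.map (StrictSMC.braid X Y)) (StrictSMC.braid (F.obj X) (F.obj Y))

/-- A functor is a CD-functor. -/
structure IsCDFunctor {C : Type*} [StrictSMC C] [CDCat C] {D : Type*} [StrictSMC D] [CDCat D]
    (F : C ⥤ D) : Prop extends IsSymFunctor F where
  map_copy : ∀ X : C, HEq (F.map (CDCat.copy X)) (CDCat.copy (F.obj X))
  map_del : ∀ X : C, HEq (F.map (CDCat.del X)) (CDCat.del (F.obj X))

/-- A functor is a hypergraph functor. -/
structure IsHypFunctor {C : Type*} [StrictSMC C] [CDCat C] [HypCat C] {D : Type*} [StrictSMC D]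
    [CDCat D] [HypCat D] (F : C ⥤ D) : Prop extends IsCDFunctor F where
  map_compare : ∀ X : C, HEq (F.map (HypCat.compare X)) (HypCat.compare (F.obj X))
  map_omni : ∀ X : C, HEq (F.map (HypCat.omni X)) (HypCat.omni (F.obj X))

/-- A monoidal transformation between strict symmetric monoidal functors; naturality is not
required. -/
@[ext]
structure MonTrans {C : Type*} [StrictSMC C] {D : Type*} [StrictSMC D] (F G : C ⥤ D) where
  app : ∀ X : C, F.obj X ⟶ G.obj X
  app_tensor : ∀ X Y : C, HEq (app (X ⊠ Y)) (app X ⊠ₕ app Y)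
  app_unit : HEq (app StrictSMC.unit) (𝟙 (StrictSMC.unit : D))

/-! ### Free strict symmetric monoidal, CD- and hypergraph categories -/

/-- A monoidal signature on a set `A` of generating objects. -/
structure MonSig (A : Type u) where
  Gen : Type u
  dom : Gen → List A
  cod : Gen → List A

/-- The three kinds of free categories: symmetric monoidal (coloured PROPs), CD, hypergraph. -/
inductive Kind
  | sym
  | cd
  | hyp

def Kind.HasCopy : Kind → Prop
  | .sym => False
  | .cd => True
  | .hyp => True

def Kind.HasCompare : Kind → Prop
  | .sym => False
  | .cd => False
  | .hyp => True

theorem Kind.HasCompare.hasCopy : ∀ {k : Kind}, k.HasCompare → k.HasCopy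
  | .hyp, _ => trivial

section Free

variable {k : Kind} {A : Type u} {S : MonSig A}

/-- String diagrams built from the generators and the structural maps, by sequential and parallel
composition. -/
inductive Term (k : Kind) {A : Type u} (S : MonSig A) : List A → List A → Type u
  | gen (σ : S.Gen) : Term k S (S.dom σ) (S.cod σ)
  | id (X : List A) : Term k S X X
  | comp {X Y Z : List A} (f : Term k S X Y) (g : Term k S Y Z) : Term k S X Z
  | tensor {X Y X' Y' : List A} (f : Term k S X Y) (g : Term k S X' Y') :
      Term k S (X ++ X') (Y ++ Y')
  | braid (X Y : List A) : Term k S (X ++ Y) (Y ++ X)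
  | copy (h : k.HasCopy) (X : List A) : Term k S X (X ++ X)
  | del (h : k.HasCopy) (X : List A) : Term k S X []
  | compare (h : k.HasCompare) (X : List A) : Term k S (X ++ X) X
  | omni (h : k.HasCompare) (X : List A) : Term k S [] X

namespace Term

/-- The identity between equal lists. -/
def eqTo {X Y : List A} (h : X = Y) : Term k S X Y := h ▸ Term.id X

/-- Transport of a diagram along equalities of its boundary. -/
def castT {X X' Y Y' : List A} (hX : X = X') (hY : Y = Y') (t : Term k S X Y) : Term k S X' Y' :=
  hX ▸ hY ▸ t

theorem castT_heq {X X' Y Y' : List A} (hX : X = X') (hY : Y = Y') (t : Term k S X Y) :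
    HEq (castT hX hY t) t := by
  subst hX hY; rfl

theorem mid_eq (X Y Z W : List A) : (X ++ Y) ++ (Z ++ W) = (X ++ (Y ++ Z)) ++ W := by simp

def mid (X Y Z W : List A) : Term k S ((X ++ Y) ++ (Z ++ W)) ((X ++ Z) ++ (Y ++ W)) :=
  comp (eqTo (mid_eq X Y Z W)) (comp (tensor (tensor (id X) (braid Y Z)) (id W))
    (eqTo (mid_eq X Z Y W).symm))

/-- The congruence generated by the axioms of strict symmetric monoidal categories, and those of
CD-categories and of hypergraph categories when the kind includes these operations. -/
inductive Rel : ∀ {X Y : List A}, Term k S X Y → Term k S X Y → Prop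
  | refl {X Y} (f : Term k S X Y) : Rel f f
  | symm {X Y} {f g : Term k S X Y} : Rel f g → Rel g f
  | trans {X Y} {f g h : Term k S X Y} : Rel f g → Rel g h → Rel f h
  | comp_congr {X Y Z} {f f' : Term k S X Y} {g g' : Term k S Y Z} :
      Rel f f' → Rel g g' → Rel (comp f g) (comp f' g')
  | tensor_congr {X Y X' Y'} {f f' : Term k S X Y} {g g' : Term k S X' Y'} :
      Rel f f' → Rel g g' → Rel (tensor f g) (tensor f' g')
  | id_comp {X Y} (f : Term k S X Y) : Rel (comp (id X) f) f
  | comp_id {X Y} (f : Term k S X Y) : Rel (comp f (id Y)) f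
  | assoc {X Y Z W} (f : Term k S X Y) (g : Term k S Y Z) (h : Term k S Z W) :
      Rel (comp (comp f g) h) (comp f (comp g h))
  | tensor_id (X Y : List A) : Rel (tensor (id X) (id Y)) (id (X ++ Y))
  | tensor_comp {X Y Z X' Y' Z'} (f : Term k S X Y) (g : Term k S Y Z) (f' : Term k S X' Y')
      (g' : Term k S Y' Z') :
      Rel (tensor (comp f g) (comp f' g')) (comp (tensor f f') (tensor g g'))
  | tensor_assoc {X Y X' Y' X'' Y''} (f : Term k S X Y) (f' : Term k S X' Y')
      (f'' : Term k S X'' Y'') :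
      Rel (castT (List.append_assoc _ _ _) (List.append_assoc _ _ _) (tensor (tensor f f') f''))
        (tensor f (tensor f' f''))
  | nil_tensor {X Y} (f : Term k S X Y) :
      Rel (castT (List.nil_append _) (List.nil_append _) (tensor (id []) f)) f
  | tensor_nil {X Y} (f : Term k S X Y) :
      Rel (castT (List.append_nil _) (List.append_nil _) (tensor f (id []))) f
  | braid_naturality {X Y X' Y'} (f : Term k S X Y) (f' : Term k S X' Y') :
      Rel (comp (tensor f f') (braid Y Y')) (comp (braid X X') (tensor f' f))
  | braid_braid (X Y : List A) : Rel (comp (braid X Y) (braid Y X)) (id (X ++ Y))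
  | hexagon (X Y Z : List A) :
      Rel (castT (List.append_assoc X Y Z).symm (List.append_assoc Y Z X) (braid X (Y ++ Z)))
        (comp (tensor (braid X Y) (id Z))
          (comp (eqTo (List.append_assoc Y X Z)) (tensor (id Y) (braid X Z))))
  | copy_comm (h : k.HasCopy) (X : List A) : Rel (comp (copy h X) (braid X X)) (copy h X)
  | copy_assoc (h : k.HasCopy) (X : List A) :
      Rel (castT rfl (List.append_assoc X X X) (comp (copy h X) (tensor (copy h X) (id X))))
        (comp (copy h X) (tensor (id X) (copy h X)))
  | copy_del (h : k.HasCopy) (X : List A) :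
      Rel (castT rfl (List.nil_append X) (comp (copy h X) (tensor (del h X) (id X)))) (id X)
  | copy_tensor (h : k.HasCopy) (X Y : List A) :
      Rel (copy h (X ++ Y)) (comp (tensor (copy h X) (copy h Y)) (mid X X Y Y))
  | copy_nil (h : k.HasCopy) : Rel (castT rfl (List.append_nil []) (copy h [])) (id [])
  | del_tensor (h : k.HasCopy) (X Y : List A) :
      Rel (castT rfl (List.append_nil []).symm (del h (X ++ Y))) (tensor (del h X) (del h Y))
  | del_nil (h : k.HasCopy) : Rel (del h []) (id [])
  | compare_comm (h : k.HasCompare) (X : List A) :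
      Rel (comp (braid X X) (compare h X)) (compare h X)
  | compare_assoc (h : k.HasCompare) (X : List A) :
      Rel (castT (List.append_assoc X X X) rfl (comp (tensor (compare h X) (id X)) (compare h X)))
        (comp (tensor (id X) (compare h X)) (compare h X))
  | omni_compare (h : k.HasCompare) (X : List A) :
      Rel (castT (List.nil_append X) rfl (comp (tensor (omni h X) (id X)) (compare h X))) (id X)
  | compare_tensor (h : k.HasCompare) (X Y : List A) :
      Rel (compare h (X ++ Y)) (comp (mid X Y X Y) (tensor (compare h X) (compare h Y)))
  | compare_nil (h : k.HasCompare) :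
      Rel (castT (List.append_nil []) rfl (compare h [])) (id [])
  | omni_tensor (h : k.HasCompare) (X Y : List A) :
      Rel (castT (List.append_nil []).symm rfl (omni h (X ++ Y))) (tensor (omni h X) (omni h Y))
  | omni_nil (h : k.HasCompare) : Rel (omni h []) (id [])
  | special (h : k.HasCompare) (X : List A) :
      Rel (comp (copy h.hasCopy X) (compare h X)) (id X)
  | frobenius_left (h : k.HasCompare) (X : List A) :
      Rel (comp (tensor (copy h.hasCopy X) (id X))
          (comp (eqTo (List.append_assoc X X X)) (tensor (id X) (compare h X))))
        (comp (compare h X) (copy h.hasCopy X))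
  | frobenius_right (h : k.HasCompare) (X : List A) :
      Rel (comp (tensor (id X) (copy h.hasCopy X))
          (comp (eqTo (List.append_assoc X X X).symm) (tensor (compare h X) (id X))))
        (comp (compare h X) (copy h.hasCopy X))

instance setoid (k : Kind) (S : MonSig A) (X Y : List A) : Setoid (Term k S X Y) :=
  ⟨Rel, Rel.refl, Rel.symm, Rel.trans⟩

end Term

/-- The free category of the given kind on a monoidal signature: objects are lists of generating
objects, morphisms are diagrams modulo the axioms. -/
structure FreeCat (k : Kind) {A : Type u} (S : MonSig A) : Type u where
  of ::
  toList : List A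

namespace FreeCat

instance category (k : Kind) (S : MonSig A) : Category.{u} (FreeCat k S) where
  Hom X Y := Quotient (Term.setoid k S X.toList Y.toList)
  id X := Quotient.mk _ (Term.id X.toList)
  comp f g := Quotient.map₂ Term.comp (fun _ _ h _ _ h' => Term.Rel.comp_congr h h') f g
  id_comp f := Quotient.inductionOn f fun f => Quotient.sound (Term.Rel.id_comp f)
  comp_id f := Quotient.inductionOn f fun f => Quotient.sound (Term.Rel.comp_id f)
  assoc f g h := Quotient.inductionOn₃ f g h fun f g h => Quotient.sound (Term.Rel.assoc f g h)

/-- The morphism represented by a diagram. -/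
def mk {X Y : List A} (t : Term k S X Y) : (of X : FreeCat k S) ⟶ of Y :=
  Quotient.mk _ t

theorem mk_surj {X Y : FreeCat k S} (f : X ⟶ Y) :
    ∃ t : Term k S X.toList Y.toList, mk t = f :=
  Quotient.exists_rep f

theorem mk_sound {X Y : List A} {t s : Term k S X Y} (h : Term.Rel t s) : mk t = mk s :=
  Quotient.sound h

theorem mk_eqTo {X Y : List A} (h : X = Y) :
    mk (Term.eqTo h : Term k S X Y) = eqToHom (congrArg of h) := by
  subst h; rfl

theorem mk_heq {X X' Y Y' : List A} (hX : X = X') (hY : Y = Y') {t : Term k S X Y}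
    {s : Term k S X' Y'} (h : Term.Rel (Term.castT hX hY t) s) : HEq (mk t) (mk s) := by
  subst hX hY
  exact heq_of_eq (Quotient.sound h)

instance strictSMC (k : Kind) (S : MonSig A) : StrictSMC.{u} (FreeCat k S) where
  tensorObj X Y := of (X.toList ++ Y.toList)
  unit := of []
  tensorObj_assoc X Y Z := congrArg of (List.append_assoc X.toList Y.toList Z.toList)
  unit_tensorObj X := congrArg of (List.nil_append X.toList)
  tensorObj_unit X := congrArg of (List.append_nil X.toList)
  tensorHom f g := Quotient.map₂ Term.tensor (fun _ _ h _ _ h' => Term.Rel.tensor_congr h h') f g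
  tensorHom_id X Y := mk_sound (Term.Rel.tensor_id X.toList Y.toList)
  tensorHom_comp f g f' g' := by
    obtain ⟨f, rfl⟩ := mk_surj f
    obtain ⟨g, rfl⟩ := mk_surj g
    obtain ⟨f', rfl⟩ := mk_surj f'
    obtain ⟨g', rfl⟩ := mk_surj g'
    exact mk_sound (Term.Rel.tensor_comp _ _ _ _)
  tensorHom_assoc f g h := by
    obtain ⟨f, rfl⟩ := mk_surj f
    obtain ⟨g, rfl⟩ := mk_surj g
    obtain ⟨h, rfl⟩ := mk_surj h
    exact mk_heq _ _ (Term.Rel.tensor_assoc _ _ _)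
  unit_tensorHom f := by
    obtain ⟨f, rfl⟩ := mk_surj f
    exact mk_heq _ _ (Term.Rel.nil_tensor _)
  tensorHom_unit f := by
    obtain ⟨f, rfl⟩ := mk_surj f
    exact mk_heq _ _ (Term.Rel.tensor_nil _)
  braid X Y := mk (Term.braid X.toList Y.toList)
  braid_naturality f g := by
    obtain ⟨f, rfl⟩ := mk_surj f
    obtain ⟨g, rfl⟩ := mk_surj g
    exact mk_sound (Term.Rel.braid_naturality _ _)
  braid_braid X Y := mk_sound (Term.Rel.braid_braid X.toList Y.toList)
  hexagon X Y Z := by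
    refine (mk_heq _ _ (Term.Rel.hexagon X.toList Y.toList Z.toList)).trans (heq_of_eq ?_)
    rw [← mk_eqTo (List.append_assoc Y.toList X.toList Z.toList)]; rfl

theorem mk_mid (X Y Z W : FreeCat k S) :
    mk (Term.mid X.toList Y.toList Z.toList W.toList) = interchange X Y Z W := by
  unfold interchange
  rw [← mk_eqTo (Term.mid_eq X.toList Y.toList Z.toList W.toList),
    ← mk_eqTo (Term.mid_eq X.toList Z.toList Y.toList W.toList).symm]
  rfl

/-- The CD-structure of a free category of kind `cd` or `hyp`. -/
@[reducible]
def cdCat (S : MonSig A) (h : k.HasCopy) : CDCat (FreeCat k S) where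
  copy X := mk (Term.copy h X.toList)
  del X := mk (Term.del h X.toList)
  copy_comm X := mk_sound (Term.Rel.copy_comm h X.toList)
  copy_assoc X := mk_heq _ _ (Term.Rel.copy_assoc h X.toList)
  copy_del X := mk_heq _ _ (Term.Rel.copy_del h X.toList)
  copy_tensor X Y := by
    rw [← mk_mid]
    exact mk_sound (Term.Rel.copy_tensor h X.toList Y.toList)
  copy_unit := mk_heq _ _ (Term.Rel.copy_nil h)
  del_tensor X Y := mk_heq _ _ (Term.Rel.del_tensor h X.toList Y.toList)
  del_unit := mk_sound (Term.Rel.del_nil h)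

/-- The monoids of a free category of kind `hyp`. -/
@[reducible]
def hypCat (S : MonSig A) (h : k.HasCompare) :
    letI := cdCat S h.hasCopy
    HypCat (FreeCat k S) :=
  letI := cdCat S h.hasCopy
  { compare X := mk (Term.compare h X.toList)
    omni X := mk (Term.omni h X.toList)
    compare_comm X := mk_sound (Term.Rel.compare_comm h X.toList)
    compare_assoc X := mk_heq _ _ (Term.Rel.compare_assoc h X.toList)
    omni_compare X := mk_heq _ _ (Term.Rel.omni_compare h X.toList)
    compare_tensor X Y := by
      rw [← mk_mid]
      exact mk_sound (Term.Rel.compare_tensor h X.toList Y.toList)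
    compare_unit := mk_heq _ _ (Term.Rel.compare_nil h)
    omni_tensor X Y := mk_heq _ _ (Term.Rel.omni_tensor h X.toList Y.toList)
    omni_unit := mk_sound (Term.Rel.omni_nil h)
    special X := mk_sound (Term.Rel.special h X.toList)
    frobenius_left X := by
      rw [← mk_eqTo (List.append_assoc X.toList X.toList X.toList)]
      exact mk_sound (Term.Rel.frobenius_left h X.toList)
    frobenius_right X := by
      rw [← mk_eqTo (List.append_assoc X.toList X.toList X.toList).symm]
      exact mk_sound (Term.Rel.frobenius_right h X.toList) }

instance (S : MonSig A) : CDCat (FreeCat .cd S) := cdCat S trivial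

instance (S : MonSig A) : CDCat (FreeCat .hyp S) := cdCat S trivial

instance (S : MonSig A) : HypCat (FreeCat .hyp S) := hypCat (k := .hyp) S trivial

/-- A generator, as a morphism of the free category. -/
def gen (k : Kind) (S : MonSig A) (σ : S.Gen) : (of (S.dom σ) : FreeCat k S) ⟶ of (S.cod σ) :=
  mk (Term.gen σ)

/-! The universal property: a functor out of a free category is determined by a monoid
homomorphism `o` on objects and by the images of the generators. -/

section Lift

variable {D : Type w} [StrictSMC.{v} D] (c : k.HasCopy → CDCat D)
  (c' : ∀ h : k.HasCompare, @HypCat D _ (c h.hasCopy)) (o : List A → D)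
  (ho : o [] = StrictSMC.unit) (ho' : ∀ X Y : List A, o (X ++ Y) = o X ⊠ o Y)
  (g : ∀ σ : S.Gen, o (S.dom σ) ⟶ o (S.cod σ))

/-- The interpretation of a diagram. -/
def interp : ∀ {X Y : List A}, Term k S X Y → (o X ⟶ o Y)
  | _, _, .gen σ => g σ
  | _, _, .id X => 𝟙 (o X)
  | _, _, .comp s t => interp s ≫ interp t
  | _, _, .tensor s t => castHom (ho' _ _).symm (ho' _ _).symm (interp s ⊠ₕ interp t)
  | _, _, .braid X Y =>
      castHom (ho' _ _).symm (ho' _ _).symm (StrictSMC.braid (o X) (o Y))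
  | _, _, .copy h X => castHom rfl (ho' _ _).symm ((c h).copy (o X))
  | _, _, .del h X => castHom rfl ho.symm ((c h).del (o X))
  | _, _, .compare h X => castHom (ho' _ _).symm rfl ((c' h).compare (o X))
  | _, _, .omni h X => castHom ho.symm rfl ((c' h).omni (o X))

theorem interp_eqTo {X Y : List A} (h : X = Y) :
    interp c c' o ho ho' g (Term.eqTo h : Term k S X Y) = eqToHom (congrArg o h) := by
  subst h; rfl

theorem interp_castT {X X' Y Y' : List A} (hX : X = X') (hY : Y = Y') (t : Term k S X Y) :
    HEq (interp c c' o ho ho' g (Term.castT hX hY t)) (interp c c' o ho ho' g t) := by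
  subst hX hY; rfl

local notation "Φ" => interp c c' o ho ho' g

theorem interp_tensor {X Y X' Y' : List A} (s : Term k S X Y) (t : Term k S X' Y') :
    HEq (Φ (.tensor s t)) (Φ s ⊠ₕ Φ t) := castHom_heq _ _ _

theorem interp_mid (X Y Z W : List A) :
    HEq (Φ (Term.mid X Y Z W)) (interchange (o X) (o Y) (o Z) (o W)) := by
  unfold Term.mid interchange
  refine comp_heq_comp (by simp only [ho']) (by simp only [ho']) (by simp only [ho']) ?_
    (comp_heq_comp (by simp only [ho']) (by simp only [ho']) (by simp only [ho']) ?_ ?_)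
  · rw [interp_eqTo]
    exact eqToHom_heq _ _ (by simp only [ho'])
  · refine (interp_tensor c c' o ho ho' g _ _).trans ?_
    refine tensorHom_heq (by simp only [ho']) (by simp only [ho']) rfl rfl ?_ HEq.rfl
    refine (interp_tensor c c' o ho ho' g _ _).trans ?_
    exact tensorHom_heq rfl rfl (by simp only [ho']) (by simp only [ho']) HEq.rfl
      (castHom_heq _ _ _)
  · rw [interp_eqTo]
    exact eqToHom_heq _ _ (by simp only [ho'])

theorem copy_heq (h : k.HasCopy) {X Y : D} (e : X = Y) : HEq ((c h).copy X) ((c h).copy Y) := by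
  subst e; rfl

theorem del_heq (h : k.HasCopy) {X Y : D} (e : X = Y) : HEq ((c h).del X) ((c h).del Y) := by
  subst e; rfl

theorem compare_heq (h : k.HasCompare) {X Y : D} (e : X = Y) :
    HEq ((c' h).compare X) ((c' h).compare Y) := by
  subst e; rfl

theorem omni_heq (h : k.HasCompare) {X Y : D} (e : X = Y) :
    HEq ((c' h).omni X) ((c' h).omni Y) := by
  subst e; rfl

theorem interp_sound {X Y : List A} {s t : Term k S X Y} (h : Term.Rel s t) : Φ s = Φ t := by
  have cst : ∀ {X X' Y Y' : List A} (hX : X = X') (hY : Y = Y') (t : Term k S X Y),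
      HEq (Φ (Term.castT hX hY t)) (Φ t) := interp_castT c c' o ho ho' g
  have tns : ∀ {X Y X' Y' : List A} (s : Term k S X Y) (t : Term k S X' Y'),
      HEq (Φ (.tensor s t)) (Φ s ⊠ₕ Φ t) := interp_tensor c c' o ho ho' g
  have tns' : ∀ {X Y X' Y' : List A} (s : Term k S X Y) (t : Term k S X' Y')
      {P Q P' Q' : D} (_ : o X = P) (_ : o Y = Q) (_ : o X' = P') (_ : o Y' = Q')
      {f : P ⟶ Q} {f' : P' ⟶ Q'}, HEq (Φ s) f → HEq (Φ t) f' →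
      HEq (Φ (.tensor s t)) (f ⊠ₕ f') := by
    intro _ _ _ _ s t _ _ _ _ e₁ e₂ e₃ e₄ _ _ h₁ h₂
    exact (tns s t).trans (tensorHom_heq e₁ e₂ e₃ e₄ h₁ h₂)
  have brd : ∀ X Y : List A, HEq (Φ (.braid X Y)) (StrictSMC.braid (o X) (o Y)) :=
    fun X Y => castHom_heq _ _ _
  have cpy : ∀ (h : k.HasCopy) (X : List A), HEq (Φ (.copy h X)) ((c h).copy (o X)) :=
    fun h X => castHom_heq _ _ _
  have dl : ∀ (h : k.HasCopy) (X : List A), HEq (Φ (.del h X)) ((c h).del (o X)) :=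
    fun h X => castHom_heq _ _ _
  have cmp : ∀ (h : k.HasCompare) (X : List A),
      HEq (Φ (.compare h X)) ((c' h).compare (o X)) := fun h X => castHom_heq _ _ _
  have omn : ∀ (h : k.HasCompare) (X : List A), HEq (Φ (.omni h X)) ((c' h).omni (o X)) :=
    fun h X => castHom_heq _ _ _
  have idm : ∀ X : List A, HEq (Φ (.id X)) (𝟙 (o X)) := fun X => HEq.rfl
  have mid := interp_mid c c' o ho ho' g
  induction h with
  | refl f => rfl
  | symm _ ih => exact ih.symm
  | trans _ _ ih ih' => exact ih.trans ih'
  | comp_congr _ _ ih ih' => simp only [interp, ih, ih']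
  | tensor_congr _ _ ih ih' => simp only [interp, ih, ih']
  | id_comp f => simp [interp]
  | comp_id f => simp [interp]
  | assoc f g h => simp [interp]
  | tensor_id X Y =>
    refine eq_of_heq ((tns _ _).trans ?_)
    simp only [interp, StrictSMC.tensorHom_id]
    exact id_heq (ho' _ _).symm
  | tensor_comp f g f' g' =>
    refine eq_of_heq ((tns _ _).trans ?_)
    simp only [interp.eq_3, StrictSMC.tensorHom_comp]
    exact comp_heq_comp (ho' _ _).symm (ho' _ _).symm (ho' _ _).symm (tns _ _).symm (tns _ _).symm
  | tensor_assoc f f' f'' =>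
    refine eq_of_heq ((cst _ _ _).trans ?_)
    refine (tns' _ _ (ho' _ _) (ho' _ _) rfl rfl (tns _ _) HEq.rfl).trans ?_
    refine (StrictSMC.tensorHom_assoc _ _ _).trans ?_
    exact (tns' _ _ rfl rfl (ho' _ _) (ho' _ _) HEq.rfl (tns _ _)).symm
  | nil_tensor f =>
    refine eq_of_heq ((cst _ _ _).trans ?_)
    refine (tns' _ _ ho ho rfl rfl ((idm _).trans (id_heq ho)) HEq.rfl).trans ?_
    exact StrictSMC.unit_tensorHom _
  | tensor_nil f =>
    refine eq_of_heq ((cst _ _ _).trans ?_)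
    refine (tns' _ _ rfl rfl ho ho HEq.rfl ((idm _).trans (id_heq ho))).trans ?_
    exact StrictSMC.tensorHom_unit _
  | braid_naturality f f' =>
    refine eq_of_heq ?_
    simp only [interp.eq_3]
    refine (comp_heq_comp (ho' _ _) (ho' _ _) (ho' _ _) (tns _ _) (brd _ _)).trans ?_
    rw [StrictSMC.braid_naturality]
    exact (comp_heq_comp (ho' _ _) (ho' _ _) (ho' _ _) (brd _ _) (tns _ _)).symm
  | braid_braid X Y =>
    refine eq_of_heq ?_
    simp only [interp.eq_3]
    refine (comp_heq_comp (ho' _ _) (ho' _ _) (ho' _ _) (brd _ _) (brd _ _)).trans ?_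
    rw [StrictSMC.braid_braid]
    exact id_heq (ho' _ _).symm
  | hexagon X Y Z =>
    refine eq_of_heq ((cst _ _ _).trans ((brd _ _).trans ?_))
    refine (braid_heq rfl (ho' _ _)).trans ((StrictSMC.hexagon _ _ _).trans ?_)
    simp only [interp.eq_3]
    refine comp_heq_comp (by simp only [ho']) (by simp only [ho']) (by simp only [ho'])
      (tns' _ _ (ho' _ _) (ho' _ _) rfl rfl (brd _ _) (idm _)).symm
      (comp_heq_comp (by simp only [ho']) (by simp only [ho']) (by simp only [ho']) ?_
      (tns' _ _ rfl rfl (ho' _ _) (ho' _ _) (idm _) (brd _ _)).symm)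
    rw [interp_eqTo]
    exact eqToHom_heq _ _ (by simp only [ho'])
  | copy_comm h X =>
    refine eq_of_heq ?_
    simp only [interp.eq_3]
    refine (comp_heq_comp rfl (ho' _ _) (ho' _ _) (cpy _ _) (brd _ _)).trans ?_
    rw [(c h).copy_comm]
    exact (cpy _ _).symm
  | copy_assoc h X =>
    refine eq_of_heq ((cst _ _ _).trans ?_)
    simp only [interp.eq_3]
    refine (comp_heq_comp rfl (ho' _ _) (by simp only [ho']) (cpy _ _)
      (tns' _ _ rfl (ho' _ _) rfl rfl (cpy _ _) (idm _))).trans ?_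
    refine ((c h).copy_assoc (o X)).trans ?_
    exact (comp_heq_comp rfl (ho' _ _) (by simp only [ho']) (cpy _ _)
      (tns' _ _ rfl rfl rfl (ho' _ _) (idm _) (cpy _ _))).symm
  | copy_del h X =>
    refine eq_of_heq ((cst _ _ _).trans ?_)
    simp only [interp.eq_3]
    refine (comp_heq_comp rfl (ho' _ _) (by simp only [ho', ho]) (cpy _ _)
      (tns' _ _ rfl ho rfl rfl (dl _ _) (idm _))).trans ?_
    exact (c h).copy_del (o X)
  | copy_tensor h X Y =>
    refine eq_of_heq ((cpy _ _).trans ((copy_heq c h (ho' _ _)).trans ?_))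
    rw [(c h).copy_tensor]
    simp only [interp.eq_3]
    exact comp_heq_comp (ho' _ _).symm (by simp only [ho']) (by simp only [ho'])
      (tns' _ _ rfl (ho' _ _) rfl (ho' _ _) (cpy _ _) (cpy _ _)).symm (mid _ _ _ _).symm
  | copy_nil h =>
    refine eq_of_heq ((cst _ _ _).trans ((cpy _ _).trans ((copy_heq c h ho).trans ?_)))
    exact (c h).copy_unit.trans (id_heq ho.symm)
  | del_tensor h X Y =>
    refine eq_of_heq ((cst _ _ _).trans ((dl _ _).trans ((del_heq c h (ho' _ _)).trans ?_)))
    exact ((c h).del_tensor _ _).trans (tns' _ _ rfl ho rfl ho (dl _ _) (dl _ _)).symm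
  | del_nil h =>
    refine eq_of_heq ((dl _ _).trans ((del_heq c h ho).trans ?_))
    rw [(c h).del_unit]
    exact id_heq ho.symm
  | compare_comm h X =>
    refine eq_of_heq ?_
    simp only [interp.eq_3]
    refine (comp_heq_comp (ho' _ _) (ho' _ _) rfl (brd _ _) (cmp _ _)).trans ?_
    rw [(c' h).compare_comm]
    exact (cmp _ _).symm
  | compare_assoc h X =>
    refine eq_of_heq ((cst _ _ _).trans ?_)
    simp only [interp.eq_3]
    refine (comp_heq_comp (by simp only [ho']) (ho' _ _) rfl
      (tns' _ _ (ho' _ _) rfl rfl rfl (cmp _ _) (idm _)) (cmp _ _)).trans ?_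
    refine ((c' h).compare_assoc (o X)).trans ?_
    exact (comp_heq_comp (by simp only [ho']) (ho' _ _) rfl
      (tns' _ _ rfl rfl (ho' _ _) rfl (idm _) (cmp _ _)) (cmp _ _)).symm
  | omni_compare h X =>
    refine eq_of_heq ((cst _ _ _).trans ?_)
    simp only [interp.eq_3]
    refine (comp_heq_comp (by simp only [ho', ho]) (ho' _ _) rfl
      (tns' _ _ ho rfl rfl rfl (omn _ _) (idm _)) (cmp _ _)).trans ?_
    exact (c' h).omni_compare (o X)
  | compare_tensor h X Y =>
    refine eq_of_heq ((cmp _ _).trans ((compare_heq c c' h (ho' _ _)).trans ?_))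
    rw [(c' h).compare_tensor]
    simp only [interp.eq_3]
    exact comp_heq_comp (by simp only [ho']) (by simp only [ho']) (ho' _ _).symm
      (mid _ _ _ _).symm (tns' _ _ (ho' _ _) rfl (ho' _ _) rfl (cmp _ _) (cmp _ _)).symm
  | compare_nil h =>
    refine eq_of_heq ((cst _ _ _).trans ((cmp _ _).trans ((compare_heq c c' h ho).trans ?_)))
    exact (c' h).compare_unit.trans (id_heq ho.symm)
  | omni_tensor h X Y =>
    refine eq_of_heq ((cst _ _ _).trans ((omn _ _).trans ((omni_heq c c' h (ho' _ _)).trans ?_)))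
    exact ((c' h).omni_tensor _ _).trans (tns' _ _ ho rfl ho rfl (omn _ _) (omn _ _)).symm
  | omni_nil h =>
    refine eq_of_heq ((omn _ _).trans ((omni_heq c c' h ho).trans ?_))
    rw [(c' h).omni_unit]
    exact id_heq ho.symm
  | special h X =>
    refine eq_of_heq ?_
    simp only [interp.eq_3]
    refine (comp_heq_comp rfl (ho' _ _) rfl (cpy _ _) (cmp _ _)).trans ?_
    exact heq_of_eq ((c' h).special (o X))
  | frobenius_left h X =>
    refine eq_of_heq ?_
    simp only [interp.eq_3]
    refine (comp_heq_comp (by simp only [ho']) (by simp only [ho']) (by simp only [ho'])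
      (tns' _ _ rfl (ho' _ _) rfl rfl (cpy _ _) (idm _))
      (comp_heq_comp (by simp only [ho']) (by simp only [ho']) (by simp only [ho']) ?_
      (tns' _ _ rfl rfl (ho' _ _) rfl (idm _) (cmp _ _)))).trans
      ((heq_of_eq ((c' h).frobenius_left (o X))).trans
      (comp_heq_comp (ho' _ _).symm rfl (ho' _ _).symm (cmp _ _).symm (cpy _ _).symm))
    rw [interp_eqTo]
    exact eqToHom_heq _ _ (by simp only [ho'])
  | frobenius_right h X =>
    refine eq_of_heq ?_
    simp only [interp.eq_3]
    refine (comp_heq_comp (by simp only [ho']) (by simp only [ho']) (by simp only [ho'])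
      (tns' _ _ rfl rfl rfl (ho' _ _) (idm _) (cpy _ _))
      (comp_heq_comp (by simp only [ho']) (by simp only [ho']) (by simp only [ho']) ?_
      (tns' _ _ (ho' _ _) rfl rfl rfl (cmp _ _) (idm _)))).trans
      ((heq_of_eq ((c' h).frobenius_right (o X))).trans
      (comp_heq_comp (ho' _ _).symm rfl (ho' _ _).symm (cmp _ _).symm (cpy _ _).symm))
    rw [interp_eqTo]
    exact eqToHom_heq _ _ (by simp only [ho'])

/-- The functor out of a free category that is freely obtained from its values on generators. -/
def lift : FreeCat k S ⥤ D where
  obj X := o X.toList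
  map f := Quotient.lift (fun t => Φ t) (fun _ _ h => interp_sound c c' o ho ho' g h) f
  map_id _ := rfl
  map_comp f f' := by
    obtain ⟨f, rfl⟩ := mk_surj f
    obtain ⟨f', rfl⟩ := mk_surj f'
    rfl

theorem lift_gen (σ : S.Gen) : (lift c c' o ho ho' g).map (gen k S σ) = g σ := rfl

theorem lift_isSym : IsSymFunctor (lift c c' o ho ho' g) where
  obj_unit := ho
  obj_tensor X Y := ho' X.toList Y.toList
  map_tensor f f' := by
    obtain ⟨f, rfl⟩ := mk_surj f
    obtain ⟨f', rfl⟩ := mk_surj f'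
    exact interp_tensor c c' o ho ho' g f f'
  map_braid X Y := castHom_heq (ho' X.toList Y.toList).symm (ho' Y.toList X.toList).symm _

theorem lift_isCD (h : k.HasCopy) :
    @IsCDFunctor (FreeCat k S) _ (cdCat S h) D _ (c h) (lift c c' o ho ho' g) :=
  letI := cdCat S h
  letI := c h
  { lift_isSym c c' o ho ho' g with
    map_copy _ := castHom_heq rfl (ho' _ _).symm _
    map_del _ := castHom_heq rfl ho.symm _ }

theorem lift_isHyp (h : k.HasCompare) :
    @IsHypFunctor (FreeCat k S) _ (cdCat S h.hasCopy) (hypCat S h) D _ (c h.hasCopy) (c' h)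
      (lift c c' o ho ho' g) :=
  letI := cdCat S h.hasCopy
  letI := hypCat S h
  letI := c h.hasCopy
  letI := c' h
  { lift_isCD c c' o ho ho' g h.hasCopy with
    map_compare _ := castHom_heq (ho' _ _).symm rfl _
    map_omni _ := castHom_heq ho.symm rfl _ }

end Lift

end FreeCat

end Free

end PGM
namespace PGM

/-! ### Finite sets, nonnegative matrices, stochastic matrices -/

/-- To make the categories of matrices strict, their objects are finite sets whose elements are
lists, all of the same length, over an alphabet `U`; the monoidal product is concatenation. -/
@[ext]
structure FinObj (U : Type u) where
  len : ℕ
  carrier : Finset (List U)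
  length_eq : ∀ l ∈ carrier, l.length = len

namespace FinObj

variable {U : Type u}

/-- The elements of a finite set. -/
def El (X : FinObj U) : Type u := {l : List U // l ∈ X.carrier}

theorem El.ext {X : FinObj U} {x y : X.El} (h : x.1 = y.1) : x = y := Subtype.ext h

instance (X : FinObj U) : Fintype X.El := inferInstanceAs (Fintype {l // l ∈ X.carrier})

noncomputable instance (X : FinObj U) : DecidableEq X.El := Classical.decEq _

open Classical in
noncomputable def prod (X Y : FinObj U) : FinObj U where
  len := X.len + Y.len
  carrier := Finset.image₂ (· ++ ·) X.carrier Y.carrier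
  length_eq l hl := by
    obtain ⟨a, ha, b, hb, rfl⟩ := Finset.mem_image₂.1 hl
    rw [List.length_append, X.length_eq a ha, Y.length_eq b hb]

def one : FinObj U where
  len := 0
  carrier := {[]}
  length_eq l hl := by rw [Finset.mem_singleton.1 hl]; rfl

theorem mem_prod {X Y : FinObj U} {l : List U} :
    l ∈ (X.prod Y).carrier ↔ ∃ a ∈ X.carrier, ∃ b ∈ Y.carrier, a ++ b = l := by
  classical exact Finset.mem_image₂

theorem prod_assoc (X Y Z : FinObj U) : (X.prod Y).prod Z = X.prod (Y.prod Z) := by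
  ext l
  · exact Nat.add_assoc _ _ _
  · simp only [mem_prod]
    constructor
    · rintro ⟨_, ⟨a, ha, b, hb, rfl⟩, c, hc, rfl⟩
      exact ⟨a, ha, _, ⟨b, hb, c, hc, rfl⟩, by simp⟩
    · rintro ⟨a, ha, _, ⟨b, hb, c, hc, rfl⟩, rfl⟩
      exact ⟨_, ⟨a, ha, b, hb, rfl⟩, c, hc, by simp⟩

theorem one_prod (X : FinObj U) : one.prod X = X := by
  ext l
  · exact Nat.zero_add _
  · simp [mem_prod, one]

theorem prod_one (X : FinObj U) : X.prod one = X := by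
  ext l
  · exact Nat.add_zero _
  · simp [mem_prod, one]

/-- The unique element of the monoidal unit. -/
def star : (one : FinObj U).El := ⟨[], Finset.mem_singleton_self _⟩

theorem eq_star (x : (one : FinObj U).El) : x = star := El.ext (Finset.mem_singleton.1 x.2)

/-- Elements of `X ⊗ Y` are pairs. -/
noncomputable def pair {X Y : FinObj U} (x : X.El) (y : Y.El) : (X.prod Y).El :=
  ⟨x.1 ++ y.1, mem_prod.2 ⟨x.1, x.2, y.1, y.2, rfl⟩⟩

def fst {X Y : FinObj U} (p : (X.prod Y).El) : X.El :=
  ⟨p.1.take X.len, by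
    obtain ⟨a, ha, b, hb, h⟩ := mem_prod.1 p.2
    rw [← h, ← X.length_eq a ha, List.take_left]; exact ha⟩

def snd {X Y : FinObj U} (p : (X.prod Y).El) : Y.El :=
  ⟨p.1.drop X.len, by
    obtain ⟨a, ha, b, hb, h⟩ := mem_prod.1 p.2
    rw [← h, ← X.length_eq a ha, List.drop_left]; exact hb⟩

@[simp]
theorem fst_pair {X Y : FinObj U} (x : X.El) (y : Y.El) : fst (pair x y) = x :=
  El.ext (by
    change (x.1 ++ y.1).take X.len = x.1
    rw [← X.length_eq x.1 x.2, List.take_left])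

@[simp]
theorem snd_pair {X Y : FinObj U} (x : X.El) (y : Y.El) : snd (pair x y) = y :=
  El.ext (by
    change (x.1 ++ y.1).drop X.len = y.1
    rw [← X.length_eq x.1 x.2, List.drop_left])

@[simp]
theorem pair_fst_snd {X Y : FinObj U} (p : (X.prod Y).El) : pair (fst p) (snd p) = p :=
  El.ext (List.take_append_drop _ _)

/-- Elements of `X ⊗ Y` are pairs. -/
noncomputable def prodEquiv (X Y : FinObj U) : (X.prod Y).El ≃ X.El × Y.El where
  toFun p := (fst p, snd p)
  invFun q := pair q.1 q.2
  left_inv p := pair_fst_snd p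
  right_inv q := by simp

theorem pair_inj {X Y : FinObj U} {x x' : X.El} {y y' : Y.El} :
    pair x y = pair x' y' ↔ x = x' ∧ y = y' := by
  constructor
  · intro h
    exact ⟨by rw [← fst_pair x y, h, fst_pair], by rw [← snd_pair x y, h, snd_pair]⟩
  · rintro ⟨rfl, rfl⟩; rfl

theorem sum_prod {M : Type*} [AddCommMonoid M] {X Y : FinObj U} (f : (X.prod Y).El → M) :
    ∑ p, f p = ∑ x : X.El, ∑ y : Y.El, f (pair x y) := by
  rw [← Fintype.sum_prod_type']
  exact Fintype.sum_equiv (prodEquiv X Y) _ _ fun p => by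
    change f p = f (pair (fst p) (snd p)); rw [pair_fst_snd]

end FinObj

open FinObj

variable {U : Type u}

/-- Matrices with nonnegative real entries, `M y x` being the entry written `M(y ∣ x)`. -/
abbrev Mx (X Y : FinObj U) : Type u := Matrix Y.El X.El ℝ≥0

namespace Mx

/-- The Kronecker product. -/
def tensor {X Y X' Y' : FinObj U} (f : Mx X Y) (f' : Mx X' Y') : Mx (X.prod X') (Y.prod Y') :=
  fun q p => f (fst q) (fst p) * f' (snd q) (snd p)

/-- The matrix of a function. -/
noncomputable def ofFun {X Y : FinObj U} (φ : X.El → Y.El) : Mx X Y :=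
  fun y x => if y = φ x then 1 else 0

theorem heq_iff {X X' Y Y' : FinObj U} (hX : X = X') (hY : Y = Y') {f : Mx X Y} {f' : Mx X' Y'}
    (h : ∀ y x y' x', y.1 = y'.1 → x.1 = x'.1 → f y x = f' y' x') : HEq f f' := by
  subst hX hY
  exact heq_of_eq (Matrix.ext fun y x => h y x y x rfl rfl)

theorem ofFun_heq {X X' Y Y' : FinObj U} (hX : X = X') (hY : Y = Y') {φ : X.El → Y.El}
    {φ' : X'.El → Y'.El} (h : ∀ x x', x.1 = x'.1 → (φ x).1 = (φ' x').1) :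
    HEq (ofFun φ) (ofFun φ') := by
  subst hX hY
  obtain rfl : φ = φ' := funext fun x => El.ext (h x x rfl)
  rfl

theorem ofFun_id (X : FinObj U) : ofFun (fun x : X.El => x) = 1 := by
  ext y x; simp [ofFun, Matrix.one_apply]

theorem ofFun_mul {X Y Z : FinObj U} (ψ : Y.El → Z.El) (φ : X.El → Y.El) :
    ofFun ψ * ofFun φ = ofFun (fun x => ψ (φ x)) := by
  ext z x; simp [ofFun, Matrix.mul_apply]

theorem ofFun_tensor {X Y X' Y' : FinObj U} (φ : X.El → Y.El) (φ' : X'.El → Y'.El) :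
    tensor (ofFun φ) (ofFun φ') = ofFun (fun p => pair (φ (fst p)) (φ' (snd p))) := by
  ext q p
  obtain ⟨y, y', rfl⟩ : ∃ y y', q = pair y y' := ⟨_, _, (pair_fst_snd q).symm⟩
  simp only [tensor, ofFun, fst_pair, snd_pair, pair_inj, ite_and]
  split_ifs <;> simp

theorem tensor_mul {X Y Z X' Y' Z' : FinObj U} (f : Mx X Y) (g : Mx Y Z) (f' : Mx X' Y')
    (g' : Mx Y' Z') : tensor (g * f) (g' * f') = tensor g g' * tensor f f' := by
  ext q p
  simp only [tensor, Matrix.mul_apply, sum_prod, fst_pair, snd_pair, Finset.sum_mul_sum]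
  refine congrArg _ (Finset.sum_congr rfl fun _ _ => Finset.sum_congr rfl fun _ _ => ?_)
  exact mul_mul_mul_comm _ _ _ _

theorem tensor_one {X Y : FinObj U} : tensor (1 : Mx X X) (1 : Mx Y Y) = 1 := by
  rw [← ofFun_id, ← ofFun_id, ofFun_tensor, ← ofFun_id]; simp

theorem fst_val {X Y : FinObj U} (p : (X.prod Y).El) : (fst p).1 = p.1.take X.len := rfl

theorem snd_val {X Y : FinObj U} (p : (X.prod Y).El) : (snd p).1 = p.1.drop X.len := rfl

theorem pair_val {X Y : FinObj U} (x : X.El) (y : Y.El) : (pair x y).1 = x.1 ++ y.1 := rfl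

theorem prod_len (X Y : FinObj U) : (X.prod Y).len = X.len + Y.len := rfl

theorem one_len : (one : FinObj U).len = 0 := rfl

theorem val_length {X : FinObj U} (x : X.El) : x.1.length = X.len := X.length_eq _ x.2

theorem tensor_assoc {X Y X' Y' X'' Y'' : FinObj U} (f : Mx X Y) (f' : Mx X' Y')
    (f'' : Mx X'' Y'') : HEq (tensor (tensor f f') f'') (tensor f (tensor f' f'')) := by
  refine heq_iff (prod_assoc _ _ _) (prod_assoc _ _ _) fun q p q' p' hq hp => ?_
  have h₁ : ∀ {A B D : FinObj U} (p : ((A.prod B).prod D).El) (p' : (A.prod (B.prod D)).El),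
      p.1 = p'.1 → fst (fst p) = fst p' ∧ snd (fst p) = fst (snd p') ∧
        snd p = snd (snd p') := by
    intro A B D p p' h
    refine ⟨El.ext ?_, El.ext ?_, El.ext ?_⟩ <;>
      simp only [fst_val, snd_val, h, prod_len, List.take_take, List.drop_drop, List.drop_take]
    · rw [Nat.min_eq_left (Nat.le_add_right _ _)]
    · rw [Nat.add_sub_cancel_left]
  obtain ⟨a, b, c⟩ := h₁ p p' hp
  obtain ⟨a', b', c'⟩ := h₁ q q' hq
  simp only [tensor, a, b, c, a', b', c', mul_assoc]

theorem one_tensor {X Y : FinObj U} (f : Mx X Y) : HEq (tensor (1 : Mx one one) f) f := by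
  refine heq_iff (one_prod _) (one_prod _) fun q p q' p' hq hp => ?_
  have e : ∀ {A : FinObj U} (p : (one.prod A).El) (p' : A.El), p.1 = p'.1 → snd p = p' :=
    fun p p' h => El.ext (by simp [snd_val, h, one_len])
  have e' : (1 : Mx (one : FinObj U) one) (fst q) (fst p) = 1 := by
    rw [eq_star (fst q), eq_star (fst p), Matrix.one_apply_eq]
  change _ * _ = _
  rw [e', e p p' hp, e q q' hq]; simp

theorem tensor_one' {X Y : FinObj U} (f : Mx X Y) : HEq (tensor f (1 : Mx one one)) f := by
  refine heq_iff (prod_one _) (prod_one _) fun q p q' p' hq hp => ?_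
  have e : ∀ {A : FinObj U} (p : (A.prod one).El) (p' : A.El), p.1 = p'.1 → fst p = p' :=
    fun p p' h => El.ext (by simp [fst_val, h, ← val_length p'])
  have e' : (1 : Mx (one : FinObj U) one) (snd q) (snd p) = 1 := by
    rw [eq_star (snd q), eq_star (snd p), Matrix.one_apply_eq]
  change _ * _ = _
  rw [e', e p p' hp, e q q' hq]; simp

noncomputable def braid (X Y : FinObj U) : Mx (X.prod Y) (Y.prod X) :=
  ofFun fun p => pair (snd p) (fst p)

/-- `copy (y, z ∣ x)` is `1` if `x = y = z` and `0` otherwise. -/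
noncomputable def copy (X : FinObj U) : Mx X (X.prod X) := ofFun fun x => pair x x

/-- `del ( ∣ x) = 1`. -/
noncomputable def del (X : FinObj U) : Mx X one := ofFun fun _ => star

/-- `compare (z ∣ x, y)` is `1` if `x = y = z` and `0` otherwise. -/
noncomputable def compare (X : FinObj U) : Mx (X.prod X) X := (copy X).transpose

/-- `omni (x ∣ ) = 1`. -/
noncomputable def omni (X : FinObj U) : Mx one X := (del X).transpose

theorem del_apply (X : FinObj U) (s : (one : FinObj U).El) (x : X.El) : del X s x = 1 := by
  simp [del, ofFun, eq_star s]

theorem omni_apply (X : FinObj U) (x : X.El) (s : (one : FinObj U).El) : omni X x s = 1 :=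
  del_apply X s x

theorem copy_apply (X : FinObj U) (y z x : X.El) :
    copy X (pair y z) x = if x = y ∧ x = z then 1 else 0 := by
  simp [copy, ofFun, pair_inj, eq_comm]

theorem compare_apply (X : FinObj U) (x y z : X.El) :
    compare X z (pair x y) = if z = x ∧ z = y then 1 else 0 :=
  copy_apply X x y z

theorem transpose_tensor {X Y X' Y' : FinObj U} (f : Mx X Y) (f' : Mx X' Y') :
    (tensor f f').transpose = tensor (X := Y) (Y := X) (X' := Y') (Y' := X')
      f.transpose f'.transpose := rfl

theorem transpose_braid (X Y : FinObj U) : (braid X Y).transpose = braid Y X := by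
  ext q p
  obtain ⟨y, y', rfl⟩ : ∃ y y', q = pair y y' := ⟨_, _, (pair_fst_snd q).symm⟩
  obtain ⟨x, x', rfl⟩ : ∃ x x', p = pair x x' := ⟨_, _, (pair_fst_snd p).symm⟩
  simp only [braid, ofFun, Matrix.transpose_apply, fst_pair, snd_pair, pair_inj]
  simp only [eq_comm, and_comm]

theorem transpose_heq {X X' Y Y' : FinObj U} (hX : X = X') (hY : Y = Y') {f : Mx X Y}
    {f' : Mx X' Y'} (h : HEq f f') : HEq f.transpose f'.transpose := by
  subst hX hY h; rfl

theorem braid_naturality {X Y X' Y' : FinObj U} (f : Mx X Y) (f' : Mx X' Y') :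
    braid Y Y' * tensor f f' = tensor f' f * braid X X' := by
  ext q p
  obtain ⟨y', y, rfl⟩ : ∃ y' y, q = pair y' y := ⟨_, _, (pair_fst_snd q).symm⟩
  obtain ⟨x, x', rfl⟩ : ∃ x x', p = pair x x' := ⟨_, _, (pair_fst_snd p).symm⟩
  have h₁ : (braid Y Y' * tensor f f') (pair y' y) (pair x x') = f y x * f' y' x' := by
    rw [← transpose_braid]
    simp only [Matrix.mul_apply, Matrix.transpose_apply, braid, ofFun, tensor]
    simp
  have h₂ : (tensor f' f * braid X X') (pair y' y) (pair x x') = f' y' x' * f y x := by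
    simp only [Matrix.mul_apply, braid, ofFun, tensor]
    simp
  rw [h₁, h₂, mul_comm]

theorem braid_braid (X Y : FinObj U) : braid Y X * braid X Y = 1 := by
  rw [braid, braid, ofFun_mul, ← ofFun_id]; simp

/-- The same element, in an equal set. -/
def castEl {X Y : FinObj U} (h : X = Y) (x : X.El) : Y.El := ⟨x.1, h ▸ x.2⟩

theorem castEl_val {X Y : FinObj U} (h : X = Y) (x : X.El) : (castEl h x).1 = x.1 := rfl

@[simp]
theorem castEl_assoc {X Y Z : FinObj U} (h : (X.prod Y).prod Z = X.prod (Y.prod Z)) (x : X.El)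
    (y : Y.El) (z : Z.El) : castEl h (pair (pair x y) z) = pair x (pair y z) :=
  El.ext (List.append_assoc _ _ _)

@[simp]
theorem castEl_assoc' {X Y Z : FinObj U} (h : X.prod (Y.prod Z) = (X.prod Y).prod Z) (x : X.El)
    (y : Y.El) (z : Z.El) : castEl h (pair x (pair y z)) = pair (pair x y) z :=
  El.ext (List.append_assoc _ _ _).symm

@[simp]
theorem castEl_mid {X Y Z W : FinObj U}
    (h : (X.prod Y).prod (Z.prod W) = (X.prod (Y.prod Z)).prod W) (x : X.El) (y : Y.El) (z : Z.El)
    (t : W.El) : castEl h (pair (pair x y) (pair z t)) = pair (pair x (pair y z)) t :=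
  El.ext (by simp [castEl_val, pair_val])

@[simp]
theorem castEl_mid' {X Y Z W : FinObj U}
    (h : (X.prod (Y.prod Z)).prod W = (X.prod Y).prod (Z.prod W)) (x : X.El) (y : Y.El) (z : Z.El)
    (t : W.El) : castEl h (pair (pair x (pair y z)) t) = pair (pair x y) (pair z t) :=
  El.ext (by simp [castEl_val, pair_val])

theorem exists_pair {X Y : FinObj U} (p : (X.prod Y).El) : ∃ x y, p = pair x y :=
  ⟨_, _, (pair_fst_snd p).symm⟩

theorem mul_ofFun {X Y Z : FinObj U} (f : Mx Y Z) (φ : X.El → Y.El) (z : Z.El) (x : X.El) :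
    (f * ofFun φ) z x = f z (φ x) := by
  simp [Matrix.mul_apply, ofFun]

/-- The middle-four exchange. -/
noncomputable def ic (X Y Z W : FinObj U) :
    Mx ((X.prod Y).prod (Z.prod W)) ((X.prod Z).prod (Y.prod W)) :=
  ofFun fun p => pair (pair (fst (fst p)) (fst (snd p))) (pair (snd (fst p)) (snd (snd p)))

theorem transpose_ic (X Y Z W : FinObj U) : (ic X Y Z W).transpose = ic X Z Y W := by
  ext q p
  obtain ⟨q₁, q₂, rfl⟩ := exists_pair q
  obtain ⟨p₁, p₂, rfl⟩ := exists_pair p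
  obtain ⟨a, b, rfl⟩ := exists_pair q₁
  obtain ⟨c, d, rfl⟩ := exists_pair q₂
  obtain ⟨a', b', rfl⟩ := exists_pair p₁
  obtain ⟨c', d', rfl⟩ := exists_pair p₂
  simp only [ic, ofFun, Matrix.transpose_apply, fst_pair, snd_pair, pair_inj]
  congr 1
  refine if_congr ?_ rfl rfl
  constructor
  · rintro ⟨⟨rfl, rfl⟩, rfl, rfl⟩; exact ⟨⟨rfl, rfl⟩, rfl, rfl⟩
  · rintro ⟨⟨rfl, rfl⟩, rfl, rfl⟩; exact ⟨⟨rfl, rfl⟩, rfl, rfl⟩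

theorem hexagon (X Y Z : FinObj U) : HEq (braid X (Y.prod Z))
    (tensor (1 : Mx Y Y) (braid X Z) * ofFun (castEl (prod_assoc Y X Z)) *
      tensor (braid X Y) (1 : Mx Z Z)) := by
  rw [← ofFun_id, ← ofFun_id, braid, braid, braid, ofFun_tensor, ofFun_tensor, ofFun_mul,
    ofFun_mul]
  refine ofFun_heq (prod_assoc _ _ _).symm (prod_assoc _ _ _) fun p p' h => ?_
  obtain ⟨q, c, rfl⟩ := exists_pair p'
  obtain ⟨a, b, rfl⟩ := exists_pair q
  obtain rfl : p = pair a (pair b c) := El.ext (h.trans (List.append_assoc _ _ _))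
  simp [pair_val]

theorem copy_comm (X : FinObj U) : braid X X * copy X = copy X := by
  rw [braid, copy, ofFun_mul]; simp

theorem copy_assoc (X : FinObj U) :
    HEq (tensor (copy X) (1 : Mx X X) * copy X) (tensor (1 : Mx X X) (copy X) * copy X) := by
  rw [← ofFun_id, copy, ofFun_tensor, ofFun_tensor, ofFun_mul, ofFun_mul]
  refine ofFun_heq rfl (prod_assoc _ _ _) fun x x' h => ?_
  obtain rfl := El.ext h
  simp [pair_val]

theorem copy_del (X : FinObj U) : HEq (tensor (del X) (1 : Mx X X) * copy X) (1 : Mx X X) := by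
  rw [← ofFun_id, copy, del, ofFun_tensor, ofFun_mul]
  refine ofFun_heq rfl (one_prod _) fun x x' h => ?_
  obtain rfl := El.ext h
  simp only [snd_pair]; rfl

theorem copy_tensor (X Y : FinObj U) :
    copy (X.prod Y) = ic X X Y Y * tensor (copy X) (copy Y) := by
  rw [copy, copy, copy, ofFun_tensor, ic, ofFun_mul]; simp

theorem copy_unit : HEq (copy (one : FinObj U)) (1 : Mx (one : FinObj U) one) := by
  rw [← ofFun_id, copy]
  refine ofFun_heq rfl (one_prod _) fun x x' h => ?_
  obtain rfl := El.ext h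
  rw [eq_star x]; rfl

theorem del_tensor (X Y : FinObj U) : HEq (del (X.prod Y)) (tensor (del X) (del Y)) := by
  rw [del, del, del, ofFun_tensor]
  exact ofFun_heq rfl (one_prod _).symm fun _ _ _ => rfl

theorem del_unit : del (one : FinObj U) = 1 := by
  rw [← ofFun_id, del]
  exact congrArg ofFun (funext fun x => (eq_star x).symm)

theorem special (X : FinObj U) : compare X * copy X = 1 := by
  ext z x
  rw [copy, mul_ofFun, compare_apply]
  simp [Matrix.one_apply]

theorem copy_mul_compare (X : FinObj U) (z w x y : X.El) :
    (copy X * compare X) (pair z w) (pair x y) = if z = x ∧ z = y ∧ w = x then 1 else 0 := by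
  simp only [Matrix.mul_apply, copy_apply, compare_apply]
  rw [Finset.sum_eq_single z]
  · by_cases h : z = w
    · subst h; simp; grind
    · simp [h]; grind
  · intro b _ hb; simp [hb]
  · simp

theorem frobenius_left (X : FinObj U) :
    tensor (1 : Mx X X) (compare X) * ofFun (castEl (prod_assoc X X X)) *
      tensor (copy X) (1 : Mx X X) = copy X * compare X := by
  ext q p
  obtain ⟨z, t, rfl⟩ := exists_pair q
  obtain ⟨x, y, rfl⟩ := exists_pair p
  rw [copy_mul_compare, copy, ← ofFun_id, ofFun_tensor, mul_ofFun, mul_ofFun]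
  simp only [fst_pair, snd_pair, castEl_assoc, tensor, compare_apply, ofFun]
  grind

theorem frobenius_right (X : FinObj U) :
    tensor (compare X) (1 : Mx X X) * ofFun (castEl (prod_assoc X X X).symm) *
      tensor (1 : Mx X X) (copy X) = copy X * compare X := by
  ext q p
  obtain ⟨z, t, rfl⟩ := exists_pair q
  obtain ⟨x, y, rfl⟩ := exists_pair p
  rw [copy_mul_compare, copy, ← ofFun_id, ofFun_tensor, mul_ofFun, mul_ofFun]
  simp only [fst_pair, snd_pair, castEl_assoc', tensor, compare_apply, ofFun]
  grind

theorem compare_comm (X : FinObj U) : compare X * braid X X = compare X := by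
  rw [← transpose_braid, compare, ← Matrix.transpose_mul, copy_comm]

theorem compare_assoc (X : FinObj U) : HEq (compare X * tensor (compare X) (1 : Mx X X))
    (compare X * tensor (1 : Mx X X) (compare X)) := by
  have h := transpose_heq rfl (prod_assoc _ _ _) (copy_assoc X)
  rw [Matrix.transpose_mul, Matrix.transpose_mul, transpose_tensor, transpose_tensor,
    Matrix.transpose_one] at h
  exact h

theorem omni_compare (X : FinObj U) :
    HEq (compare X * tensor (omni X) (1 : Mx X X)) (1 : Mx X X) := by
  have h := transpose_heq rfl (one_prod _) (copy_del X)
  rw [Matrix.transpose_mul, transpose_tensor, Matrix.transpose_one] at h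
  exact h

theorem compare_tensor (X Y : FinObj U) :
    compare (X.prod Y) = tensor (compare X) (compare Y) * ic X Y X Y := by
  rw [compare, copy_tensor, Matrix.transpose_mul, transpose_ic, transpose_tensor]; rfl

theorem compare_unit : HEq (compare (one : FinObj U)) (1 : Mx (one : FinObj U) one) := by
  have h := transpose_heq rfl (one_prod _) (copy_unit (U := U))
  rw [Matrix.transpose_one] at h
  exact h

theorem omni_tensor (X Y : FinObj U) : HEq (omni (X.prod Y)) (tensor (omni X) (omni Y)) :=
  transpose_heq rfl (one_prod _).symm (del_tensor X Y)

theorem omni_unit : omni (one : FinObj U) = 1 := by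
  rw [omni, del_unit, Matrix.transpose_one]

theorem ic_eq (X Y Z W : FinObj U)
    (h : (X.prod Y).prod (Z.prod W) = (X.prod (Y.prod Z)).prod W)
    (h' : (X.prod (Z.prod Y)).prod W = (X.prod Z).prod (Y.prod W)) :
    ofFun (castEl h') * tensor (tensor (1 : Mx X X) (braid Y Z)) (1 : Mx W W) *
      ofFun (castEl h) = ic X Y Z W := by
  rw [← ofFun_id, ← ofFun_id, braid, ofFun_tensor, ofFun_tensor, ofFun_mul, ofFun_mul, ic]
  refine congrArg ofFun (funext fun p => ?_)
  obtain ⟨q₁, q₂, rfl⟩ := exists_pair p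
  obtain ⟨a, b, rfl⟩ := exists_pair q₁
  obtain ⟨c, d, rfl⟩ := exists_pair q₂
  simp

/-- A matrix is stochastic if each of its columns sums to one. -/
def IsStoch {X Y : FinObj U} (f : Mx X Y) : Prop := ∀ x, ∑ y, f y x = 1

theorem isStoch_ofFun {X Y : FinObj U} (φ : X.El → Y.El) : IsStoch (ofFun φ) := fun x => by
  simp [ofFun]

theorem isStoch_one (X : FinObj U) : IsStoch (1 : Mx X X) := by
  rw [← ofFun_id]; exact isStoch_ofFun _

theorem IsStoch.mul {X Y Z : FinObj U} {f : Mx X Y} {g : Mx Y Z} (hg : IsStoch g)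
    (hf : IsStoch f) : IsStoch (g * f : Mx X Z) := fun x => by
  simp only [Matrix.mul_apply]
  rw [Finset.sum_comm]
  simp only [← Finset.sum_mul, hg _, one_mul, hf x]

theorem IsStoch.tensor {X Y X' Y' : FinObj U} {f : Mx X Y} {f' : Mx X' Y'} (hf : IsStoch f)
    (hf' : IsStoch f') : IsStoch (tensor f f') := fun p => by
  simp only [Mx.tensor, sum_prod, fst_pair, snd_pair, ← Finset.mul_sum, hf' _, mul_one, hf _]

end Mx

end PGM
namespace PGM

open FinObj

/-- The hypergraph category of finite sets and matrices with nonnegative entries. -/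
structure MatCat (U : Type u) : Type u where
  of ::
  set : FinObj U

/-- The CD-category of finite sets and stochastic matrices. -/
structure FinStoch (U : Type u) : Type u where
  of ::
  set : FinObj U

variable {U : Type u}

namespace MatCat

noncomputable instance : Category.{u} (MatCat U) where
  Hom X Y := Mx X.set Y.set
  id X := (1 : Mx X.set X.set)
  comp {X Y Z} f g := ((g : Mx Y.set Z.set) * (f : Mx X.set Y.set) : Mx X.set Z.set)
  id_comp f := Matrix.mul_one (f : Matrix _ _ ℝ≥0)
  comp_id f := Matrix.one_mul (f : Matrix _ _ ℝ≥0)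
  assoc f g h := (Matrix.mul_assoc (h : Matrix _ _ ℝ≥0) (g : Matrix _ _ ℝ≥0) f).symm

theorem eqToHom_eq {X Y : MatCat U} (h : X = Y) :
    eqToHom h = Mx.ofFun (Mx.castEl (congrArg set h)) := by
  subst h; exact (Mx.ofFun_id _).symm

noncomputable instance : StrictSMC.{u} (MatCat U) where
  tensorObj X Y := of (X.set.prod Y.set)
  unit := of one
  tensorObj_assoc X Y Z := congrArg of (prod_assoc X.set Y.set Z.set)
  unit_tensorObj X := congrArg of (one_prod X.set)
  tensorObj_unit X := congrArg of (prod_one X.set)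
  tensorHom f g := Mx.tensor f g
  tensorHom_id X Y := Mx.tensor_one
  tensorHom_comp f g f' g' := Mx.tensor_mul f g f' g'
  tensorHom_assoc f f' f'' := Mx.tensor_assoc f f' f''
  unit_tensorHom f := Mx.one_tensor f
  tensorHom_unit f := Mx.tensor_one' f
  braid X Y := Mx.braid X.set Y.set
  braid_naturality f f' := Mx.braid_naturality f f'
  braid_braid X Y := Mx.braid_braid X.set Y.set
  hexagon X Y Z := by
    rw [eqToHom_eq]; exact Mx.hexagon X.set Y.set Z.set

theorem interchange_eq (X Y Z W : MatCat U) :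
    interchange X Y Z W = Mx.ic X.set Y.set Z.set W.set := by
  unfold interchange
  rw [eqToHom_eq, eqToHom_eq]
  exact Mx.ic_eq _ _ _ _ _ _

noncomputable instance : CDCat (MatCat U) where
  copy X := Mx.copy X.set
  del X := Mx.del X.set
  copy_comm X := Mx.copy_comm X.set
  copy_assoc X := Mx.copy_assoc X.set
  copy_del X := Mx.copy_del X.set
  copy_tensor X Y := by rw [interchange_eq]; exact Mx.copy_tensor X.set Y.set
  copy_unit := Mx.copy_unit
  del_tensor X Y := Mx.del_tensor X.set Y.set
  del_unit := Mx.del_unit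

noncomputable instance : HypCat (MatCat U) where
  compare X := Mx.compare X.set
  omni X := Mx.omni X.set
  compare_comm X := Mx.compare_comm X.set
  compare_assoc X := Mx.compare_assoc X.set
  omni_compare X := Mx.omni_compare X.set
  compare_tensor X Y := by rw [interchange_eq]; exact Mx.compare_tensor X.set Y.set
  compare_unit := Mx.compare_unit
  omni_tensor X Y := Mx.omni_tensor X.set Y.set
  omni_unit := Mx.omni_unit
  special X := Mx.special X.set
  frobenius_left X := by
    rw [eqToHom_eq, ← Category.assoc]
    exact (Matrix.mul_assoc _ _ _).symm.trans (Mx.frobenius_left X.set)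
  frobenius_right X := by
    rw [eqToHom_eq, ← Category.assoc]
    exact (Matrix.mul_assoc _ _ _).symm.trans (Mx.frobenius_right X.set)

end MatCat

namespace FinStoch

noncomputable instance : Category.{u} (FinStoch U) where
  Hom X Y := {f : Mx X.set Y.set // Mx.IsStoch f}
  id X := ⟨1, Mx.isStoch_one X.set⟩
  comp f g := ⟨g.1 * f.1, g.2.mul f.2⟩
  id_comp f := Subtype.ext (Matrix.mul_one f.1)
  comp_id f := Subtype.ext (Matrix.one_mul f.1)
  assoc f g h := Subtype.ext (Matrix.mul_assoc h.1 g.1 f.1).symm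

theorem hom_heq {X X' Y Y' : FinStoch U} (hX : X = X') (hY : Y = Y') {f : X ⟶ Y} {f' : X' ⟶ Y'}
    (h : HEq f.1 f'.1) : HEq f f' := by
  subst hX hY
  exact heq_of_eq (Subtype.ext (eq_of_heq h))

theorem eqToHom_eq {X Y : FinStoch U} (h : X = Y) :
    eqToHom h = (⟨Mx.ofFun (Mx.castEl (congrArg set h)), Mx.isStoch_ofFun _⟩ : X ⟶ Y) := by
  subst h; exact Subtype.ext (Mx.ofFun_id _).symm

noncomputable instance : StrictSMC.{u} (FinStoch U) where
  tensorObj X Y := of (X.set.prod Y.set)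
  unit := of one
  tensorObj_assoc X Y Z := congrArg of (prod_assoc X.set Y.set Z.set)
  unit_tensorObj X := congrArg of (one_prod X.set)
  tensorObj_unit X := congrArg of (prod_one X.set)
  tensorHom f g := ⟨Mx.tensor f.1 g.1, f.2.tensor g.2⟩
  tensorHom_id X Y := Subtype.ext Mx.tensor_one
  tensorHom_comp f g f' g' := Subtype.ext (Mx.tensor_mul f.1 g.1 f'.1 g'.1)
  tensorHom_assoc f f' f'' := hom_heq (congrArg of (prod_assoc _ _ _))
    (congrArg of (prod_assoc _ _ _)) (Mx.tensor_assoc f.1 f'.1 f''.1)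
  unit_tensorHom f := hom_heq (congrArg of (one_prod _)) (congrArg of (one_prod _))
    (Mx.one_tensor f.1)
  tensorHom_unit f := hom_heq (congrArg of (prod_one _)) (congrArg of (prod_one _))
    (Mx.tensor_one' f.1)
  braid X Y := ⟨Mx.braid X.set Y.set, Mx.isStoch_ofFun _⟩
  braid_naturality f f' := Subtype.ext (Mx.braid_naturality f.1 f'.1)
  braid_braid X Y := Subtype.ext (Mx.braid_braid X.set Y.set)
  hexagon X Y Z := by
    rw [eqToHom_eq]
    exact hom_heq (congrArg of (prod_assoc _ _ _).symm) (congrArg of (prod_assoc _ _ _))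
      (Mx.hexagon X.set Y.set Z.set)

theorem interchange_eq (X Y Z W : FinStoch U) :
    (interchange X Y Z W).1 = Mx.ic X.set Y.set Z.set W.set := by
  unfold interchange
  rw [eqToHom_eq, eqToHom_eq]
  exact Mx.ic_eq _ _ _ _ _ _

noncomputable instance : CDCat (FinStoch U) where
  copy X := ⟨Mx.copy X.set, Mx.isStoch_ofFun _⟩
  del X := ⟨Mx.del X.set, Mx.isStoch_ofFun _⟩
  copy_comm X := Subtype.ext (Mx.copy_comm X.set)
  copy_assoc X := hom_heq rfl (congrArg of (prod_assoc _ _ _)) (Mx.copy_assoc X.set)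
  copy_del X := hom_heq rfl (congrArg of (one_prod _)) (Mx.copy_del X.set)
  copy_tensor X Y := Subtype.ext
    ((Mx.copy_tensor X.set Y.set).trans (congrArg (· * _) (interchange_eq X X Y Y).symm))
  copy_unit := hom_heq rfl (congrArg of (one_prod _)) Mx.copy_unit
  del_tensor X Y := hom_heq rfl (congrArg of (one_prod _).symm) (Mx.del_tensor X.set Y.set)
  del_unit := Subtype.ext Mx.del_unit

/-- The inclusion of stochastic matrices into all nonnegative matrices. -/
noncomputable def toMat (U : Type u) : FinStoch U ⥤ MatCat U where
  obj X := .of X.set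
  map f := f.1

end FinStoch

/-- The category of finite sets and nonnegative matrices up to a positive scalar factor. -/
structure FinProjStoch (U : Type u) : Type u where
  of ::
  set : FinObj U

namespace FinProjStoch

/-- Two matrices are proportional if they differ by a global positive factor. -/
def propSetoid (X Y : FinObj U) : Setoid (Mx X Y) where
  r f f' := ∃ c : ℝ≥0, 0 < c ∧ ∀ y x, c * f y x = f' y x
  iseqv :=
    { refl := fun f => ⟨1, one_pos, fun y x => one_mul _⟩
      symm := fun {f f'} ⟨c, hc, h⟩ => ⟨c⁻¹, inv_pos.2 hc, fun y x => by
        rw [← h y x, inv_mul_cancel_left₀ hc.ne']⟩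
      trans := fun {f f' f''} ⟨c, hc, h⟩ ⟨c', hc', h'⟩ => ⟨c' * c, mul_pos hc' hc, fun y x => by
        rw [mul_assoc, h y x, h' y x]⟩ }

theorem mul_congr {X Y Z : FinObj U} {f f' : Mx X Y} {g g' : Mx Y Z}
    (hf : (propSetoid X Y).r f f') (hg : (propSetoid Y Z).r g g') :
    (propSetoid X Z).r (g * f) (g' * f') := by
  obtain ⟨c, hc, hf⟩ := hf
  obtain ⟨d, hd, hg⟩ := hg
  refine ⟨d * c, mul_pos hd hc, fun z x => ?_⟩
  simp only [Matrix.mul_apply, Finset.mul_sum, ← hf, ← hg]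
  exact Finset.sum_congr rfl fun _ _ => mul_mul_mul_comm _ _ _ _

noncomputable instance : Category.{u} (FinProjStoch U) where
  Hom X Y := Quotient (propSetoid X.set Y.set)
  id X := Quotient.mk _ (1 : Mx X.set X.set)
  comp {X Y Z} f g := Quotient.map₂ (fun (f : Mx X.set Y.set) (g : Mx Y.set Z.set) => g * f)
    (fun _ _ h _ _ h' => mul_congr h h') f g
  id_comp f := Quotient.inductionOn f fun f => congrArg (Quotient.mk _) (Matrix.mul_one f)
  comp_id f := Quotient.inductionOn f fun f => congrArg (Quotient.mk _) (Matrix.one_mul f)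
  assoc f g h := Quotient.inductionOn₃ f g h fun f g h =>
    congrArg (Quotient.mk _) (Matrix.mul_assoc h g f).symm

/-- The quotient functor, from matrices to matrices up to a positive factor. -/
noncomputable def quot (U : Type u) : MatCat U ⥤ FinProjStoch U where
  obj X := .of X.set
  map {X Y} f := Quotient.mk (propSetoid X.set Y.set) f

/-- The embedding of stochastic matrices, sending a matrix to its class up to a positive factor. -/
noncomputable def emb (U : Type u) : FinStoch U ⥤ FinProjStoch U where
  obj X := .of X.set
  map {X Y} f := Quotient.mk (propSetoid X.set Y.set) f.1

end FinProjStoch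

end PGM
namespace PGM

/-! ### Ordered graphs -/

/-- The elements of a finite set of vertices, in increasing order. -/
def vlist {V : Type v} [LinearOrder V] (S : Finset V) : List V := S.sort (· ≤ ·)

section

variable {V : Type v} [LinearOrder V]

theorem mem_vlist {S : Finset V} {a : V} : a ∈ vlist S ↔ a ∈ S := Finset.mem_sort _

theorem vlist_empty : vlist (∅ : Finset V) = [] := Finset.sort_empty _

theorem vlist_singleton (a : V) : vlist {a} = [a] := Finset.sort_singleton _ a

theorem vlist_pairwise (S : Finset V) : (vlist S).Pairwise (· < ·) :=
  (Finset.sortedLT_sort S).pairwise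

theorem vlist_eq {S : Finset V} {l : List V} (hl : l.Pairwise (· < ·)) (h : ∀ a, a ∈ l ↔ a ∈ S) :
    l = vlist S :=
  hl.eq_of_mem_iff (vlist_pairwise S) fun a => (h a).trans mem_vlist.symm

theorem vlist_reverse_pairwise (S : Finset V) : (vlist S).reverse.Pairwise (· > ·) :=
  List.pairwise_reverse.2 (vlist_pairwise S)

theorem vlist_insert {S : Finset V} {a : V} (h : ∀ b ∈ S, b < a) :
    vlist S ++ [a] = vlist (insert a S) := by
  refine vlist_eq (List.pairwise_append.2 ⟨vlist_pairwise S, List.pairwise_singleton _ _, ?_⟩) ?_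
  · intro x hx y hy
    rw [List.mem_singleton] at hy
    rw [hy]; exact h x (mem_vlist.1 hx)
  · intro x
    simp [mem_vlist, or_comm]

end

/-- An ordered DAG: a finite directed graph with a total order such that `a → b` implies
`a < b`. -/
structure ODAG : Type (v + 1) where
  V : Type v
  [order : LinearOrder V]
  [fin : Fintype V]
  edge : V → V → Prop
  edge_lt : ∀ {a b : V}, edge a b → a < b

attribute [instance] ODAG.order ODAG.fin

/-- An ordered undirected graph: a finite undirected graph with a total order on the vertices. -/
structure OUGr : Type (v + 1) where
  V : Type v
  [order : LinearOrder V]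
  [fin : Fintype V]
  graph : SimpleGraph V

attribute [instance] OUGr.order OUGr.fin

/-- An order-preserving map preserves the edges of ordered DAGs; an edge whose endpoints are
identified is respected. -/
def ODAG.Preserves (G G' : ODAG.{v}) (α : G.V →o G'.V) : Prop :=
  ∀ a b : G.V, G.edge a b → α a = α b ∨ G'.edge (α a) (α b)

/-- An order-preserving map preserves the edges of ordered undirected graphs; an edge whose
endpoints are identified is respected. -/
def OUGr.Preserves (H H' : OUGr.{v}) (α : H.V →o H'.V) : Prop :=
  ∀ a b : H.V, H.graph.Adj a b → α a = α b ∨ H'.graph.Adj (α a) (α b)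

/-- A morphism of ordered DAGs. -/
@[ext]
structure ODAG.Hom (G G' : ODAG.{v}) where
  map : G.V →o G'.V
  preserves : ODAG.Preserves G G' map

/-- A morphism of ordered undirected graphs. -/
@[ext]
structure OUGr.Hom (H H' : OUGr.{v}) where
  map : H.V →o H'.V
  preserves : OUGr.Preserves H H' map

instance : Category.{v} ODAG.{v} where
  Hom := ODAG.Hom
  id _ := ⟨OrderHom.id, fun _ _ h => Or.inr h⟩
  comp f g := ⟨g.map.comp f.map, fun a b h => (f.preserves a b h).elim
    (fun e => Or.inl (congrArg g.map e)) (fun h' => g.preserves _ _ h')⟩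

instance : Category.{v} OUGr.{v} where
  Hom := OUGr.Hom
  id _ := ⟨OrderHom.id, fun _ _ h => Or.inr h⟩
  comp f g := ⟨g.map.comp f.map, fun a b h => (f.preserves a b h).elim
    (fun e => Or.inl (congrArg g.map e)) (fun h' => g.preserves _ _ h')⟩

/-- The one-vertex graph, as an ordered DAG. -/
def ODAG.point : ODAG.{v} where
  V := PUnit
  edge _ _ := False
  edge_lt h := h.elim

/-- The one-vertex graph, as an ordered undirected graph. -/
def OUGr.point : OUGr.{v} where
  V := PUnit
  graph := ⊥

instance : Unique ODAG.point.{v}.V := inferInstanceAs (Unique PUnit)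

instance : Unique OUGr.point.{v}.V := inferInstanceAs (Unique PUnit)

open Classical in
/-- The set of parents of a vertex. -/
noncomputable def ODAG.parents (G : ODAG.{v}) (a : G.V) : Finset G.V :=
  Finset.univ.filter fun b => G.edge b a

theorem ODAG.mem_parents {G : ODAG.{v}} {a b : G.V} : b ∈ G.parents a ↔ G.edge b a := by
  simp [ODAG.parents]

theorem ODAG.lt_of_mem_parents {G : ODAG.{v}} {a b : G.V} (h : b ∈ G.parents a) : b < a :=
  G.edge_lt (ODAG.mem_parents.1 h)

/-- The moralisation of an ordered DAG: two different vertices are adjacent if there is an edge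
between them or they are both parents of the same vertex. -/
def ODAG.moral (G : ODAG.{v}) : OUGr.{v} where
  V := G.V
  graph :=
    { Adj := fun a b => a ≠ b ∧ (G.edge a b ∨ G.edge b a ∨ ∃ d, G.edge a d ∧ G.edge b d)
      symm := ⟨fun _ _ h => ⟨h.1.symm, h.2.elim (fun h => Or.inr (Or.inl h)) fun h =>
        h.elim Or.inl fun ⟨d, hd⟩ => Or.inr (Or.inr ⟨d, hd.symm⟩)⟩⟩
      loopless := ⟨fun _ h => h.1 rfl⟩ }

/-- The (nonempty) cliques of an undirected graph. -/
def OUGr.Clique (H : OUGr.{v}) : Type v :=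
  {C : Finset H.V // C.Nonempty ∧ H.graph.IsClique (C : Set H.V)}

noncomputable instance (H : OUGr.{v}) : Fintype H.Clique :=
  haveI : Finite H.Clique :=
    inferInstanceAs (Finite {C : Finset H.V // C.Nonempty ∧ H.graph.IsClique (C : Set H.V)})
  Fintype.ofFinite _

/-! ### Syntax categories -/

/-- The signature of an ordered DAG: a generator `parents(a) ⟶ a` for each vertex `a`. -/
noncomputable def dagSig (G : ODAG.{v}) : MonSig.{v} G.V where
  Gen := G.V
  dom a := vlist (G.parents a)
  cod a := [a]

/-- The signature of an ordered undirected graph: a generator `I ⟶ C` for each clique `C`. -/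
def ugSig (H : OUGr.{v}) : MonSig.{v} H.V where
  Gen := H.Clique
  dom _ := []
  cod C := vlist C.1

/-- The signature on a set of objects with no generating morphisms. -/
def emptySig (V : Type v) : MonSig.{v} V where
  Gen := PEmpty
  dom := PEmpty.elim
  cod := PEmpty.elim

/-- The free CD-category of an ordered DAG. -/
abbrev CDSyn (G : ODAG.{v}) : Type v := FreeCat .cd (dagSig G)

/-- The free hypergraph category on the signature of an ordered DAG. -/
abbrev HSyn (G : ODAG.{v}) : Type v := FreeCat .hyp (dagSig G)

/-- The free hypergraph category of an ordered undirected graph. -/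
abbrev Syn (H : OUGr.{v}) : Type v := FreeCat .hyp (ugSig H)

/-- The vertex-list category: the coloured PROP on a set of vertices, whose morphisms are
permutations. -/
abbrev VCat (V : Type v) : Type v := FreeCat .sym (emptySig V)

open FreeCat (of)

/-- The functor from the vertex-list category sending each vertex to itself. -/
def VCat.incl {V : Type v} (k : Kind) (S : MonSig V) : VCat V ⥤ FreeCat k S :=
  FreeCat.lift (fun h => False.elim h) (fun h => False.elim h) of rfl (fun _ _ => rfl)
    (fun σ => PEmpty.elim σ)

/-- The contravariant action of an order-preserving map on vertex-list categories: a vertex is sent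
to the ordered list of its preimages. -/
def VCat.map {V V' : Type v} [LinearOrder V] [Fintype V] [LinearOrder V'] (α : V →o V') :
    VCat V' ⥤ VCat V :=
  FreeCat.lift (fun h => False.elim h) (fun h => False.elim h)
    (fun X => of (X.flatMap fun b => vlist (Finset.univ.filter fun a => α a = b))) rfl
    (fun _ _ => congrArg of List.flatMap_append) (fun σ => PEmpty.elim σ)

/-- The map to the one-vertex graph, on vertices. -/
def toPoint (V : Type v) [LinearOrder V] : V →o PUnit.{v + 1} := ⟨fun _ => ⟨⟩, fun _ _ _ => le_rfl⟩

/-- The functor `star` from the free CD-category to the free hypergraph category of an ordered DAG,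
the identity on generators. -/
noncomputable def starDAG (G : ODAG.{v}) : CDSyn G ⥤ HSyn G :=
  FreeCat.lift (fun _ => inferInstance) (fun h => False.elim h) of rfl (fun _ _ => rfl)
    (FreeCat.gen .hyp (dagSig G))

theorem point_dom (x : ODAG.point.V) : (dagSig ODAG.point.{v}).dom x = [] := by
  have : ODAG.point.{v}.parents x = ∅ := by
    refine Finset.eq_empty_of_forall_notMem fun y hy => ?_
    exact ODAG.mem_parents.1 hy
  simp [dagSig, this, vlist_empty]

/-- The unique clique of the one-vertex graph. -/
def pointClique : OUGr.point.{v}.Clique := 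
  ⟨{default}, Finset.singleton_nonempty _, by rw [Finset.coe_singleton]; exact Set.pairwise_singleton _ _⟩

theorem point_cod (C : OUGr.point.{v}.Clique) : (ugSig OUGr.point.{v}).cod C = [default] := by
  have : C.1 = {default} := by
    obtain ⟨y, hy⟩ := C.2.1
    exact (Finset.eq_singleton_iff_unique_mem).2
      ⟨Subsingleton.elim y default ▸ hy, fun z _ => Subsingleton.elim z default⟩
  change vlist C.1 = _
  rw [this, vlist_singleton]

/-- The functor `star` for the one-vertex graph, sending the unique generator to the unique
generator. -/
noncomputable def starPoint : CDSyn ODAG.point.{v} ⥤ Syn OUGr.point.{v} :=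
  FreeCat.lift (fun _ => inferInstance) (fun h => False.elim h) of rfl (fun _ _ => rfl)
    (fun x => castHom (congrArg of (point_dom x).symm) (congrArg of (point_cod _))
      (FreeCat.gen .hyp (ugSig OUGr.point) pointClique))

/-! ### Copy-composition -/

section Wiring

variable {A : Type u} [DecidableEq A]

/-- The projection of a list of wires onto (the first occurrence of) one of them. -/
def proj (S : MonSig A) (a : A) : ∀ X : List A, a ∈ X → ((of X : FreeCat .cd S) ⟶ of [a])
  | [], h => (List.not_mem_nil h).elim
  | x :: X, h =>
      if e : x = a then
        castHom (C := FreeCat .cd S) (X := of [x] ⊠ of X) (Y := of [x] ⊠ of []) rfl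
          (congrArg (fun z => of [z]) e) (𝟙 (of [x] : FreeCat .cd S) ⊠ₕ CDCat.del (of X))
      else
        CDCat.del (of [x] : FreeCat .cd S) ⊠ₕ
          proj S a X ((List.mem_cons.1 h).resolve_left fun e' => e e'.symm)

/-- The structural map from a list of wires to a list of wires that occur in it, obtained by
copying, deleting and permuting. -/
def wire (S : MonSig A) (X : List A) :
    ∀ Y : List A, (∀ a ∈ Y, a ∈ X) → ((of X : FreeCat .cd S) ⟶ of Y)
  | [], _ => CDCat.del (of X : FreeCat .cd S)
  | y :: Y, h =>
      CDCat.copy (of X : FreeCat .cd S) ≫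
        (proj S y X (h y List.mem_cons_self) ⊠ₕ
          wire S X Y fun a ha => h a (List.mem_cons_of_mem y ha))

/-- The injection of a wire into a list of wires at its first occurrence, the other wires being
unconstrained (`omni`). -/
def inj (S : MonSig A) (a : A) : ∀ X : List A, a ∈ X → ((of [a] : FreeCat .hyp S) ⟶ of X)
  | [], h => (List.not_mem_nil h).elim
  | x :: X, h =>
      if e : x = a then
        castHom (C := FreeCat .hyp S) (X := of [x] ⊠ of []) (Y := of [x] ⊠ of X)
          (congrArg (fun z => of [z]) e) rfl (𝟙 (of [x] : FreeCat .hyp S) ⊠ₕ HypCat.omni (of X))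
      else
        HypCat.omni (of [x] : FreeCat .hyp S) ⊠ₕ
          inj S a X ((List.mem_cons.1 h).resolve_left fun e' => e e'.symm)

/-- The structural map from a list of wires to a list containing all of them, obtained by comparing
all occurrences of the same wire, and permuting; the wires that do not occur are unconstrained. -/
def cowire (S : MonSig A) (X : List A) :
    ∀ Y : List A, (∀ a ∈ Y, a ∈ X) → ((of Y : FreeCat .hyp S) ⟶ of X)
  | [], _ => HypCat.omni (of X : FreeCat .hyp S)
  | y :: Y, h =>
      (inj S y X (h y List.mem_cons_self) ⊠ₕ
          cowire S X Y fun a ha => h a (List.mem_cons_of_mem y ha)) ≫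
        HypCat.compare (of X : FreeCat .hyp S)

end Wiring

section CopyComp

variable (G : ODAG.{v})

/-- The inputs of a set of generators, identified with the set `S` of their outputs: the parents of
elements of `S` that are not in `S`. -/
noncomputable def inputs (S : Finset G.V) : Finset G.V := S.biUnion G.parents \ S

theorem inputs_empty : inputs G ∅ = ∅ := rfl

theorem inputs_insert {a : G.V} {S : Finset G.V} (h : ∀ b ∈ S, b < a) :
    ∀ d ∈ vlist (inputs G S) ++ vlist (inputs G (insert a S)),
      d ∈ vlist (inputs G (insert a S)) := by
  intro d hd
  simp only [List.mem_append, mem_vlist] at hd ⊢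
  rcases hd with hd | hd
  · simp only [inputs, Finset.mem_sdiff, Finset.mem_biUnion, Finset.mem_insert] at hd ⊢
    obtain ⟨⟨b, hb, hdb⟩, hd⟩ := hd
    refine ⟨⟨b, Or.inr hb, hdb⟩, ?_⟩
    rintro (rfl | h')
    · exact lt_asymm (h b hb) (ODAG.lt_of_mem_parents hdb)
    · exact hd h'
  · exact hd

theorem parents_mem {a : G.V} {l : List G.V} :
    ∀ d ∈ l.reverse ++ vlist (G.parents a),
      d ∈ l.reverse ++ vlist (inputs G (insert a l.toFinset)) := by
  intro d hd
  simp only [List.mem_append, mem_vlist, List.mem_reverse] at hd ⊢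
  rcases hd with hd | hd
  · exact Or.inl hd
  · by_cases h : d ∈ l
    · exact Or.inl h
    · right
      simp only [inputs, Finset.mem_sdiff, Finset.mem_biUnion, Finset.mem_insert, List.mem_toFinset]
      refine ⟨⟨a, Or.inl rfl, hd⟩, ?_⟩
      rintro (rfl | h')
      · exact lt_irrefl _ (ODAG.lt_of_mem_parents hd)
      · exact h h'

/-- The copy-composition of the generators with outputs in a list, given in decreasing order: the
inputs are copied, the smaller generators are composed, and their inputs and outputs are copied to
act as inputs of the generator with the biggest output `a`. -/
noncomputable def copyCompList : ∀ l : List G.V, l.Pairwise (· > ·) →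
    ((of (vlist (inputs G l.toFinset)) : CDSyn G) ⟶ of l.reverse)
  | [], _ => eqToHom (congrArg of (by
      rw [List.toFinset_nil, inputs_empty, vlist_empty, List.reverse_nil]))
  | a :: l, h =>
      castHom (C := CDSyn G) (congrArg (fun T => of (vlist (inputs G T))) (List.toFinset_cons ..).symm)
        (congrArg of (List.reverse_cons (a := a) (as := l)).symm)
        (wire (dagSig G) (vlist (inputs G (insert a l.toFinset)))
            (vlist (inputs G l.toFinset) ++ vlist (inputs G (insert a l.toFinset)))
            (inputs_insert G fun _ hb => (List.pairwise_cons.1 h).1 _ (List.mem_toFinset.1 hb)) ≫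
          (copyCompList l (List.pairwise_cons.1 h).2 ⊠ₕ
            𝟙 (of (vlist (inputs G (insert a l.toFinset))) : CDSyn G)) ≫
          wire (dagSig G) (l.reverse ++ vlist (inputs G (insert a l.toFinset)))
            (l.reverse ++ vlist (G.parents a)) (parents_mem G) ≫
          (𝟙 (of l.reverse : CDSyn G) ⊠ₕ (FreeCat.gen .cd (dagSig G) a : (of ((dagSig G).dom a) : CDSyn G) ⟶ of [a])))

/-- The copy-composition of a set of generators, identified with the set of their outputs. -/
noncomputable def copyComp (S : Finset G.V) :
    (of (vlist (inputs G S)) : CDSyn G) ⟶ of (vlist S) :=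
  castHom (C := CDSyn G)
    (congrArg (fun T => of (vlist (inputs G T))) (by ext x; simp [mem_vlist]))
    (congrArg of (List.reverse_reverse _))
    (copyCompList G (vlist S).reverse (vlist_reverse_pairwise S))

theorem inputs_univ : inputs G Finset.univ = ∅ :=
  Finset.sdiff_eq_empty_iff_subset.2 (Finset.subset_univ _)

/-- The copy-composition of all the generators, which has no inputs. -/
noncomputable def copyCompAll : (of [] : CDSyn G) ⟶ of (vlist (Finset.univ : Finset G.V)) :=
  castHom (congrArg of ((congrArg vlist (inputs_univ G)).trans vlist_empty)) rfl (copyComp G Finset.univ)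

/-- The CD-functor induced by the map from an ordered DAG to the one-vertex graph: it sends the
unique generator to the copy-composition of all the generators. -/
noncomputable def bangDAG : CDSyn ODAG.point.{v} ⥤ CDSyn G :=
  FreeCat.lift (fun _ => inferInstance) (fun h => False.elim h)
    (fun X => of (X.flatMap fun _ => vlist (Finset.univ : Finset G.V))) rfl
    (fun _ _ => congrArg of List.flatMap_append)
    (fun x => castHom (congrArg of (congrArg (List.flatMap _) (point_dom x)).symm)
      (congrArg of (List.append_nil _).symm) (copyCompAll G))

/-- The hypergraph functor that agrees with `bangDAG` on the unique generator. -/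
noncomputable def bangHSyn : Syn OUGr.point.{v} ⥤ HSyn G :=
  FreeCat.lift (fun _ => inferInstance) (fun _ => inferInstance)
    (fun X => of (X.flatMap fun _ => vlist (Finset.univ : Finset G.V))) rfl
    (fun _ _ => congrArg of List.flatMap_append)
    (fun C : (ugSig OUGr.point.{v}).Gen => castHom rfl (congrArg of
        ((List.append_nil _).symm.trans (congrArg (List.flatMap _) (point_cod C).symm)))
      ((starDAG G).map (copyCompAll G)))

end CopyComp

/-! ### Compare-composition -/

section CompComp

variable {A : Type u} [LinearOrder A] (S : MonSig A)

/-- A factor: a morphism `I ⟶ C` in a free hypergraph category, together with its set `C` of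
outputs. -/
structure Factor where
  out : Finset A
  hom : (of [] : FreeCat .hyp S) ⟶ of (vlist out)

variable {S}

/-- The outputs of a collection of factors. -/
def outputs : List (Factor S) → Finset A
  | [] => ∅
  | φ :: l => φ.out ∪ outputs l

theorem mem_outputs_cons {φ : Factor S} {l : List (Factor S)} :
    ∀ a ∈ vlist φ.out ++ vlist (outputs l), a ∈ vlist (outputs (φ :: l)) := by
  intro a ha
  simpa [mem_vlist, outputs] using ha

/-- The compare-composition of a collection of factors: all occurrences of the same output on the
first factor and on the compare-composition of the others are compared. -/
def compComp : ∀ l : List (Factor S), (of [] : FreeCat .hyp S) ⟶ of (vlist (outputs l))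
  | [] => eqToHom (congrArg of vlist_empty.symm)
  | φ :: l =>
      castHom (C := FreeCat .hyp S) (X := of [] ⊠ of []) rfl rfl (φ.hom ⊠ₕ compComp l) ≫
        cowire S (vlist (outputs (φ :: l))) (vlist φ.out ++ vlist (outputs l)) mem_outputs_cons

end CompComp

section Undirected

variable (H : OUGr.{v})

/-- A generator of the free hypergraph category of an undirected graph, as a factor. -/
def cliqueFactor (C : H.Clique) : Factor (ugSig H) := ⟨C.1, FreeCat.gen .hyp (ugSig H) C⟩

/-- All the generators, as factors, in an arbitrary order. -/
noncomputable def allFactors : List (Factor (ugSig H)) :=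
  (Finset.univ : Finset H.Clique).toList.map (cliqueFactor H)

theorem mem_outputs {A : Type u} [LinearOrder A] {S : MonSig A} {l : List (Factor S)} {a : A} :
    a ∈ outputs l ↔ ∃ φ ∈ l, a ∈ φ.out := by
  induction l with
  | nil => simp [outputs]
  | cons φ l ih => simp [outputs, ih]

theorem outputs_allFactors : outputs (allFactors H) = Finset.univ := by
  refine Finset.eq_univ_of_forall fun a => mem_outputs.2 ?_
  refine ⟨cliqueFactor H ⟨{a}, Finset.singleton_nonempty a, ?_⟩,
    List.mem_map_of_mem (Finset.mem_toList.2 (Finset.mem_univ _)), Finset.mem_singleton_self a⟩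
  rw [Finset.coe_singleton]; exact Set.pairwise_singleton _ _

/-- The compare-composition of all the generators. -/
noncomputable def compCompAll : (of [] : Syn H) ⟶ of (vlist (Finset.univ : Finset H.V)) :=
  castHom rfl (congrArg (fun T => of (vlist T)) (outputs_allFactors H)) (compComp (allFactors H))

/-- The hypergraph functor induced by the map from an ordered undirected graph to the one-vertex
graph: it sends the unique generator to the compare-composition of all the generators. -/
noncomputable def bangUGr : Syn OUGr.point.{v} ⥤ Syn H :=
  FreeCat.lift (fun _ => inferInstance) (fun _ => inferInstance)
    (fun X => of (X.flatMap fun _ => vlist (Finset.univ : Finset H.V))) rfl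
    (fun _ _ => congrArg of List.flatMap_append)
    (fun C : (ugSig OUGr.point.{v}).Gen => castHom rfl (congrArg of
        ((List.append_nil _).symm.trans (congrArg (List.flatMap _) (point_cod C).symm)))
      (compCompAll H))

end Undirected

/-! ### Graphs of generators -/

/-- The graph of the generator with output `a`, as a factor. -/
noncomputable def graphFactor (G : ODAG.{v}) (a : G.V) : Factor (dagSig G) where
  out := insert a (G.parents a)
  hom := castHom (C := HSyn G) (X := of []) (Y := of (vlist (G.parents a) ++ [a])) rfl
    (congrArg of (vlist_insert fun _ hb => ODAG.lt_of_mem_parents hb))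
    (graph (FreeCat.gen .hyp (dagSig G) a))

theorem mem_outputs_graphFactor (G : ODAG.{v}) (l : List G.V) :
    ∀ d ∈ vlist (inputs G l.toFinset) ++ vlist l.toFinset,
      d ∈ vlist (outputs (l.map (graphFactor G))) := by
  intro d hd
  simp only [List.mem_append, mem_vlist, inputs, Finset.mem_sdiff, Finset.mem_biUnion,
    List.mem_toFinset] at hd
  rw [mem_vlist, mem_outputs]
  rcases hd with ⟨⟨a, ha, hd⟩, -⟩ | hd
  · exact ⟨_, List.mem_map_of_mem ha, Finset.mem_insert_of_mem hd⟩
  · exact ⟨_, List.mem_map_of_mem hd, Finset.mem_insert_self _ _⟩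

/-- The graph of the copy-composition of the generators with outputs in a list, whose outputs are
the inputs and the outputs of the copy-composition, reordered. -/
noncomputable def graphCopyComp (G : ODAG.{v}) (l : List G.V) :
    (of [] : HSyn G) ⟶ of (vlist (outputs (l.map (graphFactor G)))) :=
  graph ((starDAG G).map (copyComp G l.toFinset)) ≫
    cowire (dagSig G) (vlist (outputs (l.map (graphFactor G))))
      (vlist (inputs G l.toFinset) ++ vlist l.toFinset) (mem_outputs_graphFactor G l)

/-! ### The functor from the syntax of the moralisation -/

open Classical in
/-- The hypergraph functor `m` from the syntax of the moralisation of `G` to the free hypergraph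
category of `G`: the identity on objects; the generator of a clique `C` is sent to the graph of the
generator `parents(a) ⟶ a` if `C = {a} ∪ parents(a)`, and to `omni` otherwise. -/
noncomputable def moralFunctor (G : ODAG.{v}) : Syn G.moral ⥤ HSyn G :=
  FreeCat.lift (fun _ => inferInstance) (fun _ => inferInstance) of rfl (fun _ _ => rfl)
    (fun C : Subtype (α := Finset G.V) _ =>
      if h : ∃ a : G.V, C.1 = insert a (G.parents a) then
        castHom rfl (congrArg (fun T => of (vlist T)) h.choose_spec.symm)
          (graphFactor G h.choose).hom
      else
        HypCat.omni (of (vlist C.1) : HSyn G))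

/-! ### Bayesian and Markov networks -/

/-- The hypergraph functor into matrices that agrees on objects and generators with a given
CD-functor into stochastic matrices. -/
noncomputable def extend {U : Type w} {G : ODAG.{v}} (F : CDSyn G ⥤ FinStoch U)
    (hF : IsCDFunctor F) : HSyn G ⥤ MatCat U :=
  FreeCat.lift (fun _ => inferInstance) (fun _ => inferInstance)
    (fun X => (FinStoch.toMat U).obj (F.obj (of X)))
    (congrArg (FinStoch.toMat U).obj hF.obj_unit)
    (fun X Y => congrArg (FinStoch.toMat U).obj (hF.obj_tensor (of X) (of Y)))
    (fun a => (FinStoch.toMat U).map (F.map (FreeCat.gen .cd (dagSig G) a)))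

/-- `F` is a model of the ordered DAG `G` with distribution `ω` and assignment `τ`. -/
structure IsBNModel {U : Type w} (ω : CDSyn ODAG.point.{v} ⥤ FinStoch U) (G : ODAG.{v})
    (τ : VCat G.V ⥤ FinStoch U) (F : CDSyn G ⥤ FinStoch U) : Prop where
  isCD : IsCDFunctor F
  assignment : VCat.incl .cd (dagSig G) ⋙ F = τ
  distribution : bangDAG G ⋙ F = ω

/-- `Φ` is a model of the ordered undirected graph `H` whose distribution is `ω`, up to
normalisation, and with assignment `τ`. -/
structure IsMNModel {U : Type w} (ω : CDSyn ODAG.point.{v} ⥤ FinStoch U) (H : OUGr.{v})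
    (τ : VCat H.V ⥤ FinStoch U) (Φ : Syn H ⥤ MatCat U) : Prop where
  isHyp : IsHypFunctor Φ
  assignment : VCat.incl .hyp (ugSig H) ⋙ Φ ⋙ FinProjStoch.quot U = τ ⋙ FinProjStoch.emb U
  distribution :
    starPoint ⋙ bangUGr H ⋙ Φ ⋙ FinProjStoch.quot U = ω ⋙ FinProjStoch.emb U

/-- An (irredundant) Bayesian network. -/
structure BN (U : Type w) where
  ω : CDSyn ODAG.point.{v} ⥤ FinStoch U
  ω_isCD : IsCDFunctor ω
  G : ODAG.{v}
  τ : VCat G.V ⥤ FinStoch U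
  τ_isSym : IsSymFunctor τ
  factorises : ∃ F : CDSyn G ⥤ FinStoch U, IsBNModel ω G τ F

/-- An (irredundant) Markov network. -/
structure MN (U : Type w) where
  ω : CDSyn ODAG.point.{v} ⥤ FinStoch U
  ω_isCD : IsCDFunctor ω
  H : OUGr.{v}
  τ : VCat H.V ⥤ FinStoch U
  τ_isSym : IsSymFunctor τ
  factorises : ∃ Φ : Syn H ⥤ MatCat U, IsMNModel ω H τ Φ

end PGM
namespace PGM

open FreeCat (of)

/-! ### Morphisms of networks -/

theorem VCat.map_id_obj {V : Type v} [LinearOrder V] [Fintype V] (X : VCat V) :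
    (VCat.map (OrderHom.id : V →o V)).obj X = X := by
  refine congrArg of (a₁ := X.toList.flatMap _) (a₂ := X.toList) ?_
  have h : ∀ b : V, vlist (Finset.univ.filter fun a => (OrderHom.id : V →o V) a = b) = [b] := by
    intro b
    rw [← vlist_singleton]
    congr 1; ext; simp
  simp only [h, List.flatMap_singleton']

theorem VCat.map_comp_obj {V V' V'' : Type v} [LinearOrder V] [Fintype V] [LinearOrder V']
    [Fintype V'] [LinearOrder V''] [Fintype V''] (α : V' →o V) (β : V'' →o V') (X : VCat V) :
    (VCat.map β).obj ((VCat.map α).obj X) = (VCat.map (α.comp β)).obj X := by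
  refine congrArg of ((List.flatMap_assoc (l := X.toList)).trans ?_)
  refine congrArg (fun f => X.toList.flatMap f) (funext fun b => ?_)
  refine vlist_eq (List.pairwise_flatMap.2 ⟨fun a _ => vlist_pairwise _, ?_⟩) ?_
  · refine (vlist_pairwise _).imp fun {a₁ a₂} h x hx y hy => ?_
    have hx' := (Finset.mem_filter.1 (mem_vlist.1 hx)).2
    have hy' := (Finset.mem_filter.1 (mem_vlist.1 hy)).2
    by_contra hlt
    have := β.monotone (not_lt.1 hlt)
    rw [hx', hy'] at this
    exact absurd h (not_lt.2 this)
  · intro x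
    simp [List.mem_flatMap, mem_vlist]

/-- The data on which the semantic part of a morphism of networks depends: a distribution and an
assignment, on an ordered set of vertices, where the distribution is on the product of the sets
assigned to the vertices. -/
structure PreNet (U : Type w) where
  V : Type v
  [order : LinearOrder V]
  [fin : Fintype V]
  ω : CDSyn ODAG.point.{v} ⥤ FinStoch U
  ω_isCD : IsCDFunctor ω
  τ : VCat V ⥤ FinStoch U
  τ_isSym : IsSymFunctor τ
  obj_eq : ∀ X : VCat PUnit.{v + 1},
    ω.obj ((VCat.incl .cd (dagSig ODAG.point)).obj X) = τ.obj ((VCat.map (toPoint V)).obj X)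

attribute [instance] PreNet.order PreNet.fin

theorem bang_obj_eq {V : Type v} [LinearOrder V] [Fintype V] (X : VCat PUnit.{v + 1}) :
    X.toList.flatMap (fun _ => vlist (Finset.univ : Finset V)) =
      ((VCat.map (toPoint V)).obj X).toList := by
  refine congrArg (fun f => X.toList.flatMap f) (funext fun b => congrArg vlist ?_)
  ext a; simp [toPoint]

variable {U : Type w}

/-- A Bayesian network, forgetting the edges of the graph. -/
def BN.pre (N : BN.{w, v} U) : PreNet.{w, v} U where
  V := N.G.V
  ω := N.ω
  ω_isCD := N.ω_isCD
  τ := N.τ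
  τ_isSym := N.τ_isSym
  obj_eq X := by
    obtain ⟨F, hF⟩ := N.factorises
    rw [← hF.assignment, ← hF.distribution]
    exact congrArg (fun l => F.obj (of l)) (bang_obj_eq X)

/-- A Markov network, forgetting the edges of the graph. -/
def MN.pre (N : MN.{w, v} U) : PreNet.{w, v} U where
  V := N.H.V
  ω := N.ω
  ω_isCD := N.ω_isCD
  τ := N.τ
  τ_isSym := N.τ_isSym
  obj_eq X := by
    obtain ⟨Φ, hΦ⟩ := N.factorises
    have h₁ := Functor.congr_obj hΦ.distribution ((VCat.incl .cd (dagSig ODAG.point)).obj X)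
    have h₂ := Functor.congr_obj hΦ.assignment ((VCat.map (toPoint N.H.V)).obj X)
    have h₃ : (FinProjStoch.emb U).obj (N.ω.obj ((VCat.incl .cd (dagSig ODAG.point)).obj X)) =
        (FinProjStoch.emb U).obj (N.τ.obj ((VCat.map (toPoint N.H.V)).obj X)) :=
      h₁.symm.trans ((congrArg (fun l => (FinProjStoch.quot U).obj (Φ.obj (of l)))
        (bang_obj_eq X)).trans h₂)
    exact congrArg (fun Y : FinProjStoch U => FinStoch.of Y.set) h₃

/-- The semantic part `(η, ηh)` of a morphism of networks over an order-preserving map `α` of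
vertices: a monoidal transformation `η : τ ⟶ τ' ∘ V(α)` and a distribution-preserving monoidal
transformation `ηh : ω ⟶ ω'`, which coincide as transformations between functors from the
vertex-list category of the one-vertex graph. -/
@[ext]
structure SemHom (N N' : PreNet.{w, v} U) (α : N'.V →o N.V) where
  η : MonTrans N.τ (VCat.map α ⋙ N'.τ)
  ηh : MonTrans N.ω N'.ω
  dist : HEq (N.ω.map (FreeCat.gen .cd (dagSig ODAG.point) (default : PUnit.{v + 1})) ≫
      ηh.app (of [default]))
    (N'.ω.map (FreeCat.gen .cd (dagSig ODAG.point) (default : PUnit.{v + 1})))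
  compat : ∀ X : VCat PUnit.{v + 1}, HEq (ηh.app ((VCat.incl .cd (dagSig ODAG.point)).obj X))
    (η.app ((VCat.map (toPoint N.V)).obj X))

theorem MonTrans.app_heq {C : Type*} [StrictSMC C] {D : Type*} [StrictSMC D] {F G : C ⥤ D}
    (η : MonTrans F G) {X Y : C} (h : X = Y) : HEq (η.app X) (η.app Y) := by
  subst h; rfl

theorem MonTrans.ext_heq {C : Type*} [StrictSMC C] {D : Type*} [StrictSMC D] {F G : C ⥤ D}
    {η η' : MonTrans F G} (h : ∀ X, HEq (η.app X) (η'.app X)) : η = η' :=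
  MonTrans.ext (funext fun X => eq_of_heq (h X))

/-- The identity monoidal transformation. -/
def MonTrans.id {C : Type*} [StrictSMC C] {D : Type*} [StrictSMC D] {F : C ⥤ D}
    (hF : IsSymFunctor F) : MonTrans F F where
  app X := 𝟙 (F.obj X)
  app_tensor X Y := by rw [StrictSMC.tensorHom_id]; exact id_heq (hF.obj_tensor X Y)
  app_unit := id_heq hF.obj_unit

/-- The composition of monoidal transformations. -/
def MonTrans.comp {C : Type*} [StrictSMC C] {D : Type*} [StrictSMC D] {F G H : C ⥤ D}
    (hF : IsSymFunctor F) (hG : IsSymFunctor G) (hH : IsSymFunctor H) (η : MonTrans F G)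
    (θ : MonTrans G H) : MonTrans F H where
  app X := η.app X ≫ θ.app X
  app_tensor X Y := by
    rw [StrictSMC.tensorHom_comp]
    exact comp_heq_comp (hF.obj_tensor X Y) (hG.obj_tensor X Y) (hH.obj_tensor X Y)
      (η.app_tensor X Y) (θ.app_tensor X Y)
  app_unit := by
    have := comp_heq_comp hF.obj_unit hG.obj_unit hH.obj_unit η.app_unit θ.app_unit
    rwa [Category.comp_id] at this

theorem VCat.map_isSym {V V' : Type v} [LinearOrder V] [Fintype V] [LinearOrder V']
    (α : V →o V') : IsSymFunctor (VCat.map α) :=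
  FreeCat.lift_isSym ..

/-- Change of the target of a monoidal transformation to a functor with the same objects. -/
def MonTrans.cast {C : Type*} [StrictSMC C] {D : Type*} [StrictSMC D] {F G H : C ⥤ D}
    (hGH : ∀ X, G.obj X = H.obj X) (η : MonTrans F G) : MonTrans F H where
  app X := castHom rfl (hGH X) (η.app X)
  app_tensor X Y := (castHom_heq rfl (hGH _) _).trans ((η.app_tensor X Y).trans
    (tensorHom_heq rfl (hGH X) rfl (hGH Y) (castHom_heq rfl (hGH X) _).symm
      (castHom_heq rfl (hGH Y) _).symm))
  app_unit := (castHom_heq rfl (hGH _) _).trans η.app_unit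

theorem MonTrans.cast_app_heq {C : Type*} [StrictSMC C] {D : Type*} [StrictSMC D] {F G H : C ⥤ D}
    (hGH : ∀ X, G.obj X = H.obj X) (η : MonTrans F G) (X : C) :
    HEq ((η.cast hGH).app X) (η.app X) :=
  castHom_heq rfl (hGH X) _

/-- Precomposition of a monoidal transformation with a symmetric monoidal functor. -/
def MonTrans.whisker {C : Type*} [StrictSMC C] {D : Type*} [StrictSMC D] {E : Type*} [StrictSMC E]
    {K : E ⥤ C} (hK : IsSymFunctor K) {F G : C ⥤ D} (η : MonTrans F G) :
    MonTrans (K ⋙ F) (K ⋙ G) where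
  app X := η.app (K.obj X)
  app_tensor X Y := (η.app_heq (hK.obj_tensor X Y)).trans (η.app_tensor _ _)
  app_unit := (η.app_heq hK.obj_unit).trans η.app_unit

theorem IsSymFunctor.comp {C : Type*} [StrictSMC C] {D : Type*} [StrictSMC D] {E : Type*}
    [StrictSMC E] {F : C ⥤ D} {G : D ⥤ E} (hF : IsSymFunctor F) (hG : IsSymFunctor G) :
    IsSymFunctor (F ⋙ G) where
  obj_unit := (congrArg G.obj hF.obj_unit).trans hG.obj_unit
  obj_tensor X Y := (congrArg G.obj (hF.obj_tensor X Y)).trans (hG.obj_tensor _ _)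
  map_tensor {X Y X' Y'} f f' := by
    have : ∀ {P P' Q Q' : D} (_ : P = P') (_ : Q = Q') {g : P ⟶ Q} {g' : P' ⟶ Q'}, HEq g g' →
        HEq (G.map g) (G.map g') := by
      rintro P P' Q Q' rfl rfl g g' h; rw [eq_of_heq h]
    exact (this (hF.obj_tensor _ _) (hF.obj_tensor _ _) (hF.map_tensor f f')).trans
      (hG.map_tensor _ _)
  map_braid X Y := by
    have : ∀ {P P' Q Q' : D} (_ : P = P') (_ : Q = Q') {g : P ⟶ Q} {g' : P' ⟶ Q'}, HEq g g' →
        HEq (G.map g) (G.map g') := by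
      rintro P P' Q Q' rfl rfl g g' h; rw [eq_of_heq h]
    exact (this (hF.obj_tensor _ _) (hF.obj_tensor _ _) (hF.map_braid X Y)).trans
      (hG.map_braid _ _)

namespace SemHom

variable {N N' N'' N''' : PreNet.{w, v} U}

/-- The identity: both transformations are identities. -/
noncomputable def id (N : PreNet.{w, v} U) : SemHom N N OrderHom.id where
  η := (MonTrans.id N.τ_isSym).cast fun X => congrArg N.τ.obj (VCat.map_id_obj X).symm
  ηh := MonTrans.id N.ω_isCD.toIsSymFunctor
  dist := heq_of_eq (Category.comp_id _)
  compat X := (id_heq (N.obj_eq X)).trans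
    (MonTrans.cast_app_heq (G := N.τ) (H := VCat.map OrderHom.id ⋙ N.τ)
      (fun X => congrArg N.τ.obj (VCat.map_id_obj X).symm)
      (MonTrans.id N.τ_isSym) ((VCat.map (toPoint N.V)).obj X)).symm

/-- Composition is component-wise; here `τ'' ∘ V(β) ∘ V(α)` is identified with
`τ'' ∘ V(α ∘ β)`. -/
noncomputable def comp {α : N'.V →o N.V} {β : N''.V →o N'.V} (f : SemHom N N' α) (g : SemHom N' N'' β) :
    SemHom N N'' (α.comp β) where
  η := (MonTrans.comp N.τ_isSym ((VCat.map_isSym α).comp N'.τ_isSym)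
      ((VCat.map_isSym α).comp ((VCat.map_isSym β).comp N''.τ_isSym)) f.η
      (g.η.whisker (VCat.map_isSym α))).cast fun X =>
    congrArg N''.τ.obj (VCat.map_comp_obj α β X)
  ηh := MonTrans.comp N.ω_isCD.toIsSymFunctor N'.ω_isCD.toIsSymFunctor
    N''.ω_isCD.toIsSymFunctor f.ηh g.ηh
  dist := by
    have e : ∀ M : PreNet.{w, v} U, M.ω.obj (of ((dagSig ODAG.point).dom
        (default : PUnit.{v + 1}))) = StrictSMC.unit := fun M =>
      (congrArg (fun l => M.ω.obj (of l)) (point_dom _)).trans M.ω_isCD.obj_unit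
    refine HEq.trans ?_ g.dist
    refine (heq_of_eq (Category.assoc _ _ _).symm).trans ?_
    exact comp_heq_comp ((e N).trans (e N').symm) rfl rfl f.dist HEq.rfl
  compat X := by
    refine HEq.trans ?_ (MonTrans.cast_app_heq _ _ _).symm
    have h : (VCat.map α).obj ((VCat.map (toPoint N.V)).obj X) =
        (VCat.map (toPoint N'.V)).obj X := VCat.map_comp_obj _ _ _
    have e : (VCat.map (toPoint N''.V)).obj X =
        (VCat.map β).obj ((VCat.map α).obj ((VCat.map (toPoint N.V)).obj X)) := by
      rw [h]; exact (VCat.map_comp_obj (toPoint N'.V) β X).symm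
    exact comp_heq_comp (N.obj_eq X) ((N'.obj_eq X).trans (congrArg N'.τ.obj h.symm))
      ((N''.obj_eq X).trans (congrArg N''.τ.obj e))
      (f.compat X) ((g.compat X).trans (g.η.app_heq h.symm))

theorem id_η_app (X : VCat N.V) : HEq ((id N).η.app X) (𝟙 (N.τ.obj X)) :=
  MonTrans.cast_app_heq (G := N.τ) (H := VCat.map OrderHom.id ⋙ N.τ)
      (fun X => congrArg N.τ.obj (VCat.map_id_obj X).symm)
    (MonTrans.id N.τ_isSym) X

theorem id_ηh_app (X : CDSyn ODAG.point.{v}) : (id N).ηh.app X = 𝟙 (N.ω.obj X) := rfl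

theorem comp_η_app {α : N'.V →o N.V} {β : N''.V →o N'.V} (f : SemHom N N' α)
    (g : SemHom N' N'' β) (X : VCat N.V) :
    HEq ((f.comp g).η.app X) (f.η.app X ≫ g.η.app ((VCat.map α).obj X)) :=
  MonTrans.cast_app_heq (G := VCat.map α ⋙ VCat.map β ⋙ N''.τ)
    (H := VCat.map (α.comp β) ⋙ N''.τ) (fun X => congrArg N''.τ.obj (VCat.map_comp_obj α β X))
    (MonTrans.comp N.τ_isSym ((VCat.map_isSym α).comp N'.τ_isSym)
      ((VCat.map_isSym α).comp ((VCat.map_isSym β).comp N''.τ_isSym)) f.η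
      (g.η.whisker (VCat.map_isSym α))) X

theorem comp_ηh_app {α : N'.V →o N.V} {β : N''.V →o N'.V} (f : SemHom N N' α)
    (g : SemHom N' N'' β) (X : CDSyn ODAG.point.{v}) :
    (f.comp g).ηh.app X = f.ηh.app X ≫ g.ηh.app X := rfl

theorem id_comp {α : N'.V →o N.V} (f : SemHom N N' α) : (id N).comp f = f := by
  refine SemHom.ext (MonTrans.ext_heq fun X => ?_) (MonTrans.ext (funext fun X => ?_))
  · refine (comp_η_app _ _ _).trans ?_
    refine (comp_heq_comp rfl (congrArg N.τ.obj (VCat.map_id_obj X))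
      (congrArg (fun Y => N'.τ.obj ((VCat.map α).obj Y)) (VCat.map_id_obj X))
      (id_η_app X) (f.η.app_heq (VCat.map_id_obj X))).trans ?_
    exact heq_of_eq (Category.id_comp (f.η.app X))
  · rw [comp_ηh_app, id_ηh_app, Category.id_comp]

theorem comp_id {α : N'.V →o N.V} (f : SemHom N N' α) : f.comp (id N') = f := by
  refine SemHom.ext (MonTrans.ext_heq fun X => ?_) (MonTrans.ext (funext fun X => ?_))
  · refine (comp_η_app _ _ _).trans ?_
    refine (comp_heq_comp rfl rfl (congrArg N'.τ.obj (VCat.map_id_obj _)) HEq.rfl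
      (id_η_app ((VCat.map α).obj X))).trans ?_
    exact heq_of_eq (Category.comp_id (f.η.app X))
  · rw [comp_ηh_app, id_ηh_app, Category.comp_id]

theorem assoc {α : N'.V →o N.V} {β : N''.V →o N'.V} {γ : N'''.V →o N''.V} (f : SemHom N N' α)
    (g : SemHom N' N'' β) (h : SemHom N'' N''' γ) : (f.comp g).comp h = f.comp (g.comp h) := by
  refine SemHom.ext (MonTrans.ext_heq fun X => ?_) (MonTrans.ext (funext fun X => ?_))
  · refine (comp_η_app _ _ _).trans (HEq.trans ?_ (comp_η_app _ _ _).symm)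
    have e := VCat.map_comp_obj α β X
    have e' := VCat.map_comp_obj β γ ((VCat.map α).obj X)
    refine (comp_heq_comp rfl (congrArg N''.τ.obj e.symm)
      (congrArg (fun Y => N'''.τ.obj ((VCat.map γ).obj Y)) e.symm) (comp_η_app f g X)
      (h.η.app_heq e.symm)).trans ?_
    refine (heq_of_eq (Category.assoc (f.η.app X) (g.η.app ((VCat.map α).obj X))
      (h.η.app ((VCat.map β).obj ((VCat.map α).obj X))))).trans ?_
    exact comp_heq_comp rfl rfl (congrArg N'''.τ.obj e') HEq.rfl
      (comp_η_app g h ((VCat.map α).obj X)).symm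
  · simp only [comp_ηh_app, Category.assoc]

end SemHom

/-- A morphism `(α, η, ηh)` of Bayesian networks. -/
@[ext]
structure BN.Hom (N N' : BN.{w, v} U) where
  α : N'.G ⟶ N.G
  sem : SemHom N.pre N'.pre α.map

/-- A morphism `(α, η, ηh)` of Markov networks. -/
@[ext]
structure MN.Hom (N N' : MN.{w, v} U) where
  α : N'.H ⟶ N.H
  sem : SemHom N.pre N'.pre α.map

/-- The category of (irredundant) Bayesian networks. -/
noncomputable instance : Category (BN.{w, v} U) where
  Hom := BN.Hom
  id N := ⟨𝟙 N.G, SemHom.id N.pre⟩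
  comp f g := ⟨g.α ≫ f.α, f.sem.comp g.sem⟩
  id_comp f := BN.Hom.ext (Category.comp_id f.α) (heq_of_eq f.sem.id_comp)
  comp_id f := BN.Hom.ext (Category.id_comp f.α) (heq_of_eq f.sem.comp_id)
  assoc f g h := BN.Hom.ext (Category.assoc h.α g.α f.α).symm
    (heq_of_eq (f.sem.assoc g.sem h.sem))

/-- The category of (irredundant) Markov networks. -/
noncomputable instance : Category (MN.{w, v} U) where
  Hom := MN.Hom
  id N := ⟨𝟙 N.H, SemHom.id N.pre⟩
  comp f g := ⟨g.α ≫ f.α, f.sem.comp g.sem⟩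
  id_comp f := MN.Hom.ext (Category.comp_id f.α) (heq_of_eq f.sem.id_comp)
  comp_id f := MN.Hom.ext (Category.id_comp f.α) (heq_of_eq f.sem.comp_id)
  assoc f g h := MN.Hom.ext (Category.assoc h.α g.α f.α).symm
    (heq_of_eq (f.sem.assoc g.sem h.sem))

end PGM

/-! Part 1 is the string-diagram form of the chain rule: a Bayesian network has the joint density ∏
p(x_v | x_pa(v)), and pointwise multiplication does not care about the order of the factors.

For an object `L` of a hypergraph category, the points `I ⟶ L` form a commutative monoid under
comparison, with unit `omni` (`pointMonoid`). For matrices these are the nonnegative functions on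
`L`, multiplied pointwise. To an endomorphism `u` of `L` belongs the point `diagPt u`, for matrices
the function `x ↦ u(x ∣ x)`. A morphism `f : X ⟶ Y` between lists of wires that occur in `L` is
extended to `L` by `wire` (project `L` onto `X`) and `cowire` (inject `Y` into `L`, leaving the
other wires unconstrained). The graph of `f`, injected into `L`, is the diagonal of this extension
(`graph_comp_cowire`).

The heart of the argument is `diagPt_fusion`. If a morphism keeps its outputs and feeds copies of
them, with its context, into a second one, then the diagonal of the composite is the product of the
two diagonals. The Frobenius laws are what makes this work: comparing and then copying is the same
as copying and then comparing with one of the copies. Applied at each stage of a copy-composition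
(`diagPt_copy_step`), it shows by induction that the graph of the copy-composition is the product of
the graphs of its generators (`diagPt_copyComp`). A compare-composition is a product of the same
kind by construction (`compComp_comp_cowire`), and commutativity of the monoid does the rest.

The bookkeeping with wires rests on two observations. Structural wirings are comonoid morphisms, so
they can be paired, projected and composed as in a cartesian category. And `cowire` is the transpose
of `wire` in the sense of `IsTranspose`; transposes are unique, so the laws of `cowire` need no
separate computation.

For part 2 it suffices to compare the images of the unique generator. A hypergraph functor that is
the identity on objects preserves products of points, so `m` turns the compare-composition of all
cliques into a product over the cliques. Cliques that are not of the form {v} ∪ pa(v) contribute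
`omni`, the unit. The others correspond bijectively to the vertices, because v is the largest
element of {v} ∪ pa(v). What remains is the product that part 1 finds for the copy-composition of
all generators (`hypHom_compCompAll`).

Part 3 pastes commuting triangles and squares of functors out of free categories, each checked on
generators. In part 4 only the preservation of moral edges needs an argument: the semantic part of a
morphism does not see the edges of the graph, so functoriality holds by definition. -/

namespace PGM

/-! ### Copy-discard and Frobenius categories. -/

open MonoidalCategory ComonObj MonObj

/-- The comonoid on an object of a copy-discard category, declared anew so that it is preferred to
the product comonoid on a tensor product. -/
@[reducible]
instance (priority := 2000) copyDiscardComonObj {C : Type u} [Category.{v} C]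
    [MonoidalCategory.{v} C] [CopyDiscardCategory C] (X : C) : ComonObj X :=
  CopyDiscardCategory.comonObj X

/-- A symmetric monoidal category all of whose objects carry commutative comonoids and commutative
monoids, compatible with the monoidal structure and satisfying the Frobenius equations. -/
class FrobeniusCategory (C : Type u) [Category.{v} C] [MonoidalCategory.{v} C]
    extends CopyDiscardCategory C where
  monObj : ∀ X : C, MonObj X
  isCommMonObj : ∀ X : C, IsCommMonObj X
  one_tensor : ∀ X Y : C, η[X ⊗ Y] = (λ_ (𝟙_ C)).inv ≫ (η[X] ⊗ₘ η[Y])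
  one_unit : η[𝟙_ C] = 𝟙 (𝟙_ C)
  frobenius_left : ∀ X : C, Δ[X] ▷ X ≫ (α_ X X X).hom ≫ X ◁ μ[X] = μ[X] ≫ Δ[X]
  frobenius_right : ∀ X : C, X ◁ Δ[X] ≫ (α_ X X X).inv ≫ μ[X] ▷ X = μ[X] ≫ Δ[X]

/-- The monoid on an object of a Frobenius category, preferred to the product monoid on a tensor
product. -/
@[reducible]
instance (priority := 2000) frobeniusMonObj {C : Type u} [Category.{v} C] [MonoidalCategory.{v} C]
    [FrobeniusCategory C] (X : C) : MonObj X :=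
  FrobeniusCategory.monObj X

attribute [instance] FrobeniusCategory.isCommMonObj

section Monoidal

variable {C : Type u} [Category.{v} C] [MonoidalCategory.{v} C]

/-! ### Pairings and comonoid morphisms in a copy-discard category. -/

section CopyDiscard

variable [CopyDiscardCategory C]

/-- Of four copies of a wire the two middle ones can be produced, after reassociation, by a single
copy, and cocommutativity absorbs their crossing. -/
theorem comul_comul_tensorμ (X : C) : Δ[X] ≫ (Δ ⊗ₘ Δ) ≫ tensorμ X X X X = Δ ≫ (Δ ⊗ₘ Δ) := by
  have e : Δ[X] ≫ (Δ ⊗ₘ Δ) =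
      Δ ≫ X ◁ (Δ ≫ Δ ▷ X ≫ (α_ X X X).hom) ≫ (α_ X X (X ⊗ X)).inv := by
    rw [MonoidalCategory.tensorHom_def, comul_assoc_flip_assoc, ← ComonObj.comul_assoc]
    simp [-comul_assoc, -comul_assoc_assoc]
  have r : X ◁ (Δ ≫ Δ ▷ X ≫ (α_ X X X).hom) ≫ (α_ X X (X ⊗ X)).inv ≫ tensorμ X X X X =
      X ◁ (Δ ≫ (Δ ≫ (β_ X X).hom) ▷ X ≫ (α_ X X X).hom) ≫ (α_ X X (X ⊗ X)).inv := by
    simp [tensorμ, -IsCommComonObj.comul_comm, -IsCommComonObj.comul_comm_assoc]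
  rw [reassoc_of% e, e, r, IsCommComonObj.comul_comm]

/-- Copying is itself compatible with copying and discarding; cocommutativity is essential here. -/
instance isComonHom_comul (X : C) : IsComonHom Δ[X] where
  hom_counit := by
    rw [CopyDiscardCategory.discard_tensor]
    simp [unitors_equal]
  hom_comul := by rw [CopyDiscardCategory.copy_tensor, comul_comul_tensorμ]

instance isComonHom_tensorHom {X Y X' Y' : C} (f : X ⟶ Y) (f' : X' ⟶ Y') [IsComonHom f]
    [IsComonHom f'] : IsComonHom (f ⊗ₘ f') where
  hom_counit := by simp [CopyDiscardCategory.discard_tensor]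
  hom_comul := by
    rw [CopyDiscardCategory.copy_tensor, CopyDiscardCategory.copy_tensor,
      tensorHom_comp_tensorHom_assoc, IsComonHom.hom_comul, IsComonHom.hom_comul,
      ← tensorHom_comp_tensorHom, Category.assoc, tensorμ_natural, Category.assoc]

instance isComonHom_counit (X : C) : IsComonHom ε[X] where
  hom_counit := by simp [CopyDiscardCategory.discard_unit]
  hom_comul := by simp [CopyDiscardCategory.copy_unit, unitors_inv_equal]

/-- A comonoid morphism may be copied, so it distributes over a pairing. This and the next lemmas
are the cartesian laws of pairings, with a comonoid morphism required where a component gets copied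
or discarded. -/
theorem comp_pairing {X Y Z W : C} (p : X ⟶ Y) [IsComonHom p] (f : Y ⟶ Z) (g : Y ⟶ W) :
    p ≫ Δ ≫ (f ⊗ₘ g) = Δ ≫ ((p ≫ f) ⊗ₘ (p ≫ g)) := by
  rw [IsComonHom.hom_comul_assoc, tensorHom_comp_tensorHom]

theorem isComonHom_leftUnitor (X : C) : IsComonHom (λ_ X).hom where
  hom_counit := by simp [CopyDiscardCategory.discard_tensor, CopyDiscardCategory.discard_unit]
  hom_comul := by
    rw [leftUnitor_monoidal, CopyDiscardCategory.copy_tensor, CopyDiscardCategory.copy_unit]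
    simp [tensorμ, MonoidalCategory.tensorHom_def]

/-- A copy of `N` that is discarded at once costs nothing, so only `R` is really copied. A
copy-composition keeps its earlier outputs in this way. -/
theorem pairing_fst {R N Q : C} (w : R ⊗ N ⟶ Q) :
    Δ ≫ ((R ◁ ε ≫ (ρ_ R).hom) ⊗ₘ w) = Δ ▷ N ≫ (α_ R R N).hom ≫ R ◁ w := by
  have e := tensorμ_natural (𝟙 R) (𝟙 R) ε[N] (𝟙 N)
  rw [CopyDiscardCategory.copy_tensor]
  have e' : (R ◁ ε[N] ≫ (ρ_ R).hom) ⊗ₘ w =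
      ((𝟙 R ⊗ₘ ε[N]) ⊗ₘ (𝟙 R ⊗ₘ 𝟙 N)) ≫ (ρ_ R).hom ▷ (R ⊗ N) ≫ R ◁ w := by
    simp only [MonoidalCategory.tensorHom_def, comp_whiskerRight, Category.assoc,
      id_whiskerRight, MonoidalCategory.whiskerLeft_id, Category.id_comp]
  rw [e', Category.assoc, ← reassoc_of% e, tensorHom_comp_tensorHom_assoc, tensorHom_id,
    tensorHom_id, ComonObj.counit_comul]
  simp [tensorμ, MonoidalCategory.tensorHom_def]
  monoidal

theorem pairing_fst_snd {A X Q : C} (q : X ⟶ Q) :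
    Δ ≫ ((A ◁ ε ≫ (ρ_ A).hom) ⊗ₘ (ε ▷ X ≫ (λ_ X).hom ≫ q)) = A ◁ q := by
  rw [pairing_fst]
  rw [MonoidalCategory.whiskerLeft_comp, ← associator_naturality_middle_assoc,
    ← comp_whiskerRight_assoc, ComonObj.comul_counit]
  simp

/-- Coassociativity, in the form needed to split a list of requested wires. -/
theorem pairing_assoc {X Y Z W : C} (f : X ⟶ Y) (g : X ⟶ Z) (h : X ⟶ W) :
    Δ ≫ (f ⊗ₘ (Δ ≫ (g ⊗ₘ h))) = Δ ≫ ((Δ ≫ (f ⊗ₘ g)) ⊗ₘ h) ≫ (α_ Y Z W).hom := by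
  have e : f ⊗ₘ (Δ ≫ (g ⊗ₘ h)) = X ◁ Δ ≫ (f ⊗ₘ (g ⊗ₘ h)) := by
    rw [← id_tensorHom, tensorHom_comp_tensorHom, Category.id_comp]
  have e' : (Δ ≫ (f ⊗ₘ g)) ⊗ₘ h = Δ ▷ X ≫ ((f ⊗ₘ g) ⊗ₘ h) := by
    rw [← tensorHom_id, tensorHom_comp_tensorHom, Category.id_comp]
  rw [e, e', Category.assoc, associator_naturality, ComonObj.comul_assoc_assoc]

theorem pairing_comp_fst {X Y Z : C} (f : X ⟶ Y) (g : X ⟶ Z) [IsComonHom g] :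
    (Δ ≫ (f ⊗ₘ g)) ≫ Y ◁ ε ≫ (ρ_ Y).hom = f := by
  rw [← id_tensorHom, Category.assoc, tensorHom_comp_tensorHom_assoc, IsComonHom.hom_counit,
    Category.comp_id, comul_counit_hom_assoc, Iso.inv_hom_id, Category.comp_id]

theorem pairing_comp_snd {X Y Z : C} (f : X ⟶ Y) (g : X ⟶ Z) [IsComonHom f] :
    (Δ ≫ (f ⊗ₘ g)) ≫ ε ▷ Z ≫ (λ_ Z).hom = g := by
  rw [← tensorHom_id, Category.assoc, tensorHom_comp_tensorHom_assoc, IsComonHom.hom_counit,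
    Category.comp_id, counit_comul_hom_assoc, Iso.inv_hom_id, Category.comp_id]

theorem isComonHom_pairing {X Y Z : C} (f : X ⟶ Y) (g : X ⟶ Z) [IsComonHom f] [IsComonHom g] :
    IsComonHom (Δ ≫ (f ⊗ₘ g)) := inferInstance

theorem isComonHom_rightUnitor (X : C) : IsComonHom (ρ_ X).hom where
  hom_counit := by simp [CopyDiscardCategory.discard_tensor, CopyDiscardCategory.discard_unit,
    unitors_equal]
  hom_comul := by
    rw [rightUnitor_monoidal, CopyDiscardCategory.copy_tensor, CopyDiscardCategory.copy_unit]
    simp [tensorμ, MonoidalCategory.tensorHom_def]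

instance isComonHom_fst (X Y : C) : IsComonHom (X ◁ ε[Y] ≫ (ρ_ X).hom) := by
  have := isComonHom_rightUnitor X
  rw [← id_tensorHom]
  infer_instance

instance isComonHom_snd (X Y : C) : IsComonHom (ε[X] ▷ Y ≫ (λ_ Y).hom) := by
  have := isComonHom_leftUnitor Y
  rw [← tensorHom_id]
  infer_instance

end CopyDiscard

/-! ### Points under comparison, diagonals and transposes. -/

section Frobenius

variable [FrobeniusCategory C] {L : C}

/-- The product of two points of a commutative monoid. -/
def pmul (s t : 𝟙_ C ⟶ L) : 𝟙_ C ⟶ L := (λ_ (𝟙_ C)).inv ≫ (s ⊗ₘ t) ≫ μ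

theorem pmul_comm (s t : 𝟙_ C ⟶ L) : pmul s t = pmul t s := by
  have h : (λ_ (𝟙_ C)).inv ≫ (β_ (𝟙_ C) (𝟙_ C)).hom = (λ_ (𝟙_ C)).inv := by
    simp [← unitors_equal]
  unfold pmul
  rw [← IsCommMonObj.mul_comm L, BraidedCategory.braiding_naturality_assoc, reassoc_of% h]
  simp

theorem pmul_assoc (s t r : 𝟙_ C ⟶ L) : pmul (pmul s t) r = pmul s (pmul t r) := by
  have e : ∀ f g h : 𝟙_ C ⟶ L, ((λ_ (𝟙_ C)).inv ≫ (f ⊗ₘ g) ≫ μ) ⊗ₘ h =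
      (λ_ (𝟙_ C)).inv ▷ 𝟙_ C ≫ ((f ⊗ₘ g) ⊗ₘ h) ≫ μ ▷ L := fun f g h => by
    simp only [← tensorHom_id, tensorHom_comp_tensorHom, Category.id_comp, Category.comp_id]
  have e' : ∀ f g h : 𝟙_ C ⟶ L, h ⊗ₘ ((λ_ (𝟙_ C)).inv ≫ (f ⊗ₘ g) ≫ μ) =
      𝟙_ C ◁ (λ_ (𝟙_ C)).inv ≫ (h ⊗ₘ (f ⊗ₘ g)) ≫ L ◁ μ := fun f g h => by
    simp only [← id_tensorHom, tensorHom_comp_tensorHom, Category.id_comp, Category.comp_id]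
  simp only [pmul, e, e', Category.assoc, MonObj.mul_assoc, associator_naturality_assoc]
  simp only [← Category.assoc]
  congr 3
  monoidal_coherence

theorem one_pmul (s : 𝟙_ C ⟶ L) : pmul η s = s := by
  simp [pmul, MonoidalCategory.tensorHom_def']

/-- The points of an object of a Frobenius category form a commutative monoid under comparison. -/
@[reducible]
def pointMonoid (L : C) : CommMonoid (𝟙_ C ⟶ L) where
  mul := pmul
  one := η
  mul_assoc := pmul_assoc
  one_mul := one_pmul
  mul_one s := (pmul_comm s η).trans (one_pmul s)
  mul_comm := pmul_comm

/-- The `L`-linear endomorphism given by the diagonal of an endomorphism of `L`. -/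
def diagEnd (u : L ⟶ L) : L ⟶ L := Δ ≫ L ◁ u ≫ μ

/-- The diagonal of an endomorphism, as a point. -/
def diagPt (u : L ⟶ L) : 𝟙_ C ⟶ L := η ≫ diagEnd u

/-- A diagonal endomorphism is linear over the comparison monoid, hence it is multiplication by its
value at the unit. Linearity is the Frobenius law: write `s` as the product of `s` and `η`; the copy
that follows the comparison slides onto the leg carrying `η`. -/
theorem comp_diagEnd (s : 𝟙_ C ⟶ L) (h : L ⟶ L) : s ≫ diagEnd h = pmul s (diagPt h) := by
  have e : s = (λ_ (𝟙_ C)).inv ≫ (s ⊗ₘ η) ≫ μ := by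
    rw [← pmul, pmul_comm, one_pmul]
  conv_lhs => rw [e]
  simp only [diagEnd, diagPt, pmul, Category.assoc]
  rw [← reassoc_of% (FrobeniusCategory.frobenius_right L)]
  congr 1
  simp only [MonoidalCategory.tensorHom_def, MonoidalCategory.whiskerLeft_comp, Category.assoc]
  congr 3
  rw [← whisker_exchange_assoc, MonObj.mul_assoc]
  simp

/-- For matrices `diagEnd u` only rescales each element, and the scalar may be applied before
copying or to either copy. In general Frobenius and coassociativity move it to the right copy, and
cocommutativity then moves it to the left one. -/
theorem diagEnd_comp_comul (u : L ⟶ L) : diagEnd u ≫ Δ = Δ ≫ diagEnd u ▷ L := by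
  have h : diagEnd u ≫ Δ = Δ ≫ L ◁ diagEnd u := by
    simp only [diagEnd, Category.assoc, ← FrobeniusCategory.frobenius_left,
      MonoidalCategory.whiskerLeft_comp]
    rw [whisker_exchange_assoc]
    simp
  rw [← IsCommComonObj.comul_comm L, ← Category.assoc, h]
  simp

/-- Fusion: in a diagonal, comparing the output of `u` with the context and feeding a copy of it,
with the context, into `k` amounts to feeding two copies of the context into `k`. -/
theorem diagPt_fusion (u : L ⟶ L) (k : L ⊗ L ⟶ L) :
    diagPt (Δ ≫ u ▷ L ≫ Δ ▷ L ≫ (α_ L L L).hom ≫ L ◁ k ≫ μ) =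
      pmul (diagPt u) (diagPt (Δ ≫ k)) := by
  rw [← comp_diagEnd]
  -- The outer diagonal compares the final output with the context. By associativity of comparison
  -- and the Frobenius law, this can be done on the output of `u` before it is copied, which turns
  -- `u` into `diagEnd u`.
  have h : Δ ≫ L ◁ (Δ ≫ u ▷ L ≫ Δ ▷ L ≫ (α_ L L L).hom ≫ L ◁ k ≫ μ) ≫ μ =
      Δ ≫ (diagEnd u ≫ Δ) ▷ L ≫ (α_ L L L).hom ≫ L ◁ k ≫ μ := by
    simp only [diagEnd, Category.assoc]
    rw [← FrobeniusCategory.frobenius_right]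
    have e : L ◁ (α_ L L L).hom ≫ L ◁ L ◁ k ≫ L ◁ μ ≫ μ =
        (α_ L (L ⊗ L) L).inv ≫ (α_ L L L).inv ▷ L ≫ μ ▷ L ▷ L ≫ (α_ L L L).hom ≫ L ◁ k ≫ μ := by
      rw [associator_naturality_left_assoc, ← whisker_exchange_assoc, MonObj.mul_assoc]
      simp
    simp [e]
  rw [diagPt, diagEnd, h, comp_whiskerRight, Category.assoc]
  -- The diagonal of `u` slides to the front, where it meets `η` and becomes `diagPt u`.
  have e := diagEnd_comp_comul u
  rw [← reassoc_of% e]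
  simp [diagPt, diagEnd]

/-- `i : Y ⟶ L` is the transpose of `π : L ⟶ Y`. -/
structure IsTranspose {Y L : C} (i : Y ⟶ L) (π : L ⟶ Y) : Prop where
  one_comp : η ≫ i = η
  comul_comp : Δ ≫ i ▷ Y = i ≫ Δ ≫ L ◁ π

namespace IsTranspose

/-- Slid around the cup `η ≫ Δ`, `i` becomes `π`. The two axioms say slightly more than this: for
matrices they make `i` the transpose of the matrix of a function. -/
theorem bend {Y : C} {i : Y ⟶ L} {π : L ⟶ Y} (h : IsTranspose i π) :
    η ≫ Δ ≫ i ▷ Y = η ≫ Δ ≫ L ◁ π := by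
  rw [h.comul_comp, ← Category.assoc, h.one_comp]

/-- The snake identity recovers `i` from its bent form, and `bend` expresses that form by `π` alone.
-/
theorem unique {Y : C} {i i' : Y ⟶ L} {π : L ⟶ Y} (h : IsTranspose i π) (h' : IsTranspose i' π) :
    i = i' := by
  have snake : ∀ j : Y ⟶ L, (λ_ Y).inv ≫ (η ≫ Δ ≫ j ▷ Y) ▷ Y ≫ (α_ L Y Y).hom ≫
      L ◁ (μ ≫ ε) ≫ (ρ_ L).hom = j := fun j => by
    have e := FrobeniusCategory.frobenius_left Y
    simp only [comp_whiskerRight, Category.assoc, associator_naturality_left_assoc,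
      ← whisker_exchange_assoc, MonoidalCategory.whiskerLeft_comp, rightUnitor_naturality]
    rw [reassoc_of% e]
    simp
  rw [← snake i, h.bend, ← h'.bend, snake]

theorem id (L : C) : IsTranspose (𝟙 L) (𝟙 L) := ⟨by simp, by simp⟩

theorem unit (L : C) : IsTranspose η[L] ε[L] where
  one_comp := by simp [FrobeniusCategory.one_unit]
  comul_comp := by simp [CopyDiscardCategory.copy_unit, unitors_inv_equal]

theorem comp {Y Z : C} {i : Y ⟶ L} {π : L ⟶ Y} {j : Z ⟶ Y} {ρ : Y ⟶ Z} (h : IsTranspose i π)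
    (h' : IsTranspose j ρ) : IsTranspose (j ≫ i) (π ≫ ρ) where
  one_comp := by rw [← Category.assoc, h'.one_comp, h.one_comp]
  comul_comp := by
    rw [comp_whiskerRight, reassoc_of% h'.comul_comp, whisker_exchange, reassoc_of% h.comul_comp]
    simp

theorem tensor {Y L' Y' : C} {i : Y ⟶ L} {π : L ⟶ Y} {i' : Y' ⟶ L'} {π' : L' ⟶ Y'}
    (h : IsTranspose i π) (h' : IsTranspose i' π') : IsTranspose (i ⊗ₘ i') (π ⊗ₘ π') where
  one_comp := by simp [FrobeniusCategory.one_tensor, h.one_comp, h'.one_comp]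
  comul_comp := by
    simp only [CopyDiscardCategory.copy_tensor, Category.assoc]
    have e := tensorμ_natural i (𝟙 Y) i' (𝟙 Y')
    have e' := tensorμ_natural (𝟙 L) π (𝟙 L') π'
    simp only [tensorHom_id, id_tensorHom, id_whiskerRight] at e e'
    rw [← e, ← e']
    simp [h.comul_comp, h'.comul_comp]

theorem mul (L : C) : IsTranspose μ[L] Δ[L] where
  one_comp := by
    rw [FrobeniusCategory.one_tensor]
    simp only [MonoidalCategory.tensorHom_def, Category.assoc, MonObj.mul_one]
    simp [← unitors_equal]
  comul_comp := by
    -- With a crossing in front, the two wires to be compared are the adjacent inner ones, one from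
    -- each copied wire; in this position the Frobenius laws apply.
    have e : (β_ L L).hom ▷ (L ⊗ L) ≫ tensorμ L L L L ≫ μ ▷ (L ⊗ L) =
        (α_ L L (L ⊗ L)).hom ≫ L ◁ ((α_ L L L).inv ≫ μ ▷ L) ≫ (α_ L L L).inv ≫
          (β_ L L).hom ▷ L ≫ (α_ L L L).hom := by
      have n := BraidedCategory.braiding_naturality_right L μ[L]
      have r : L ◁ ((α_ L L L).inv ≫ μ ▷ L) ≫ (α_ L L L).inv ≫ (β_ L L).hom ▷ L ≫
          (α_ L L L).hom = L ◁ (α_ L L L).inv ≫ (α_ L (L ⊗ L) L).inv ≫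
            (L ◁ μ ≫ (β_ L L).hom) ▷ L ≫ (α_ L L L).hom := by
        rw [MonoidalCategory.whiskerLeft_comp, Category.assoc,
          associator_inv_naturality_middle_assoc]
        simp only [comp_whiskerRight, Category.assoc]
      rw [r, n, BraidedCategory.braiding_tensor_right_hom]
      simp [tensorμ]
    rw [CopyDiscardCategory.copy_tensor, MonoidalCategory.tensorHom_def]
    -- Cocommutativity supplies the crossing that `e` requires, and it removes the crossing again at
    -- the end.
    conv_lhs => rw [← IsCommComonObj.comul_comm L]
    simp only [comp_whiskerRight, Category.assoc]
    rw [← whisker_exchange_assoc, e, IsCommComonObj.comul_comm, associator_naturality_right_assoc,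
      ← MonoidalCategory.whiskerLeft_comp_assoc, FrobeniusCategory.frobenius_right,
      MonoidalCategory.whiskerLeft_comp_assoc,
      reassoc_of% (FrobeniusCategory.frobenius_left L)]
    have c : Δ[L] ≫ L ◁ Δ = Δ ≫ Δ ▷ L ≫ (α_ L L L).hom := ComonObj.comul_assoc L
    rw [reassoc_of% c, c, Iso.hom_inv_id_assoc, ← comp_whiskerRight_assoc,
      IsCommComonObj.comul_comm]

end IsTranspose

/-- The diagonal of the composite of two morphisms, the first of which keeps a copy of its inputs
and of its outputs as inputs of the second, is the product of their diagonals. -/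
theorem diagPt_copy_comp {X N R Q Z : C} {πX : L ⟶ X} {πN : L ⟶ N} {πR : L ⟶ R} {πQ : L ⟶ Q}
    {iR : R ⟶ L} {iZ : Z ⟶ L} (hR : IsTranspose iR πR) {w : R ⊗ N ⟶ Q}
    (hw : Δ ≫ (πR ⊗ₘ πN) ≫ w = πQ) (f : X ⟶ R) (g : Q ⟶ Z) :
    diagPt (Δ ≫ (πX ⊗ₘ πN) ≫ f ▷ N ≫ Δ ▷ N ≫ (α_ R R N).hom ≫ R ◁ w ≫
      (iR ⊗ₘ (g ≫ iZ)) ≫ μ) = pmul (diagPt (πX ≫ f ≫ iR)) (diagPt (πQ ≫ g ≫ iZ)) := by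
  -- Both morphisms are extended to `L`. The second one reads its inputs from two contexts, one for
  -- the outputs of `f` and one for everything else; by `hw` it sees just `πQ` when the two contexts
  -- are copies of each other.
  have e := diagPt_fusion (πX ≫ f ≫ iR) ((πR ⊗ₘ πN) ≫ w ≫ g ≫ iZ)
  rw [reassoc_of% hw] at e
  rw [← e]
  have e₁ : (πX ⊗ₘ πN) ≫ f ▷ N ≫ Δ ▷ N ≫ (α_ R R N).hom ≫ R ◁ w ≫ (iR ⊗ₘ (g ≫ iZ)) =
      (πX ≫ f) ▷ L ≫ (Δ ≫ iR ▷ R) ▷ L ≫ (L ⊗ R) ◁ πN ≫ (α_ L R N).hom ≫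
        L ◁ (w ≫ g ≫ iZ) := by
    have e₂ : R ◁ w ≫ (iR ⊗ₘ (g ≫ iZ)) = iR ▷ (R ⊗ N) ≫ L ◁ (w ≫ g ≫ iZ) := by
      rw [MonoidalCategory.tensorHom_def, whisker_exchange_assoc]
      simp only [MonoidalCategory.whiskerLeft_comp]
    rw [e₂, MonoidalCategory.tensorHom_def, ← associator_naturality_left_assoc]
    simp only [comp_whiskerRight, Category.assoc]
    rw [whisker_exchange_assoc, whisker_exchange_assoc, whisker_exchange_assoc]
  -- Injecting one of two copies of the outputs of `f` is the same as injecting before the copy and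
  -- projecting the other copy back. This brings all the copying to `L`, where fusion takes place.
  have e₃ : (Δ ≫ iR ▷ R) ▷ L ≫ (L ⊗ R) ◁ πN ≫ (α_ L R N).hom =
      iR ▷ L ≫ Δ ▷ L ≫ (α_ L L L).hom ≫ L ◁ (πR ⊗ₘ πN) := by
    rw [hR.comul_comp]
    simp [MonoidalCategory.tensorHom_def]
  have e₄ := e₁ =≫ μ
  rw [reassoc_of% e₃] at e₄
  simp only [Category.assoc] at e₄
  rw [e₄]
  simp only [comp_whiskerRight, MonoidalCategory.whiskerLeft_comp, Category.assoc]

end Frobenius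

end Monoidal

/-! ### Strict CD- and hypergraph categories as copy-discard and Frobenius categories. -/

section Bridge

variable {C : Type u} [StrictSMC.{v} C]

/-- Converts a strict law, stated as a heterogeneous equality, into naturality of a coherence
isomorphism of the form `eqToHom`. -/
theorem eq_of_heq_eqToHom {X X' Y Y' : C} {f : X ⟶ Y} {g : X' ⟶ Y'} (hX : X = X') (hY : Y = Y')
    (h : HEq f g) : f ≫ eqToHom hY = eqToHom hX ≫ g := by
  subst hX hY h; simp

theorem eqToHom_tensorHom_eqToHom {X X' Y Y' : C} (h : X = X') (h' : Y = Y') :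
    eqToHom h ⊠ₕ eqToHom h' = eqToHom (congrArg₂ StrictSMC.tensorObj h h') := by
  subst h h'; exact StrictSMC.tensorHom_id _ _

/-- A strict monoidal category as a monoidal category whose coherence isomorphisms are
identities. -/
instance : MonoidalCategory C where
  tensorObj := StrictSMC.tensorObj
  whiskerLeft X _ _ f := 𝟙 X ⊠ₕ f
  whiskerRight f Y := f ⊠ₕ 𝟙 Y
  tensorHom := StrictSMC.tensorHom
  tensorUnit := StrictSMC.unit
  associator X Y Z := eqToIso (StrictSMC.tensorObj_assoc X Y Z)
  leftUnitor X := eqToIso (StrictSMC.unit_tensorObj X)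
  rightUnitor X := eqToIso (StrictSMC.tensorObj_unit X)
  tensorHom_def f g := by
    rw [← StrictSMC.tensorHom_comp, Category.comp_id, Category.id_comp]
  id_tensorHom_id := StrictSMC.tensorHom_id
  tensorHom_comp_tensorHom _ _ _ _ := (StrictSMC.tensorHom_comp _ _ _ _).symm
  whiskerLeft_id := StrictSMC.tensorHom_id
  id_whiskerRight := StrictSMC.tensorHom_id
  associator_naturality f g h := eq_of_heq_eqToHom (StrictSMC.tensorObj_assoc _ _ _)
    (StrictSMC.tensorObj_assoc _ _ _) (StrictSMC.tensorHom_assoc f g h)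
  leftUnitor_naturality f := eq_of_heq_eqToHom (StrictSMC.unit_tensorObj _)
    (StrictSMC.unit_tensorObj _) (StrictSMC.unit_tensorHom f)
  rightUnitor_naturality f := eq_of_heq_eqToHom (StrictSMC.tensorObj_unit _)
    (StrictSMC.tensorObj_unit _) (StrictSMC.tensorHom_unit f)
  pentagon W X Y Z := by
    simp only [eqToIso.hom, ← eqToHom_refl, eqToHom_tensorHom_eqToHom, eqToHom_trans]
  triangle X Y := by
    simp only [eqToIso.hom, ← eqToHom_refl, eqToHom_tensorHom_eqToHom, eqToHom_trans]

theorem braid_hexagon (X Y Z : C) : (α_ X Y Z).hom ≫ StrictSMC.braid X (Y ⊠ Z) ≫ (α_ Y Z X).hom =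
    (StrictSMC.braid X Y ⊠ₕ 𝟙 Z) ≫ (α_ Y X Z).hom ≫ (𝟙 Y ⊠ₕ StrictSMC.braid X Z) := by
  have h := eq_of_heq_eqToHom (StrictSMC.tensorObj_assoc X Y Z).symm
    (StrictSMC.tensorObj_assoc Y Z X) (StrictSMC.hexagon X Y Z)
  have e : (α_ X Y Z).hom ≫ eqToHom (StrictSMC.tensorObj_assoc X Y Z).symm = 𝟙 _ :=
    (α_ X Y Z).hom_inv_id
  change (α_ X Y Z).hom ≫ StrictSMC.braid X (Y ⊠ Z) ≫ eqToHom (StrictSMC.tensorObj_assoc Y Z X) = _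
  rw [h, reassoc_of% e]
  rfl

/-- Both sides are inverse to the same composite, the one in the hexagon for `Z`, `X`, `Y`, since
the inverse of a braiding is the opposite braiding. -/
theorem braid_hexagon_inv (X Y Z : C) :
    (α_ X Y Z).inv ≫ StrictSMC.braid (X ⊠ Y) Z ≫ (α_ Z X Y).inv =
      (𝟙 X ⊠ₕ StrictSMC.braid Y Z) ≫ (α_ X Z Y).inv ≫ (StrictSMC.braid X Z ⊠ₕ 𝟙 Y) := by
  have h₁ : ∀ X Y Z : C, (StrictSMC.braid X Y ⊠ₕ 𝟙 Z) ≫ (StrictSMC.braid Y X ⊠ₕ 𝟙 Z) = 𝟙 _ :=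
    fun X Y Z => by
      rw [← StrictSMC.tensorHom_comp, StrictSMC.braid_braid, Category.comp_id,
        StrictSMC.tensorHom_id]
  have h₂ : ∀ X Y Z : C, (𝟙 Z ⊠ₕ StrictSMC.braid X Y) ≫ (𝟙 Z ⊠ₕ StrictSMC.braid Y X) = 𝟙 _ :=
    fun X Y Z => by
      rw [← StrictSMC.tensorHom_comp, StrictSMC.braid_braid, Category.comp_id,
        StrictSMC.tensorHom_id]
  have a : ((StrictSMC.braid Z X ⊠ₕ 𝟙 Y) ≫ (α_ X Z Y).hom ≫ (𝟙 X ⊠ₕ StrictSMC.braid Z Y)) ≫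
      (𝟙 X ⊠ₕ StrictSMC.braid Y Z) ≫ (α_ X Z Y).inv ≫ (StrictSMC.braid X Z ⊠ₕ 𝟙 Y) = 𝟙 _ := by
    simp only [Category.assoc, reassoc_of% h₂ Z Y X, Iso.hom_inv_id_assoc, h₁]
  have b : ((α_ X Y Z).inv ≫ StrictSMC.braid (X ⊠ Y) Z ≫ (α_ Z X Y).inv) ≫
      (StrictSMC.braid Z X ⊠ₕ 𝟙 Y) ≫ (α_ X Z Y).hom ≫ (𝟙 X ⊠ₕ StrictSMC.braid Z Y) = 𝟙 _ := by
    rw [← braid_hexagon]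
    have c := StrictSMC.braid_braid (X ⊠ Y) Z
    simp only [Category.assoc, Iso.inv_hom_id_assoc, reassoc_of% c, Iso.inv_hom_id]
  have key : ∀ {P Q : C} {x z : P ⟶ Q} {y : Q ⟶ P}, x ≫ y = 𝟙 P → y ≫ z = 𝟙 Q → x = z :=
    fun {_ _ x _ _} hx hz => by
      rw [← Category.comp_id x, ← hz, ← Category.assoc, hx, Category.id_comp]
  exact key b a

/-- The symmetry of a strict symmetric monoidal category. -/
instance : SymmetricCategory C where
  braiding X Y := ⟨StrictSMC.braid X Y, StrictSMC.braid Y X, StrictSMC.braid_braid X Y,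
    StrictSMC.braid_braid Y X⟩
  braiding_naturality_right X _ _ f := StrictSMC.braid_naturality (𝟙 X) f
  braiding_naturality_left f Z := StrictSMC.braid_naturality f (𝟙 Z)
  hexagon_forward := braid_hexagon
  hexagon_reverse := braid_hexagon_inv
  symmetry X Y := StrictSMC.braid_braid X Y

theorem associator_hom_eq (X Y Z : C) :
    (α_ X Y Z).hom = eqToHom (StrictSMC.tensorObj_assoc X Y Z) := rfl

theorem associator_inv_eq (X Y Z : C) :
    (α_ X Y Z).inv = eqToHom (StrictSMC.tensorObj_assoc X Y Z).symm := rfl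

theorem interchange_eq_tensorμ (X Y Z W : C) : interchange X Y Z W = tensorμ X Y Z W := by
  have e : ∀ Y Z : C, eqToHom (interchange_dom X Y Z W) =
      (α_ X Y (Z ⊗ W)).hom ≫ X ◁ (α_ Y Z W).inv ≫ (α_ X (Y ⊗ Z) W).inv := fun Y Z => by
    simp only [associator_hom_eq, associator_inv_eq, MonoidalCategory.whiskerLeft_eqToHom,
      eqToHom_trans]
  have e' : eqToHom (interchange_dom X Z Y W).symm =
      (α_ X (Z ⊗ Y) W).hom ≫ X ◁ (α_ Z Y W).hom ≫ (α_ X Z (Y ⊗ W)).inv := by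
    simp only [associator_hom_eq, associator_inv_eq, MonoidalCategory.whiskerLeft_eqToHom,
      eqToHom_trans]
  unfold interchange
  rw [e, e']
  change _ ≫ ((X ◁ (β_ Y Z).hom) ▷ W) ≫ _ = _
  simp [tensorμ]

theorem eq_comp_eqToHom_of_heq {X Y Y' : C} {f : X ⟶ Y} {g : X ⟶ Y'} (hY : Y' = Y)
    (h : HEq f g) : f = g ≫ eqToHom hY := by
  subst hY h; simp

theorem eq_eqToHom_comp_of_heq {X X' Y : C} {f : X ⟶ Y} {g : X' ⟶ Y} (hX : X = X')
    (h : HEq f g) : f = eqToHom hX ≫ g := by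
  subst hX h; simp

/-- The comonoids of a CD-category. -/
@[reducible]
def cdComonObj [CDCat C] (X : C) : ComonObj X where
  counit := CDCat.del X
  comul := CDCat.copy X
  counit_comul := (eq_comp_eqToHom_of_heq (StrictSMC.unit_tensorObj X).symm
    (CDCat.copy_del X)).trans (Category.id_comp _)
  -- A CD-category postulates one counit law; cocommutativity gives the other.
  comul_counit := by
    have h : CDCat.copy X ≫ CDCat.del X ▷ X = (λ_ X).inv :=
      (eq_comp_eqToHom_of_heq (StrictSMC.unit_tensorObj X).symm
        (CDCat.copy_del X)).trans (Category.id_comp _)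
    have c : CDCat.copy X ≫ (β_ X X).hom = CDCat.copy X := CDCat.copy_comm X
    rw [← c, Category.assoc, ← BraidedCategory.braiding_naturality_left, reassoc_of% h]
    simp
  comul_assoc := by
    have h := eq_comp_eqToHom_of_heq (StrictSMC.tensorObj_assoc X X X) (CDCat.copy_assoc X).symm
    exact h.trans (Category.assoc _ _ _)

instance [CDCat C] : CopyDiscardCategory C where
  comonObj := cdComonObj
  isCommComonObj X := @IsCommComonObj.mk _ _ _ _ X (cdComonObj X) (CDCat.copy_comm X)
  copy_tensor X Y := (CDCat.copy_tensor X Y).trans (by rw [interchange_eq_tensorμ]; rfl)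
  discard_tensor X Y := eq_comp_eqToHom_of_heq (StrictSMC.unit_tensorObj _) (CDCat.del_tensor X Y)
  copy_unit := (eq_comp_eqToHom_of_heq (StrictSMC.unit_tensorObj _).symm
    CDCat.copy_unit).trans (Category.id_comp _)
  discard_unit := CDCat.del_unit

/-- The monoids of a hypergraph category. -/
@[reducible]
def hypMonObj [CDCat C] [HypCat C] (X : C) : MonObj X where
  one := HypCat.omni X
  mul := HypCat.compare X
  one_mul := (eq_eqToHom_comp_of_heq (StrictSMC.unit_tensorObj X)
    (HypCat.omni_compare X)).trans (Category.comp_id _)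
  mul_one := by
    have h : HypCat.omni X ▷ X ≫ HypCat.compare X = (λ_ X).hom :=
      (eq_eqToHom_comp_of_heq (StrictSMC.unit_tensorObj X)
        (HypCat.omni_compare X)).trans (Category.comp_id _)
    have c : (β_ X X).hom ≫ HypCat.compare X = HypCat.compare X := HypCat.compare_comm X
    rw [← c, BraidedCategory.braiding_naturality_right_assoc, h]
    simp
  mul_assoc := eq_eqToHom_comp_of_heq (StrictSMC.tensorObj_assoc X X X) (HypCat.compare_assoc X)

instance [CDCat C] [HypCat C] : FrobeniusCategory C where
  monObj := hypMonObj
  isCommMonObj X := @IsCommMonObj.mk _ _ _ _ X (hypMonObj X) (HypCat.compare_comm X)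
  one_tensor X Y := eq_eqToHom_comp_of_heq (StrictSMC.unit_tensorObj _).symm
    (HypCat.omni_tensor X Y)
  one_unit := HypCat.omni_unit
  frobenius_left := HypCat.frobenius_left
  frobenius_right := HypCat.frobenius_right

end Bridge
end PGM

namespace PGM

open MonoidalCategory ComonObj MonObj FreeCat

/-! ### Wirings in the free CD-category. -/

section Wire

variable {A : Type u} [DecidableEq A] {S : MonSig A}

theorem proj_cons_self (a : A) (X : List A) (h : a ∈ a :: X) :
    proj S a (a :: X) h = (of [a] : FreeCat .cd S) ◁ ε[of X] ≫ (ρ_ (of [a])).hom := by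
  rw [proj, dif_pos rfl]
  exact Category.id_comp _

theorem proj_cons_of_ne {a x : A} {X : List A} (e : x ≠ a) (h : a ∈ x :: X) (h' : a ∈ X) :
    proj S a (x :: X) h =
      ε[(of [x] : FreeCat .cd S)] ▷ of X ≫ (λ_ (of X)).hom ≫ proj S a X h' := by
  rw [proj, dif_neg e]
  change ε[(of [x] : FreeCat .cd S)] ⊗ₘ proj S a X h' = _
  rw [← leftUnitor_naturality, MonoidalCategory.tensorHom_def]
  -- The left unitor is an identity here because `[] ++ X` reduces to `X`.
  exact (congrArg _ (Category.comp_id _)).symm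

theorem wire_nil (X : List A) (h) : wire S X [] h = ε[(of X : FreeCat .cd S)] := rfl

theorem wire_cons (X : List A) (y : A) (Y : List A) (h) :
    wire S X (y :: Y) h = Δ[(of X : FreeCat .cd S)] ≫ (proj S y X (h y List.mem_cons_self) ⊗ₘ
      wire S X Y fun a ha => h a (List.mem_cons_of_mem y ha)) := rfl

instance isComonHom_proj (a : A) : ∀ (X : List A) (h : a ∈ X), IsComonHom (proj S a X h)
  | [], h => (List.not_mem_nil h).elim
  | x :: X, h => by
    by_cases e : x = a
    · subst e
      rw [proj_cons_self]
      exact isComonHom_fst (of [x] : FreeCat .cd S) (of X)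
    · have h' := (List.mem_cons.1 h).resolve_left fun e' => e e'.symm
      have := isComonHom_proj a X h'
      rw [proj_cons_of_ne e h h', ← Category.assoc]
      have := isComonHom_snd (of [x] : FreeCat .cd S) (of X)
      exact inferInstanceAs (IsComonHom ((ε[(of [x] : FreeCat .cd S)] ▷ of X ≫ (λ_ (of X)).hom) ≫
        proj S a X h'))

/-- Projections and pairings of comonoid morphisms are comonoid morphisms. This is what allows
cartesian reasoning about wirings. -/
instance isComonHom_wire (X : List A) : ∀ (Y : List A) (h), IsComonHom (wire S X Y h)
  | [], h => isComonHom_counit (of X : FreeCat .cd S)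
  | y :: Y, h => by
    have := isComonHom_wire X Y fun a ha => h a (List.mem_cons_of_mem y ha)
    exact isComonHom_pairing (proj S y X (h y List.mem_cons_self)) _

theorem wire_append (X : List A) : ∀ (Y Z : List A) (h hY hZ), wire S X (Y ++ Z) h =
    Δ[(of X : FreeCat .cd S)] ≫ (wire S X Y hY ⊗ₘ wire S X Z hZ)
  | [], Z, h, hY, hZ => by
    rw [wire_nil, counit_comul_hom]
    exact (Category.comp_id _).symm
  | y :: Y, Z, h, hY, hZ => by
    have e := wire_append X Y Z (fun a ha => h a (List.mem_cons_of_mem y ha))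
      (fun a ha => hY a (List.mem_cons_of_mem y ha)) hZ
    have e' := pairing_assoc (proj S y X (h y List.mem_cons_self))
      (wire S X Y fun a ha => hY a (List.mem_cons_of_mem y ha)) (wire S X Z hZ)
    rw [← e] at e'
    -- The associator of `[y]`, `Y`, `Z` is an identity, as both bracketings reduce to `y :: (Y ++
    -- Z)`.
    exact e'.trans (congrArg _ (Category.comp_id _))

/-- At the first match the pairing is projected to its head; at any other wire the head is
discarded. Either way the unwanted component disappears because it is a comonoid morphism. -/
theorem wire_comp_proj (X : List A) (a : A) : ∀ (Y : List A) (h : ∀ b ∈ Y, b ∈ X) (ha : a ∈ Y),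
    wire S X Y h ≫ proj S a Y ha = proj S a X (h a ha)
  | [], _, ha => (List.not_mem_nil ha).elim
  | y :: Y, h, ha => by
    rw [wire_cons]
    by_cases e : y = a
    · subst e
      rw [proj_cons_self]
      exact pairing_comp_fst (proj S y X (h y List.mem_cons_self)) _
    · have h' := (List.mem_cons.1 ha).resolve_left fun e' => e e'.symm
      have := wire_comp_proj X a Y (fun a ha => h a (List.mem_cons_of_mem y ha)) h'
      rw [proj_cons_of_ne e ha h', ← this]
      have e' := pairing_comp_snd (proj S y X (h y List.mem_cons_self))
        (wire S X Y fun a ha => h a (List.mem_cons_of_mem y ha)) =≫ proj S a Y h'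
      simp only [Category.assoc] at e' ⊢
      exact e'

/-- Selections compose: the first wiring distributes over the pairings that make up the second, and
each projection then reads the original wire. -/
theorem wire_comp_wire (X Y : List A) (h : ∀ b ∈ Y, b ∈ X) : ∀ (Z : List A) (hZ : ∀ b ∈ Z, b ∈ Y),
    wire S X Y h ≫ wire S Y Z hZ = wire S X Z fun b hb => h b (hZ b hb)
  | [], _ => IsComonHom.hom_counit (wire S X Y h)
  | z :: Z, hZ => by
    rw [wire_cons, wire_cons, ← wire_comp_wire X Y h Z fun a ha => hZ a (List.mem_cons_of_mem z ha),
      ← wire_comp_proj X z Y h (hZ z List.mem_cons_self)]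
    exact comp_pairing (wire S X Y h) _ _

theorem wire_cons_left {a : A} (X : List A) : ∀ (Y : List A) (_ : a ∉ Y) (h h'),
    wire S (a :: X) Y h = ε[(of [a] : FreeCat .cd S)] ▷ of X ≫ (λ_ (of X)).hom ≫ wire S X Y h'
  | [], _, h, h' => by
    have e := (isComonHom_snd (of [a] : FreeCat .cd S) (of X)).hom_counit
    rw [Category.assoc] at e
    exact e.symm
  | y :: Y, hY, h, h' => by
    rw [List.mem_cons, not_or] at hY
    have e := comp_pairing (X := (of [a] : FreeCat .cd S) ⊗ of X) (Y := of X)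
      (ε[(of [a] : FreeCat .cd S)] ▷ of X ≫ (λ_ (of X)).hom) (proj S y X (h' y List.mem_cons_self))
      (wire S X Y fun a ha => h' a (List.mem_cons_of_mem y ha))
    simp only [Category.assoc] at e
    rw [wire_cons, wire_cons, wire_cons_left X Y hY.2 _ fun a ha => h' a (List.mem_cons_of_mem y ha),
      proj_cons_of_ne hY.1 _ (h' y List.mem_cons_self)]
    exact e.symm

theorem wire_cons_cons {a : A} (X Y : List A) (ha : a ∉ Y) (h h') :
    wire S (a :: X) (a :: Y) h = (of [a] : FreeCat .cd S) ◁ wire S X Y h' := by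
  rw [wire_cons, wire_cons_left X Y ha _ h', proj_cons_self]
  exact pairing_fst_snd (A := (of [a] : FreeCat .cd S)) (wire S X Y h')

/-- Repetitions have to be excluded because `proj` reads the first occurrence: a second occurrence
would be filled with a copy of the first. -/
theorem wire_self : ∀ (Y : List A) (_ : Y.Nodup) (h), wire S Y Y h = 𝟙 (of Y : FreeCat .cd S)
  | [], _, _ => CopyDiscardCategory.discard_unit (C := FreeCat .cd S)
  | y :: Y, hY, h => by
    have hY := List.nodup_cons.1 hY
    rw [wire_cons_cons Y Y hY.1 _ (fun _ h => h), wire_self Y hY.2]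
    exact MonoidalCategory.whiskerLeft_id _ _

/-- The first occurrences of the wires of `Y` lie in the front part, so `Z` is never read. -/
theorem wire_append_left (Z : List A) : ∀ (Y : List A) (_ : Y.Nodup) (h), wire S (Y ++ Z) Y h =
    (of Y : FreeCat .cd S) ◁ ε[(of Z : FreeCat .cd S)] ≫ (ρ_ _).hom
  | [], _, h => by
    have e := leftUnitor_naturality ε[(of Z : FreeCat .cd S)]
    rw [unitors_equal] at e
    exact ((Category.id_comp _).symm.trans e.symm)
  | y :: Y, hY, h => by
    have hY := List.nodup_cons.1 hY
    have e := wire_cons_cons (S := S) (Y ++ Z) Y hY.1 h fun b hb => List.mem_append_left Z hb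
    rw [wire_append_left Z Y hY.2, MonoidalCategory.whiskerLeft_comp] at e
    have e' := tensor_whiskerLeft (of [y] : FreeCat .cd S) (of Y) ε[(of Z : FreeCat .cd S)]
    -- Whiskering by, and the unitor of, a tensor product differ from the iterated ones by
    -- associators of lists starting with `[y]`, which are identities by computation.
    have e₁ : (of (y :: Y) : FreeCat .cd S) ◁ ε[(of Z : FreeCat .cd S)] =
        (of [y] : FreeCat .cd S) ◁ (of Y : FreeCat .cd S) ◁ ε[(of Z : FreeCat .cd S)] :=
      e'.trans ((Category.id_comp _).trans (Category.comp_id _))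
    have e₂ : (ρ_ (of (y :: Y) : FreeCat .cd S)).hom =
        (of [y] : FreeCat .cd S) ◁ (ρ_ (of Y : FreeCat .cd S)).hom :=
      ((rightUnitor_tensor_hom (of [y] : FreeCat .cd S) (of Y)).trans (Category.id_comp _))
    rw [e₁, e₂]
    exact e

end Wire

/-! ### Cowires as transposes of wires. -/

section Cowire

variable {A : Type u} {S : MonSig A}

/-- The image of a morphism of a free CD-category in the free hypergraph category. -/
def starHom {X Y : List A} (f : (of X : FreeCat .cd S) ⟶ of Y) : (of X : FreeCat .hyp S) ⟶ of Y :=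
  (FreeCat.lift (k := .cd) (S := S) (D := FreeCat .hyp S) (fun _ => inferInstance)
    (fun h => False.elim h) of rfl (fun _ _ => rfl) (FreeCat.gen .hyp S)).map f

theorem starHom_comp {X Y Z : List A} (f : (of X : FreeCat .cd S) ⟶ of Y)
    (g : (of Y : FreeCat .cd S) ⟶ of Z) : starHom (f ≫ g) = starHom f ≫ starHom g :=
  Functor.map_comp _ f g

theorem starHom_id (X : List A) : starHom (𝟙 (of X : FreeCat .cd S)) = 𝟙 _ := rfl

theorem starHom_tensorHom {X Y X' Y' : List A} (f : (of X : FreeCat .cd S) ⟶ of Y)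
    (g : (of X' : FreeCat .cd S) ⟶ of Y') :
    starHom (X := X ++ X') (Y := Y ++ Y') (f ⊗ₘ g) = starHom f ⊗ₘ starHom g :=
  eq_of_heq ((FreeCat.lift_isSym (k := .cd) (S := S) (D := FreeCat .hyp S) (fun _ => inferInstance)
    (fun h => False.elim h) of rfl (fun _ _ => rfl) (FreeCat.gen .hyp S)).map_tensor f g)

theorem starHom_comul (X : List A) :
    starHom (Y := X ++ X) Δ[(of X : FreeCat .cd S)] = Δ[(of X : FreeCat .hyp S)] :=
  eq_of_heq ((FreeCat.lift_isCD (k := .cd) (S := S) (D := FreeCat .hyp S) (fun _ => inferInstance)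
    (fun h => False.elim h) of rfl (fun _ _ => rfl) (FreeCat.gen .hyp S) trivial).map_copy (of X))

theorem starHom_counit (X : List A) :
    starHom (Y := []) ε[(of X : FreeCat .cd S)] = ε[(of X : FreeCat .hyp S)] :=
  eq_of_heq ((FreeCat.lift_isCD (k := .cd) (S := S) (D := FreeCat .hyp S) (fun _ => inferInstance)
    (fun h => False.elim h) of rfl (fun _ _ => rfl) (FreeCat.gen .hyp S) trivial).map_del (of X))

variable [DecidableEq A]

theorem inj_cons_self (a : A) (X : List A) (h : a ∈ a :: X) :
    inj S a (a :: X) h = (of [a] : FreeCat .hyp S) ◁ η[(of X : FreeCat .hyp S)] := by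
  rw [inj, dif_pos rfl]
  exact (Category.id_comp _).trans (Category.comp_id _)

theorem inj_cons_of_ne {a x : A} {X : List A} (e : x ≠ a) (h : a ∈ x :: X) (h' : a ∈ X) :
    inj S a (x :: X) h = η[(of [x] : FreeCat .hyp S)] ⊗ₘ inj S a X h' := by
  rw [inj, dif_neg e]
  rfl

theorem isTranspose_inj (a : A) : ∀ (X : List A) (h : a ∈ X),
    IsTranspose (inj S a X h) (starHom (proj S a X h))
  | [], h => (List.not_mem_nil h).elim
  | x :: X, h => by
    by_cases e : x = a
    · subst e
      have t := (IsTranspose.id (of [x] : FreeCat .hyp S)).tensor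
        (IsTranspose.unit (of X : FreeCat .hyp S))
      have ep : starHom (proj S x (x :: X) h) =
          𝟙 (of [x] : FreeCat .hyp S) ⊗ₘ ε[(of X : FreeCat .hyp S)] := by
        rw [proj, dif_pos rfl]
        have e₁ := starHom_tensorHom (𝟙 (of [x] : FreeCat .cd S)) ε[(of X : FreeCat .cd S)]
        rw [starHom_counit] at e₁
        refine Eq.trans ?_ e₁
        exact congrArg starHom ((Category.id_comp _).trans (Category.comp_id _))
      rw [inj_cons_self, ep]
      exact t
    · have h' := (List.mem_cons.1 h).resolve_left fun e' => e e'.symm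
      have t := (IsTranspose.unit (of [x] : FreeCat .hyp S)).tensor (isTranspose_inj a X h')
      have ep : starHom (proj S a (x :: X) h) =
          ε[(of [x] : FreeCat .hyp S)] ⊗ₘ starHom (proj S a X h') := by
        rw [proj, dif_neg e]
        have e₁ := starHom_tensorHom ε[(of [x] : FreeCat .cd S)] (proj S a X h')
        rw [starHom_counit] at e₁
        exact e₁
      rw [inj_cons_of_ne e h h', ep]
      exact t

/-- The two recursions mirror each other: `μ` is transpose to `Δ`, `inj` to `proj` and `omni` to
`del`. By uniqueness of transposes the laws of `wire` pass to `cowire` with the order of composition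
reversed. -/
theorem isTranspose_cowire (X : List A) : ∀ (Y : List A) (h : ∀ a ∈ Y, a ∈ X),
    IsTranspose (cowire S X Y h) (starHom (wire S X Y h))
  | [], h => by
    rw [wire_nil, starHom_counit]
    exact IsTranspose.unit (of X : FreeCat .hyp S)
  | y :: Y, h => by
    have t := (IsTranspose.mul (of X : FreeCat .hyp S)).comp
      ((isTranspose_inj y X (h y List.mem_cons_self)).tensor
        (isTranspose_cowire X Y fun a ha => h a (List.mem_cons_of_mem y ha)))
    rw [wire_cons]
    have e := starHom_comp (Y := X ++ X) (Z := [y] ++ Y) Δ[(of X : FreeCat .cd S)]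
      (proj S y X (h y List.mem_cons_self) ⊗ₘ
        wire S X Y fun a ha => h a (List.mem_cons_of_mem y ha))
    rw [starHom_comul, starHom_tensorHom] at e
    rw [← e] at t
    exact t

theorem cowire_append (X Y Z : List A) (h hY hZ) : cowire S X (Y ++ Z) h =
    (cowire S X Y hY ⊗ₘ cowire S X Z hZ) ≫ μ[(of X : FreeCat .hyp S)] := by
  refine (isTranspose_cowire X (Y ++ Z) h).unique ?_
  have t := (IsTranspose.mul (of X : FreeCat .hyp S)).comp
    ((isTranspose_cowire X Y hY).tensor (isTranspose_cowire X Z hZ))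
  have e := starHom_comp (Y := X ++ X) (Z := Y ++ Z) Δ[(of X : FreeCat .cd S)]
    (wire S X Y hY ⊗ₘ wire S X Z hZ)
  rw [starHom_comul, starHom_tensorHom] at e
  rw [← e] at t
  rw [wire_append X Y Z h hY hZ]
  exact t

theorem cowire_comp_cowire (X Y Z : List A) (h : ∀ b ∈ Y, b ∈ X) (hZ : ∀ b ∈ Z, b ∈ Y) :
    cowire S Y Z hZ ≫ cowire S X Y h = cowire S X Z fun b hb => h b (hZ b hb) := by
  refine IsTranspose.unique ?_ (isTranspose_cowire X Z _)
  rw [← wire_comp_wire X Y h Z hZ, starHom_comp]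
  exact (isTranspose_cowire X Y h).comp (isTranspose_cowire Y Z hZ)

theorem cowire_self (Y : List A) (hY : Y.Nodup) (h) :
    cowire S Y Y h = 𝟙 (of Y : FreeCat .hyp S) := by
  refine (isTranspose_cowire Y Y h).unique ?_
  rw [wire_self Y hY]
  exact IsTranspose.id _

end Cowire

/-! ### Graphs as diagonals. -/

section

variable {C : Type u} [Category.{v} C] [MonoidalCategory.{v} C] [FrobeniusCategory C]

/-- The input leg of a graph, once injected into `L`, slides around the cup and becomes the
projection `π`; the final comparison then closes up a diagonal. -/
theorem IsTranspose.bend_comp {L X Y : C} {i : X ⟶ L} {π : L ⟶ X} (h : IsTranspose i π)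
    (f : X ⟶ Y) (j : Y ⟶ L) :
    η ≫ Δ ≫ X ◁ f ≫ (i ⊗ₘ j) ≫ μ = diagPt (π ≫ f ≫ j) := by
  have e : X ◁ f ≫ (i ⊗ₘ j) = i ▷ X ≫ L ◁ (f ≫ j) := by
    rw [MonoidalCategory.tensorHom_def, whisker_exchange_assoc, MonoidalCategory.whiskerLeft_comp]
  have b := h.bend
  rw [reassoc_of% e]
  simp only [diagPt, diagEnd]
  rw [MonoidalCategory.whiskerLeft_comp _ π, Category.assoc]
  simp only [← Category.assoc] at b ⊢
  rw [b]

/-- A point ignores the context, so its diagonal is its product with the unit `η`. -/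
theorem diagPt_counit_comp {L : C} (f : 𝟙_ C ⟶ L) : diagPt (ε[L] ≫ f) = f := by
  have h := one_pmul f
  simpa [diagPt, diagEnd, pmul, MonoidalCategory.tensorHom_def, unitors_inv_equal] using h

end

/-! ### Diagonals of the steps of a copy-composition. -/

section Factors

variable {A : Type u} {S : MonSig A}

theorem starHom_eqToHom {X Y : List A} (h : X = Y) :
    starHom (S := S) (eqToHom (congrArg of h)) = eqToHom (congrArg of h) := by
  subst h; rfl

theorem starHom_whiskerLeft {Y Y' : List A} (X : List A) (f : (of Y : FreeCat .cd S) ⟶ of Y') :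
    starHom (X := X ++ Y) (Y := X ++ Y') ((of X : FreeCat .cd S) ◁ f) =
      (of X : FreeCat .hyp S) ◁ starHom f :=
  starHom_tensorHom (𝟙 (of X : FreeCat .cd S)) f

theorem starHom_whiskerRight {Y Y' : List A} (X : List A) (f : (of Y : FreeCat .cd S) ⟶ of Y') :
    starHom (X := Y ++ X) (Y := Y' ++ X) (f ▷ (of X : FreeCat .cd S)) =
      starHom f ▷ (of X : FreeCat .hyp S) :=
  starHom_tensorHom f (𝟙 (of X : FreeCat .cd S))

variable [DecidableEq A]

theorem graph_comp_cowire {L X Y : List A} (f : (of X : FreeCat .hyp S) ⟶ of Y) (h hX hY) :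
    graph f ≫ cowire S L (X ++ Y) h =
      diagPt (starHom (wire S L X hX) ≫ f ≫ cowire S L Y hY) := by
  rw [cowire_append L X Y h hX hY, ← (isTranspose_cowire L X hX).bend_comp]
  exact (Category.assoc _ _ _).trans (congrArg _ (Category.assoc _ _ _))

theorem starHom_wire_append (X Y Z : List A) (h hY hZ) :
    starHom (wire S X (Y ++ Z) h) =
      Δ[(of X : FreeCat .hyp S)] ≫ (starHom (wire S X Y hY) ⊗ₘ starHom (wire S X Z hZ)) := by
  rw [wire_append X Y Z h hY hZ]
  have e := starHom_comp (Y := X ++ X) (Z := Y ++ Z) Δ[(of X : FreeCat .cd S)]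
    (wire S X Y hY ⊗ₘ wire S X Z hZ)
  rw [starHom_comul, starHom_tensorHom] at e
  exact e

theorem starHom_wire_append_left (Y Z : List A) (hY : Y.Nodup) (h) :
    starHom (wire S (Y ++ Z) Y h) =
      (of Y : FreeCat .hyp S) ◁ ε[(of Z : FreeCat .hyp S)] ≫ (ρ_ _).hom := by
  rw [wire_append_left Z Y hY]
  have e := starHom_comp (X := Y ++ Z) (Y := Y ++ []) (Z := Y)
    ((of Y : FreeCat .cd S) ◁ ε[(of Z : FreeCat .cd S)]) (ρ_ _).hom
  rw [starHom_whiskerLeft (Y' := []), starHom_counit] at e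
  refine e.trans ?_
  exact congrArg _ (starHom_eqToHom (List.append_nil Y))

/-- Reading `R` off `R ++ N` is the first projection when `R` has no repetitions, so `pairing_fst`
applies and only `R` is copied. This brings the wiring into the shape of `diagPt_copy_comp`. -/
theorem starHom_wire_keep (R N Q : List A) (hR : R.Nodup) (h h') :
    starHom (wire S (R ++ N) (R ++ Q) h) =
      Δ[(of R : FreeCat .hyp S)] ▷ of N ≫ (α_ (of R : FreeCat .hyp S) (of R) (of N)).hom ≫
        (of R : FreeCat .hyp S) ◁ starHom (wire S (R ++ N) Q h') := by
  rw [starHom_wire_append _ R Q h (fun _ hb => List.mem_append_left N hb) h',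
    starHom_wire_append_left R N hR]
  exact pairing_fst (R := (of R : FreeCat .hyp S)) (N := of N) (starHom (wire S (R ++ N) Q h'))

/-- The diagonal of a step of a copy-composition is the product of the diagonals of the two
morphisms that are composed. -/
theorem diagPt_copy_step {L X N R Q Z : List A} (hR : R.Nodup)
    (c : (of X : FreeCat .cd S) ⟶ of R) (g : (of Q : FreeCat .cd S) ⟶ of Z)
    (hN : ∀ a ∈ N, a ∈ L) (hXN : ∀ a ∈ X ++ N, a ∈ N) (hRQ : ∀ a ∈ R ++ Q, a ∈ R ++ N)
    (hRZ : ∀ a ∈ R ++ Z, a ∈ L) (hX : ∀ a ∈ X, a ∈ L) (hRL : ∀ a ∈ R, a ∈ L)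
    (hQ : ∀ a ∈ Q, a ∈ L) (hZ : ∀ a ∈ Z, a ∈ L) :
    diagPt (starHom (wire S L N hN) ≫
      starHom (wire S N (X ++ N) hXN ≫ (c ⊠ₕ 𝟙 (of N : FreeCat .cd S)) ≫
        wire S (R ++ N) (R ++ Q) hRQ ≫ (𝟙 (of R : FreeCat .cd S) ⊠ₕ g)) ≫
      cowire S L (R ++ Z) hRZ) =
    pmul (diagPt (starHom (wire S L X hX) ≫ starHom c ≫ cowire S L R hRL))
      (diagPt (starHom (wire S L Q hQ) ≫ starHom g ≫ cowire S L Z hZ)) := by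
  have hQ' : ∀ a ∈ Q, a ∈ R ++ N := fun a ha => hRQ a (List.mem_append_right R ha)
  have hRN : ∀ a ∈ R ++ N, a ∈ L := fun a ha =>
    (List.mem_append.1 ha).elim (hRL a) (hN a)
  -- Reading `Q` from the outputs `R` and the inputs `N` agrees with reading it from `L`, provided
  -- `R` and `N` have themselves been read from `L`. This consistency is what the fusion of the two
  -- diagonals relies on.
  have hw : Δ ≫ (starHom (wire S L R hRL) ⊗ₘ starHom (wire S L N hN)) ≫
      starHom (wire S (R ++ N) Q hQ') = starHom (wire S L Q hQ) := by
    have e := starHom_wire_append (S := S) L R N hRN hRL hN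
    have e' := congrArg starHom (wire_comp_wire (S := S) L (R ++ N) hRN Q hQ')
    rw [starHom_comp, e] at e'
    exact (Category.assoc _ _ _).symm.trans e'
  rw [← diagPt_copy_comp (X := of X) (N := of N) (R := of R) (Q := of Q) (Z := of Z)
    (isTranspose_cowire L R hRL) hw]
  congr 1
  have e₁ : starHom (wire S L N hN) ≫ starHom (wire S N (X ++ N) hXN) =
      Δ[(of L : FreeCat .hyp S)] ≫ (starHom (wire S L X hX) ⊗ₘ starHom (wire S L N hN)) := by
    rw [← starHom_comp, wire_comp_wire, starHom_wire_append _ _ _ _ hX hN]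
  have e₂ : starHom (X := X ++ N) (Y := R ++ N) (c ⊠ₕ 𝟙 (of N : FreeCat .cd S)) =
      starHom c ▷ (of N : FreeCat .hyp S) := starHom_whiskerRight N c
  have e₃ : starHom (X := R ++ Q) (Y := R ++ Z) (𝟙 (of R : FreeCat .cd S) ⊠ₕ g) =
      (of R : FreeCat .hyp S) ◁ starHom g := starHom_whiskerLeft R g
  have e₄ : (of R : FreeCat .hyp S) ◁ starHom g ≫
      (cowire S L R hRL ⊗ₘ cowire S L Z hZ) = cowire S L R hRL ⊗ₘ (starHom g ≫ cowire S L Z hZ) := by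
    rw [← id_tensorHom, tensorHom_comp_tensorHom, Category.id_comp]
  have key := starHom_wire_keep (S := S) R N Q hR hRQ hQ'
  have s := starHom_comp (wire S N (X ++ N) hXN) ((c ⊠ₕ 𝟙 (of N : FreeCat .cd S)) ≫
        wire S (R ++ N) (R ++ Q) hRQ ≫ (𝟙 (of R : FreeCat .cd S) ⊠ₕ g))
  have s' := starHom_comp (X := X ++ N) (Y := R ++ N) (Z := R ++ Z) (c ⊠ₕ 𝟙 (of N : FreeCat .cd S))
        (wire S (R ++ N) (R ++ Q) hRQ ≫ (𝟙 (of R : FreeCat .cd S) ⊠ₕ g))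
  have s'' := starHom_comp (X := R ++ N) (Y := R ++ Q) (Z := R ++ Z)
        (wire S (R ++ N) (R ++ Q) hRQ) (𝟙 (of R : FreeCat .cd S) ⊠ₕ g)
  rw [e₃, key] at s''
  rw [e₂, s''] at s'
  rw [cowire_append L R Z hRZ hRL hZ, s, s', ← e₄]
  simp only [Category.assoc]
  have e₁' := e₁ =≫ (starHom c ▷ (of N : FreeCat .hyp S) ≫
    Δ[(of R : FreeCat .hyp S)] ▷ of N ≫ (α_ (of R : FreeCat .hyp S) (of R) (of N)).hom ≫
        (of R : FreeCat .hyp S) ◁ starHom (wire S (R ++ N) Q hQ') ≫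
        (of R : FreeCat .hyp S) ◁ starHom g ≫
      (cowire S L R hRL ⊗ₘ cowire S L Z hZ) ≫ μ[(of L : FreeCat .hyp S)])
  simp only [Category.assoc] at e₁'
  exact e₁'

end Factors

-- Compare-composition as a product of points.

attribute [local instance] pointMonoid

section Factors

variable {A : Type u} [LinearOrder A] {S : MonSig A}

theorem castHom_comp_cowire {L X Y Y' : List A} (hY : Y = Y')
    (f : (of X : FreeCat .hyp S) ⟶ of Y) (h h') :
    castHom rfl (congrArg of hY) f ≫ cowire S L Y' h' = f ≫ cowire S L Y h := by
  subst hY; simp [castHom]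

/-- A factor as a point of the comparison monoid on a list of wires, if this list contains all its
outputs. -/
noncomputable def factorPt (L : List A) (φ : Factor S) : 𝟙_ (FreeCat .hyp S) ⟶ of L :=
  open Classical in
  if h : ∀ a ∈ vlist φ.out, a ∈ L then φ.hom ≫ cowire S L (vlist φ.out) h else η

theorem factorPt_eq {L : List A} {φ : Factor S} (h : ∀ a ∈ vlist φ.out, a ∈ L) :
    factorPt L φ = φ.hom ≫ cowire S L (vlist φ.out) h := dif_pos h

/-- Once all factors are injected into one list `L`, comparing equal labels is multiplication of
points of `L`, and the nested cowires collapse. The empty composition gives `omni`, the unit. -/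
theorem compComp_comp_cowire (L : List A) : ∀ (l : List (Factor S))
    (h : ∀ a ∈ vlist (outputs l), a ∈ L),
    compComp l ≫ cowire S L (vlist (outputs l)) h = (l.map (factorPt L)).prod
  | [], h => by
    have e : ∀ (Y : List A) (e : [] = Y) (h), eqToHom (congrArg of e) ≫ cowire S L Y h =
        η[(of L : FreeCat .hyp S)] := by
      rintro Y rfl h
      exact Category.id_comp _
    exact e _ vlist_empty.symm h
  | φ :: l, h => by
    have h₁ : ∀ a ∈ vlist φ.out, a ∈ L := fun a ha => h a (mem_outputs_cons a
      (List.mem_append_left _ ha))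
    have h₂ : ∀ a ∈ vlist (outputs l), a ∈ L := fun a ha => h a (mem_outputs_cons a
      (List.mem_append_right _ ha))
    rw [List.map_cons, List.prod_cons, ← compComp_comp_cowire L l h₂, factorPt_eq h₁]
    refine (Category.assoc _ _ _).trans ?_
    rw [cowire_comp_cowire, cowire_append L _ _ _ h₁ h₂]
    have e : castHom (C := FreeCat .hyp S) (X := of [] ⊠ of []) rfl rfl (φ.hom ⊠ₕ compComp l) =
        φ.hom ⊗ₘ compComp l := (Category.id_comp _).trans (Category.comp_id _)
    rw [e]
    refine Eq.trans ?_ (Category.id_comp _).symm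
    have e' := tensorHom_comp_tensorHom_assoc φ.hom (compComp l) (cowire S L (vlist φ.out) h₁)
      (cowire S L (vlist (outputs l)) h₂) μ[(of L : FreeCat .hyp S)]
    exact e'

end Factors

/-! ### Copy-composition as a product of points. -/

section CopyComp

variable (G : ODAG.{v})

/-- For matrices this point is the conditional probability of the value of `a` given those of its
parents, as a function of the joint values of the wires in `L`. -/
theorem factorPt_graphFactor {L : List G.V} (a : G.V) (hp : ∀ b ∈ vlist (G.parents a), b ∈ L)
    (ha : ∀ b ∈ [a], b ∈ L) :
    factorPt L (graphFactor G a) = diagPt (starHom (wire (dagSig G) L (vlist (G.parents a)) hp) ≫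
      FreeCat.gen .hyp (dagSig G) a ≫ cowire (dagSig G) L [a] ha) := by
  have h : ∀ b ∈ vlist (G.parents a) ++ [a], b ∈ L := fun b hb =>
    (List.mem_append.1 hb).elim (hp b) (ha b)
  have e := graph_comp_cowire (FreeCat.gen .hyp (dagSig G) a) h hp ha
  have hv : vlist (G.parents a) ++ [a] = vlist (insert a (G.parents a)) :=
    vlist_insert fun _ hb => ODAG.lt_of_mem_parents hb
  have h' : ∀ b ∈ vlist (insert a (G.parents a)), b ∈ L := fun b hb => h b (hv ▸ hb)
  refine (factorPt_eq (φ := graphFactor G a) h').trans (Eq.trans ?_ e)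
  exact castHom_comp_cowire hv (graph (FreeCat.gen .hyp (dagSig G) a)) h h'

/-- Absorbs the casts in the definitions of copy-compositions; wires and cowires adapt to equal
lists. -/
theorem diagPt_starHom_castHom {L X X' Y Y' : List G.V} (hX : X = X') (hY : Y = Y')
    (f : (of X : CDSyn G) ⟶ of Y) (h h' k k') :
    diagPt (starHom (wire (dagSig G) L X' h') ≫
      starHom (castHom (congrArg of hX) (congrArg of hY) f) ≫ cowire (dagSig G) L Y' k') =
    diagPt (starHom (wire (dagSig G) L X h) ≫ starHom f ≫ cowire (dagSig G) L Y k) := by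
  subst hX hY; simp [castHom]

theorem inputs_toFinset_subset {l L : List G.V}
    (hL : ∀ b ∈ l, ∀ d ∈ vlist (G.parents b), d ∈ L) :
    ∀ d ∈ vlist (inputs G l.toFinset), d ∈ L := by
  intro d hd
  simp only [mem_vlist, inputs, Finset.mem_sdiff, Finset.mem_biUnion, List.mem_toFinset] at hd
  obtain ⟨⟨b, hb, hdb⟩, -⟩ := hd
  exact hL b hb d (mem_vlist.2 hdb)

/-- Induction along the definition: each stage is an instance of `diagPt_copy_step` and contributes
the graph of one generator as a factor. -/
theorem diagPt_copyCompList (L : List G.V) : ∀ (l : List G.V) (hl : l.Pairwise (· > ·))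
    (_ : ∀ b ∈ l, ∀ d ∈ vlist (G.parents b), d ∈ L)
    (hi : ∀ d ∈ vlist (inputs G l.toFinset), d ∈ L) (hr : ∀ d ∈ l.reverse, d ∈ L),
    diagPt (starHom (wire (dagSig G) L _ hi) ≫ starHom (copyCompList G l hl) ≫
      cowire (dagSig G) L l.reverse hr) = (l.map fun a => factorPt L (graphFactor G a)).prod
  | [], _, _, hi, hr => by
    -- The empty copy-composition reads nothing and constrains nothing, so its diagonal is the unit.
    have e : ∀ (X : List G.V) (e : X = []) (h) (h'),
        diagPt (starHom (wire (dagSig G) L X h) ≫ starHom (eqToHom (congrArg of e)) ≫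
          cowire (dagSig G) L [] h') = η := by
      rintro _ rfl h h'
      rw [wire_nil, starHom_counit, eqToHom_refl, starHom_id, Category.id_comp]
      exact diagPt_counit_comp _
    exact e _ (by rw [List.toFinset_nil, inputs_empty, vlist_empty]) hi hr
  | a :: l, hl, hp, hi, hr => by
    have hl' := List.pairwise_cons.1 hl
    have hpl : ∀ b ∈ l, ∀ d ∈ vlist (G.parents b), d ∈ L := fun b hb =>
      hp b (List.mem_cons_of_mem a hb)
    have hrl : ∀ d ∈ l.reverse, d ∈ L := fun d hd =>
      hr d (List.mem_reverse.2 (List.mem_cons_of_mem a (List.mem_reverse.1 hd)))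
    have ha : ∀ b ∈ [a], b ∈ L := fun b hb => hr b (by
      rw [List.reverse_cons]; exact List.mem_append_right _ hb)
    have hil := inputs_toFinset_subset G hpl
    have hia : ∀ d ∈ vlist (inputs G (insert a l.toFinset)), d ∈ L := fun d hd =>
      hi d (by rwa [List.toFinset_cons])
    have hR : l.reverse.Nodup := List.nodup_reverse.2
      (hl'.2.imp fun h => ne_of_gt h)
    rw [List.map_cons, List.prod_cons, ← diagPt_copyCompList L l hl'.2 hpl hil hrl,
      factorPt_graphFactor G a (hp a List.mem_cons_self) ha]
    have e₁ : l.reverse ++ [a] = (a :: l).reverse := List.reverse_cons.symm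
    have e₂ : vlist (inputs G (insert a l.toFinset)) = vlist (inputs G (a :: l).toFinset) := by
      rw [List.toFinset_cons]
    have hra : ∀ d ∈ l.reverse ++ [a], d ∈ L := fun d hd => hr d (e₁ ▸ hd)
    rw [copyCompList]
    refine (diagPt_starHom_castHom G e₂ e₁ _ hia hi hra hr).trans ?_
    refine (diagPt_copy_step hR (copyCompList G l hl'.2)
      (FreeCat.gen .cd (dagSig G) a : (of (vlist (G.parents a)) : CDSyn G) ⟶ of [a]) hia
      (inputs_insert G fun _ hb => hl'.1 _ (List.mem_toFinset.1 hb)) (parents_mem G) hra hil hrl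
      (hp a List.mem_cons_self) ha).trans ?_
    -- The generator with the biggest output heads the list but acts last in the copy-composition.
    exact pmul_comm _ _

theorem diagPt_copyComp (L : List G.V) (T : Finset G.V)
    (hp : ∀ b ∈ T, ∀ d ∈ vlist (G.parents b), d ∈ L)
    (hi : ∀ d ∈ vlist (inputs G T), d ∈ L) (hr : ∀ d ∈ vlist T, d ∈ L) :
    diagPt (starHom (wire (dagSig G) L _ hi) ≫ starHom (copyComp G T) ≫
      cowire (dagSig G) L (vlist T) hr) = ((vlist T).map fun a => factorPt L (graphFactor G a)).prod := by
  have e₁ : (vlist T).reverse.toFinset = T := by ext x; simp [mem_vlist]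
  have hi' : ∀ d ∈ vlist (inputs G (vlist T).reverse.toFinset), d ∈ L := by rwa [e₁]
  have hr' : ∀ d ∈ (vlist T).reverse.reverse, d ∈ L := by rwa [List.reverse_reverse]
  refine (diagPt_starHom_castHom G (congrArg (fun T => vlist (inputs G T)) e₁)
    (List.reverse_reverse _) _ hi' hi hr' hr).trans ?_
  rw [diagPt_copyCompList G L _ (vlist_reverse_pairwise T)
    (fun b hb => hp b (mem_vlist.1 (List.mem_reverse.1 hb))) hi' hr', List.map_reverse]
  exact (List.reverse_perm _).prod_eq

/-- Take for `L` the list of all outputs. Both sides are then the product of the same points, in the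
increasing order of the vertices on the left and in the order of `l` on the right. -/
theorem graphCopyComp_eq_compComp (l : List G.V) (hl : l.Nodup) :
    graphCopyComp G l = compComp (l.map (graphFactor G)) := by
  have hm := mem_outputs_graphFactor G l
  have hL : ∀ d ∈ l, d ∈ vlist (outputs (l.map (graphFactor G))) := fun d hd =>
    hm d (List.mem_append_right _ (mem_vlist.2 (List.mem_toFinset.2 hd)))
  have hp : ∀ b ∈ l.toFinset, ∀ d ∈ vlist (G.parents b),
      d ∈ vlist (outputs (l.map (graphFactor G))) := fun b hb d hd =>
    mem_vlist.2 (mem_outputs.2 ⟨_, List.mem_map_of_mem (List.mem_toFinset.1 hb),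
      Finset.mem_insert_of_mem (mem_vlist.1 hd)⟩)
  have e := compComp_comp_cowire _ (l.map (graphFactor G)) fun _ h => h
  -- Over its own list of outputs, the compare-composition is unchanged by injection.
  rw [cowire_self _ ((vlist_pairwise _).imp fun h => ne_of_lt h), Category.comp_id,
    List.map_map] at e
  rw [e]
  have hi : ∀ d ∈ vlist (inputs G l.toFinset), d ∈ vlist (outputs (l.map (graphFactor G))) :=
    fun d hd => hm d (List.mem_append_left _ hd)
  have hr : ∀ d ∈ vlist l.toFinset, d ∈ vlist (outputs (l.map (graphFactor G))) :=
    fun d hd => hm d (List.mem_append_right _ hd)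
  refine (graph_comp_cowire (starHom (copyComp G l.toFinset)) hm hi hr).trans ?_
  rw [diagPt_copyComp G _ l.toFinset hp hi hr]
  refine List.Perm.prod_eq (M := 𝟙_ (HSyn G) ⟶ of (vlist (outputs (l.map (graphFactor G)))))
    (List.Perm.map _ ?_)
  refine (List.perm_ext_iff_of_nodup ((vlist_pairwise _).imp fun h => ne_of_lt h) hl).2 fun a => ?_
  rw [mem_vlist, List.mem_toFinset]

end CopyComp

/-! ### Hypergraph functors that are the identity on objects. -/

section HypLift

variable {A : Type u} {S S' : MonSig A}
  (g : ∀ σ : S.Gen, (of (S.dom σ) : FreeCat .hyp S') ⟶ of (S.cod σ))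

/-- The hypergraph functor between free hypergraph categories on the same objects that is the
identity on objects and has given values on generators. -/
def hypLift : FreeCat .hyp S ⥤ FreeCat .hyp S' :=
  FreeCat.lift (fun _ => inferInstance) (fun _ => inferInstance) of rfl (fun _ _ => rfl) g

theorem hypLift_isHyp : IsHypFunctor (hypLift g) :=
  FreeCat.lift_isHyp (k := .hyp) (S := S) (D := FreeCat .hyp S') (fun _ => inferInstance)
    (fun _ => inferInstance) of rfl (fun _ _ => rfl) g trivial

/-- The value of `hypLift` on morphisms. -/
def hypHom {X Y : List A} (f : (of X : FreeCat .hyp S) ⟶ of Y) : (of X : FreeCat .hyp S') ⟶ of Y :=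
  (hypLift g).map f

theorem hypHom_comp {X Y Z : List A} (f : (of X : FreeCat .hyp S) ⟶ of Y)
    (f' : (of Y : FreeCat .hyp S) ⟶ of Z) : hypHom g (f ≫ f') = hypHom g f ≫ hypHom g f' :=
  Functor.map_comp _ f f'

theorem hypHom_tensorHom {X Y X' Y' : List A} (f : (of X : FreeCat .hyp S) ⟶ of Y)
    (f' : (of X' : FreeCat .hyp S) ⟶ of Y') :
    hypHom g (X := X ++ X') (Y := Y ++ Y') (f ⊗ₘ f') = hypHom g f ⊗ₘ hypHom g f' :=
  eq_of_heq ((hypLift_isHyp g).map_tensor f f')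

theorem hypHom_mul (X : List A) :
    hypHom g (X := X ++ X) (Y := X) μ[(of X : FreeCat .hyp S)] = μ[(of X : FreeCat .hyp S')] :=
  eq_of_heq ((hypLift_isHyp g).map_compare (of X))

theorem hypHom_one (X : List A) :
    hypHom g (X := []) (Y := X) η[(of X : FreeCat .hyp S)] = η[(of X : FreeCat .hyp S')] :=
  eq_of_heq ((hypLift_isHyp g).map_omni (of X))

theorem hypHom_pmul {L : List A} (s t : 𝟙_ (FreeCat .hyp S) ⟶ of L) :
    hypHom g (X := []) (pmul s t) = pmul (hypHom g (X := []) s) (hypHom g (X := []) t) := by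
  have e := hypHom_comp g (X := []) (Y := L ++ L) (Z := L) (s ⊗ₘ t) μ[(of L : FreeCat .hyp S)]
  have e' := hypHom_tensorHom g (X := []) (X' := []) s t
  rw [hypHom_mul] at e
  have e'' := congrArg (fun k : (of [] : FreeCat .hyp S') ⟶ of (L ++ L) =>
    k ≫ μ[(of L : FreeCat .hyp S')]) e'
  refine (congrArg (hypHom g (X := [])) (Category.id_comp _)).trans (e.trans (e''.trans ?_))
  exact (Category.id_comp _).symm

variable [DecidableEq A]

theorem hypHom_inj (a : A) : ∀ (X : List A) (h : a ∈ X),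
    hypHom g (inj S a X h) = inj S' a X h
  | [], h => (List.not_mem_nil h).elim
  | x :: X, h => by
    by_cases e : x = a
    · subst e
      rw [inj_cons_self, inj_cons_self, ← hypHom_one g]
      exact hypHom_tensorHom g (𝟙 (of [x] : FreeCat .hyp S)) η[(of X : FreeCat .hyp S)]
    · have h' := (List.mem_cons.1 h).resolve_left fun e' => e e'.symm
      rw [inj_cons_of_ne e h h', inj_cons_of_ne e h h', ← hypHom_inj a X h', ← hypHom_one g]
      exact hypHom_tensorHom g η[(of [x] : FreeCat .hyp S)] (inj S a X h')

theorem hypHom_cowire (X : List A) : ∀ (Y : List A) (h : ∀ a ∈ Y, a ∈ X),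
    hypHom g (cowire S X Y h) = cowire S' X Y h
  | [], _ => hypHom_one g X
  | y :: Y, h => by
    have e := hypHom_comp g (X := [y] ++ Y) (Y := X ++ X) (Z := X)
      (inj S y X (h y List.mem_cons_self) ⊗ₘ
        cowire S X Y fun a ha => h a (List.mem_cons_of_mem y ha)) μ[(of X : FreeCat .hyp S)]
    rw [hypHom_tensorHom, hypHom_inj, hypHom_cowire X Y, hypHom_mul] at e
    exact e

end HypLift

section HypPt

variable {A : Type u} {S S' : MonSig A}
  (g : ∀ σ : S.Gen, (of (S.dom σ) : FreeCat .hyp S') ⟶ of (S.cod σ))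

/-- Such a functor preserves comparison and `omni`, hence is a monoid homomorphism on the points of
each object. -/
theorem hypHom_prod {I : Type*} {L : List A} (s : I → (𝟙_ (FreeCat .hyp S) ⟶ of L)) :
    ∀ l : List I, hypHom g (X := []) (List.prod (α := 𝟙_ (FreeCat .hyp S) ⟶ of L) (l.map s)) =
      List.prod (α := 𝟙_ (FreeCat .hyp S') ⟶ of L) (l.map fun i => hypHom g (X := []) (s i))
  | [] => hypHom_one g L
  | i :: l => by
    rw [List.map_cons, List.prod_cons, List.map_cons, List.prod_cons, ← hypHom_prod s l]
    exact hypHom_pmul g _ _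

variable [LinearOrder A]

theorem hypHom_factorPt {L : List A} {φ : Factor S} (h : ∀ a ∈ vlist φ.out, a ∈ L) :
    hypHom g (X := []) (factorPt L φ) =
      hypHom g φ.hom ≫ cowire S' L (vlist φ.out) h := by
  rw [factorPt_eq h, ← hypHom_cowire g]
  exact hypHom_comp g (X := []) φ.hom _

end HypPt

/-! ### The image of the compare-composition of all cliques. -/

section Moral

variable (G : ODAG.{v})

/-- The values of `moralFunctor` on generators. -/
noncomputable def moralGen (C : (ugSig G.moral).Gen) :
    (of [] : HSyn G) ⟶ of (vlist (V := G.V) C.1) :=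
  (moralFunctor G).map (FreeCat.gen .hyp (ugSig G.moral) C)

/-- Parents are smaller than their child, so `a` is the largest element of this set and can be read
off from it. Hence the choice of a vertex in `moralFunctor` is forced, and different vertices use
different cliques. -/
theorem insert_parents_injective :
    Function.Injective fun a : G.V => insert a (G.parents a) := by
  have key : ∀ a b : G.V, insert a (G.parents a) = insert b (G.parents b) → a ≤ b := fun a b h => by
    have ha : a ∈ insert b (G.parents b) := h ▸ Finset.mem_insert_self a _
    exact (Finset.mem_insert.1 ha).elim le_of_eq fun h' => (ODAG.lt_of_mem_parents h').le
  exact fun a b h => le_antisymm (key a b h) (key b a h.symm)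

/-- The clique of the moralisation formed by a vertex and its parents. -/
noncomputable def familyClique (a : G.V) : G.moral.Clique := by
  refine ⟨(insert a (G.parents a) : Finset G.V), ⟨a, Finset.mem_insert_self _ _⟩, ?_⟩
  intro x hx y hy hxy
  have hx' := Finset.mem_insert.1 (Finset.mem_coe.1 hx)
  have hy' := Finset.mem_insert.1 (Finset.mem_coe.1 hy)
  refine ⟨hxy, ?_⟩
  rcases hx' with rfl | hx' <;> rcases hy' with rfl | hy'
  · exact absurd rfl hxy
  · exact Or.inr (Or.inl (ODAG.mem_parents.1 hy'))
  · exact Or.inl (ODAG.mem_parents.1 hx')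
  · exact Or.inr (Or.inr ⟨a, ODAG.mem_parents.1 hx', ODAG.mem_parents.1 hy'⟩)

/-- By injectivity the vertex that `moralFunctor` chooses for the clique of `a` is `a`. Composing
with a cowire hides the cast between the two descriptions of the clique. -/
theorem moralGen_family_comp_cowire (L : List G.V) (a : G.V) (h h') :
    moralGen G (familyClique G a) ≫ cowire (dagSig G) L (vlist (familyClique G a).1) h =
      (graphFactor G a).hom ≫ cowire (dagSig G) L (vlist (graphFactor G a).out) h' := by
  have hex : ∃ b : G.V, (familyClique G a).1 = insert b (G.parents b) := ⟨a, rfl⟩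
  -- The chosen vertex is generalised to a variable `b`, which can then be replaced by `a`.
  have key : ∀ (b : G.V) (e : (familyClique G a).1 = insert b (G.parents b)),
      castHom rfl (congrArg (fun T => of (vlist T)) e.symm) (graphFactor G b).hom ≫
        cowire (dagSig G) L (vlist (familyClique G a).1) h =
      (graphFactor G a).hom ≫ cowire (dagSig G) L (vlist (graphFactor G a).out) h' := by
    intro b e
    obtain rfl := insert_parents_injective G e
    exact (castHom_comp_cowire rfl (graphFactor G a).hom h' h)
  have e : moralGen G (familyClique G a) = castHom rfl
      (congrArg (fun T => of (vlist T)) hex.choose_spec.symm) (graphFactor G hex.choose).hom :=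
    dif_pos hex
  rw [e]
  exact key _ hex.choose_spec

/-- The other cliques are sent to `omni`, and a cowire preserves it; they become unit factors of the
product. -/
theorem moralGen_other_comp_cowire (L : List G.V) (C : G.moral.Clique)
    (hC : ∀ a, familyClique G a ≠ C) (h) :
    moralGen G C ≫ cowire (dagSig G) L (vlist C.1) h = η := by
  have hex : ¬ ∃ b : G.V, C.1 = insert b (G.parents b) := fun ⟨b, e⟩ => hC b (Subtype.ext e.symm)
  have e : moralGen G C = HypCat.omni (of (vlist C.1) : HSyn G) := dif_neg hex
  rw [e]
  exact (isTranspose_cowire L _ h).one_comp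

theorem hypHom_cliqueFactor (L : List G.V) (hL : ∀ a, a ∈ L) (C : G.moral.Clique) :
    hypHom (moralGen G) (X := []) (factorPt (A := G.V) L (cliqueFactor G.moral C)) =
      moralGen G C ≫ cowire (dagSig G) L (vlist (V := G.V) C.1) fun a _ => hL a :=
  hypHom_factorPt (A := G.V) (moralGen G) fun a _ => hL a

theorem compCompAll_eq (H : OUGr.{v}) : compCompAll H =
    ((allFactors H).map (factorPt (vlist (Finset.univ : Finset H.V)))).prod := by
  have hL : ∀ a : H.V, a ∈ vlist (Finset.univ : Finset H.V) := fun a =>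
    mem_vlist.2 (Finset.mem_univ a)
  rw [← compComp_comp_cowire _ _ fun a _ => hL a]
  have e := castHom_comp_cowire (S := ugSig H) (congrArg vlist (outputs_allFactors H))
    (compComp (allFactors H)) (fun a _ => hL a) fun a _ => hL a
  rw [cowire_self _ ((vlist_pairwise _).imp fun h => ne_of_lt h), Category.comp_id] at e
  exact e

/-- The copy-composition of all generators has no inputs, so it is its own diagonal. -/
theorem starHom_copyCompAll : starHom (copyCompAll G) =
    ((vlist (Finset.univ : Finset G.V)).map fun a =>
      factorPt (vlist (Finset.univ : Finset G.V)) (graphFactor G a)).prod := by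
  have hL : ∀ a : G.V, a ∈ vlist (Finset.univ : Finset G.V) := fun a =>
    mem_vlist.2 (Finset.mem_univ a)
  rw [← diagPt_copyComp G _ _ (fun _ _ a _ => hL a) (fun a _ => hL a) fun a _ => hL a]
  refine Eq.trans ?_ (diagPt_starHom_castHom G ((congrArg vlist (inputs_univ G)).trans vlist_empty)
    rfl (copyComp G Finset.univ) _ (fun a _ => hL a) _ fun a _ => hL a)
  rw [wire_nil, starHom_counit, cowire_self _ ((vlist_pairwise _).imp fun h => ne_of_lt h),
    Category.comp_id]
  exact (diagPt_counit_comp _).symm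

/-- The left side is a product over all cliques. Those not of the form {v} ∪ pa(v) contribute the
unit, and reindexing the rest by the injection `familyClique` gives the product over the vertices on
the right. -/
theorem hypHom_compCompAll : hypHom (moralGen G) (compCompAll G.moral) =
    starHom (copyCompAll G) := by
  have hL : ∀ a : G.V, a ∈ vlist (Finset.univ : Finset G.V) := fun a =>
    mem_vlist.2 (Finset.mem_univ a)
  rw [starHom_copyCompAll, compCompAll_eq]
  have e₁ := hypHom_prod (A := G.V) (moralGen G) (L := vlist Finset.univ)
    (fun C => factorPt (A := G.V) (vlist Finset.univ) (cliqueFactor G.moral C))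
    (Finset.univ : Finset G.moral.Clique).toList
  rw [allFactors, List.map_map]
  refine e₁.trans ((Finset.prod_map_toList (M := 𝟙_ (HSyn G) ⟶ of (vlist Finset.univ)) _ _).trans ?_)
  have e : ((vlist (Finset.univ : Finset G.V)).map fun a =>
      factorPt (vlist (Finset.univ : Finset G.V)) (graphFactor G a)).prod =
      ∏ a : G.V, factorPt (vlist (Finset.univ : Finset G.V)) (graphFactor G a) := by
    rw [← Finset.prod_map_toList]
    refine List.Perm.prod_eq (List.Perm.map _ (Finset.sort_perm_toList _ _))
  rw [e]
  refine (Finset.prod_of_injOn (familyClique G) ?_ (fun _ _ => Finset.mem_coe.2 (Finset.mem_univ _))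
    ?_ ?_).symm
  · exact fun a _ b _ h => insert_parents_injective G (congrArg Subtype.val h)
  · intro C _ hC
    refine (hypHom_cliqueFactor G _ hL C).trans (moralGen_other_comp_cowire G _ C ?_ _)
    exact fun a h => hC ⟨a, Finset.mem_coe.2 (Finset.mem_univ _), h⟩
  · intro a _
    rw [factorPt_eq fun b _ => hL b]
    exact ((hypHom_cliqueFactor G _ hL _).trans (moralGen_family_comp_cowire G _ a _ _)).symm

end Moral

end PGM

namespace PGM

/-! ### Functors out of free categories. -/

open FreeCat

theorem Functor.map_heq_map {C : Type*} [Category C] {D : Type*} [Category D] (G : C ⥤ D)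
    {P P' Q Q' : C} (hP : P = P') (hQ : Q = Q') {g : P ⟶ Q} {g' : P' ⟶ Q'} (h : HEq g g') :
    HEq (G.map g) (G.map g') := by
  subst hP hQ h; rfl

section Structure

variable {C : Type*} [StrictSMC C] {D : Type*} [StrictSMC D] {E : Type*} [StrictSMC E]

theorem CDCat.copy_heq [CDCat C] {X Y : C} (h : X = Y) : HEq (CDCat.copy X) (CDCat.copy Y) := by
  subst h; rfl

theorem CDCat.del_heq [CDCat C] {X Y : C} (h : X = Y) : HEq (CDCat.del X) (CDCat.del Y) := by
  subst h; rfl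

theorem HypCat.compare_heq [CDCat C] [HypCat C] {X Y : C} (h : X = Y) :
    HEq (HypCat.compare X) (HypCat.compare Y) := by
  subst h; rfl

theorem HypCat.omni_heq [CDCat C] [HypCat C] {X Y : C} (h : X = Y) :
    HEq (HypCat.omni X) (HypCat.omni Y) := by
  subst h; rfl

theorem IsCDFunctor.comp [CDCat C] [CDCat D] [CDCat E] {F : C ⥤ D} {G : D ⥤ E}
    (hF : IsCDFunctor F) (hG : IsCDFunctor G) : IsCDFunctor (F ⋙ G) :=
  { hF.toIsSymFunctor.comp hG.toIsSymFunctor with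
    map_copy X := (Functor.map_heq_map G rfl (hF.obj_tensor X X) (hF.map_copy X)).trans
      (hG.map_copy (F.obj X))
    map_del X := (Functor.map_heq_map G rfl hF.obj_unit (hF.map_del X)).trans
      (hG.map_del (F.obj X)) }

theorem IsHypFunctor.comp [CDCat C] [HypCat C] [CDCat D] [HypCat D] [CDCat E] [HypCat E]
    {F : C ⥤ D} {G : D ⥤ E} (hF : IsHypFunctor F) (hG : IsHypFunctor G) : IsHypFunctor (F ⋙ G) :=
  { hF.toIsCDFunctor.comp hG.toIsCDFunctor with
    map_compare X := (Functor.map_heq_map G (hF.obj_tensor X X) rfl (hF.map_compare X)).trans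
      (hG.map_compare (F.obj X))
    map_omni X := (Functor.map_heq_map G hF.obj_unit rfl (hF.map_omni X)).trans
      (hG.map_omni (F.obj X)) }

end Structure

section Ext

variable {k : Kind} {A : Type u} {S : MonSig A} {D : Type w} [StrictSMC.{v} D]

/-- Induction on diagrams. Agreement on the comonoid and monoid operations is a hypothesis, so that
a single induction serves all three kinds of free categories. -/
theorem FreeCat.functor_ext_of_ops {F F' : FreeCat k S ⥤ D} (hF : IsSymFunctor F)
    (hF' : IsSymFunctor F') (hobj : ∀ X, F.obj X = F'.obj X)
    (hgen : ∀ σ, HEq (F.map (gen k S σ)) (F'.map (gen k S σ)))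
    (hcopy : ∀ h X, HEq (F.map (mk (k := k) (S := S) (.copy h X))) (F'.map (mk (.copy h X))))
    (hdel : ∀ h X, HEq (F.map (mk (k := k) (S := S) (.del h X))) (F'.map (mk (.del h X))))
    (hcompare : ∀ h X,
      HEq (F.map (mk (k := k) (S := S) (.compare h X))) (F'.map (mk (.compare h X))))
    (homni : ∀ h X, HEq (F.map (mk (k := k) (S := S) (.omni h X))) (F'.map (mk (.omni h X)))) :
    F = F' := by
  have key : ∀ {X Y : List A} (t : Term k S X Y), HEq (F.map (mk t)) (F'.map (mk t)) := by
    intro X Y t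
    induction t with
    | gen σ => exact hgen σ
    | id X =>
      refine (heq_of_eq (F.map_id (of X))).trans (HEq.trans ?_ (heq_of_eq (F'.map_id (of X))).symm)
      exact id_heq (hobj _)
    | comp f g ihf ihg =>
      refine (heq_of_eq (F.map_comp (mk f) (mk g))).trans (HEq.trans ?_
        (heq_of_eq (F'.map_comp (mk f) (mk g))).symm)
      exact comp_heq_comp (hobj _) (hobj _) (hobj _) ihf ihg
    | tensor f g ihf ihg =>
      refine (hF.map_tensor (mk f) (mk g)).trans (HEq.trans ?_ (hF'.map_tensor (mk f) (mk g)).symm)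
      exact tensorHom_heq (hobj _) (hobj _) (hobj _) (hobj _) ihf ihg
    | braid X Y =>
      refine (hF.map_braid (of X) (of Y)).trans (HEq.trans ?_ (hF'.map_braid (of X) (of Y)).symm)
      exact braid_heq (hobj _) (hobj _)
    | copy h X => exact hcopy h X
    | del h X => exact hdel h X
    | compare h X => exact hcompare h X
    | omni h X => exact homni h X
  refine CategoryTheory.Functor.hext hobj fun X Y f => ?_
  obtain ⟨t, rfl⟩ := mk_surj f
  exact key t

theorem FreeCat.symFunctor_ext {F F' : FreeCat .sym S ⥤ D} (hF : IsSymFunctor F)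
    (hF' : IsSymFunctor F') (hobj : ∀ X, F.obj X = F'.obj X)
    (hgen : ∀ σ, HEq (F.map (gen .sym S σ)) (F'.map (gen .sym S σ))) : F = F' :=
  FreeCat.functor_ext_of_ops hF hF' hobj hgen (fun h => False.elim h) (fun h => False.elim h)
    (fun h => False.elim h) (fun h => False.elim h)

theorem FreeCat.cdFunctor_ext [CDCat D] {F F' : FreeCat .cd S ⥤ D} (hF : IsCDFunctor F)
    (hF' : IsCDFunctor F') (hobj : ∀ X, F.obj X = F'.obj X)
    (hgen : ∀ σ, HEq (F.map (gen .cd S σ)) (F'.map (gen .cd S σ))) : F = F' :=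
  FreeCat.functor_ext_of_ops hF.toIsSymFunctor hF'.toIsSymFunctor hobj hgen
    (fun _ X => (hF.map_copy (of X)).trans ((CDCat.copy_heq (hobj _)).trans (hF'.map_copy (of X)).symm))
    (fun _ X => (hF.map_del (of X)).trans ((CDCat.del_heq (hobj _)).trans (hF'.map_del (of X)).symm))
    (fun h => False.elim h) (fun h => False.elim h)

theorem FreeCat.hypFunctor_ext [CDCat D] [HypCat D] {F F' : FreeCat .hyp S ⥤ D}
    (hF : IsHypFunctor F) (hF' : IsHypFunctor F') (hobj : ∀ X, F.obj X = F'.obj X)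
    (hgen : ∀ σ, HEq (F.map (gen .hyp S σ)) (F'.map (gen .hyp S σ))) : F = F' :=
  FreeCat.functor_ext_of_ops hF.toIsSymFunctor hF'.toIsSymFunctor hobj hgen
    (fun _ X => (hF.map_copy (of X)).trans ((CDCat.copy_heq (hobj _)).trans (hF'.map_copy (of X)).symm))
    (fun _ X => (hF.map_del (of X)).trans ((CDCat.del_heq (hobj _)).trans (hF'.map_del (of X)).symm))
    (fun _ X => (hF.map_compare (of X)).trans
      ((HypCat.compare_heq (hobj _)).trans (hF'.map_compare (of X)).symm))
    (fun _ X => (hF.map_omni (of X)).trans ((HypCat.omni_heq (hobj _)).trans (hF'.map_omni (of X)).symm))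

end Ext

/-! ### Composites of the structural functors, and moralisation of models. -/

section Functors

theorem moralFunctor_isHyp (G : ODAG.{v}) : IsHypFunctor (moralFunctor G) :=
  hypLift_isHyp (moralGen G)

theorem bangUGr_isHyp (H : OUGr.{v}) : IsHypFunctor (bangUGr H) :=
  FreeCat.lift_isHyp (k := .hyp) (D := Syn H) (fun _ => inferInstance) (fun _ => inferInstance)
    _ _ _ _ trivial

theorem bangHSyn_isHyp (G : ODAG.{v}) : IsHypFunctor (bangHSyn G) :=
  FreeCat.lift_isHyp (k := .hyp) (D := HSyn G) (fun _ => inferInstance) (fun _ => inferInstance)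
    _ _ _ _ trivial

theorem bangDAG_isCD (G : ODAG.{v}) : IsCDFunctor (bangDAG G) :=
  FreeCat.lift_isCD (k := .cd) (D := CDSyn G) (fun _ => inferInstance) (fun h => False.elim h)
    _ _ _ _ trivial

theorem starDAG_isCD (G : ODAG.{v}) : IsCDFunctor (starDAG G) :=
  FreeCat.lift_isCD (k := .cd) (D := HSyn G) (fun _ => inferInstance) (fun h => False.elim h)
    _ _ _ _ trivial

theorem starPoint_isCD : IsCDFunctor starPoint.{v} :=
  FreeCat.lift_isCD (k := .cd) (D := Syn OUGr.point.{v}) (fun _ => inferInstance)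
    (fun h => False.elim h) _ _ _ _ trivial

theorem extend_isHyp {U : Type w} {G : ODAG.{v}} (F : CDSyn G ⥤ FinStoch U) (hF : IsCDFunctor F) :
    IsHypFunctor (extend F hF) :=
  FreeCat.lift_isHyp (k := .hyp) (D := MatCat U) (fun _ => inferInstance) (fun _ => inferInstance)
    _ _ _ _ trivial

theorem VCat.incl_isSym {V : Type v} (k : Kind) (S : MonSig V) : IsSymFunctor (VCat.incl k S) :=
  FreeCat.lift_isSym ..

theorem toMat_isCD (U : Type w) : IsCDFunctor (FinStoch.toMat U) where
  obj_unit := rfl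
  obj_tensor _ _ := rfl
  map_tensor _ _ := HEq.rfl
  map_braid _ _ := HEq.rfl
  map_copy _ := HEq.rfl
  map_del _ := HEq.rfl

/-- Both composites agree on objects by computation; on the unique generator the claim is
`hypHom_compCompAll`, up to casts. -/
theorem bangUGr_comp_moralFunctor (G : ODAG.{v}) :
    bangUGr G.moral ⋙ moralFunctor G = bangHSyn G := by
  refine FreeCat.hypFunctor_ext ((bangUGr_isHyp _).comp (moralFunctor_isHyp G)) (bangHSyn_isHyp G)
    (fun _ => rfl) fun C => ?_
  refine HEq.trans ?_ (castHom_heq rfl _ _).symm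
  refine HEq.trans (Functor.map_heq_map (moralFunctor G) ?_ ?_ (castHom_heq rfl _ _)) ?_
  · rfl
  · exact congrArg of
        (((List.append_nil _).symm.trans (congrArg (List.flatMap _) (point_cod C).symm))).symm
  · exact heq_of_eq (hypHom_compCompAll G)

/-- Both CD-functors send the unique generator to the image under `starDAG` of the copy-composition
of all generators. -/
theorem starPoint_comp_bangHSyn (G : ODAG.{v}) :
    starPoint ⋙ bangHSyn G = bangDAG G ⋙ starDAG G := by
  refine FreeCat.cdFunctor_ext (starPoint_isCD.comp (bangHSyn_isHyp G).toIsCDFunctor)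
    ((bangDAG_isCD G).comp (starDAG_isCD G)) (fun _ => rfl) fun x => ?_
  refine (Functor.map_heq_map (bangHSyn G) (congrArg of (point_dom x))
    (congrArg of (point_cod pointClique).symm)
    (castHom_heq (congrArg of (point_dom x).symm) _ _)).trans ?_
  refine (castHom_heq rfl _ _).trans ?_
  refine (Functor.map_heq_map (starDAG G) (congrArg of (congrArg (List.flatMap _) (point_dom x)))
    (congrArg of (List.append_nil _))
    (castHom_heq (congrArg of (congrArg (List.flatMap _) (point_dom x)).symm) _ _)).symm

theorem starDAG_comp_extend {U : Type w} {G : ODAG.{v}} (F : CDSyn G ⥤ FinStoch U)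
    (hF : IsCDFunctor F) : starDAG G ⋙ extend F hF = F ⋙ FinStoch.toMat U :=
  FreeCat.cdFunctor_ext ((starDAG_isCD G).comp (extend_isHyp F hF).toIsCDFunctor)
    (hF.comp (toMat_isCD U)) (fun _ => rfl) fun _ => HEq.rfl

/-- The vertex-list category has no generating morphisms, so agreement on objects is enough. -/
theorem incl_comp_extend {U : Type w} {G : ODAG.{v}} (F : CDSyn G ⥤ FinStoch U)
    (hF : IsCDFunctor F) :
    VCat.incl .hyp (ugSig G.moral) ⋙ moralFunctor G ⋙ extend F hF =
      (VCat.incl .cd (dagSig G) ⋙ F) ⋙ FinStoch.toMat U :=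
  FreeCat.symFunctor_ext
    ((VCat.incl_isSym _ _).comp ((moralFunctor_isHyp G).comp (extend_isHyp F hF)).toIsSymFunctor)
    (((VCat.incl_isSym _ _).comp hF.toIsSymFunctor).comp (toMat_isCD U).toIsSymFunctor)
    (fun _ => rfl) fun σ => PEmpty.elim σ

/-- The previous identities are pasted together. They hold between matrices, before passing to
proportionality classes: the product of the conditional distributions is already normalised, so no
scalar is needed. -/
theorem IsBNModel.moral {U : Type w} {ω : CDSyn ODAG.point.{v} ⥤ FinStoch U} {G : ODAG.{v}}
    {τ : VCat G.V ⥤ FinStoch U} {F : CDSyn G ⥤ FinStoch U} (hF : IsBNModel ω G τ F) :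
    IsMNModel ω G.moral τ (moralFunctor G ⋙ extend F hF.isCD) where
  isHyp := (moralFunctor_isHyp G).comp (extend_isHyp F hF.isCD)
  assignment := by
    have e := congrArg (· ⋙ FinProjStoch.quot U) (incl_comp_extend F hF.isCD)
    rw [hF.assignment] at e
    exact e
  distribution := by
    have e₁ := congrArg (fun K => starPoint ⋙ K ⋙ extend F hF.isCD ⋙ FinProjStoch.quot U)
      (bangUGr_comp_moralFunctor G)
    have e₂ := congrArg (· ⋙ extend F hF.isCD ⋙ FinProjStoch.quot U) (starPoint_comp_bangHSyn G)
    have e₃ := congrArg (fun K => bangDAG G ⋙ K ⋙ FinProjStoch.quot U)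
      (starDAG_comp_extend F hF.isCD)
    have e₄ := congrArg (· ⋙ FinProjStoch.emb U) hF.distribution
    exact e₁.trans (e₂.trans (e₃.trans e₄))

/-- The case to watch is that of two parents of a common child. If one of them is identified with
the child, the edge from the other becomes an edge between the two images; if both are, the images
coincide. -/
theorem preserves_moral {G G' : ODAG.{v}} (α : G ⟶ G') :
    OUGr.Preserves G.moral G'.moral α.map := by
  intro a b h
  by_cases e : α.map a = α.map b
  · exact Or.inl e
  refine Or.inr ⟨e, ?_⟩
  have h' := h.2
  rcases h' with h' | h' | ⟨d, had, hbd⟩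
  · exact Or.inl ((α.preserves a b h').resolve_left e)
  · exact Or.inr (Or.inl ((α.preserves b a h').resolve_left fun e' => e e'.symm))
  · rcases α.preserves a d had with ha | ha <;> rcases α.preserves b d hbd with hb | hb
    · exact absurd (ha.trans hb.symm) e
    · exact Or.inr (Or.inl (show G'.edge (α.map b) (α.map a) from ha.symm ▸ hb))
    · exact Or.inl (show G'.edge (α.map a) (α.map b) from hb.symm ▸ ha)
    · exact Or.inr (Or.inr ⟨_, ha, hb⟩)

end Functors

end PGM

theorem mainTheorem2 {U : Type w} :
    (∀ (G : PGM.ODAG.{v}) (l : List G.V), l.Nodup →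
      PGM.graphCopyComp G l = PGM.compComp (l.map (PGM.graphFactor G))) ∧
    (∀ G : PGM.ODAG.{v}, PGM.IsHypFunctor (PGM.moralFunctor G) ∧
      PGM.bangUGr G.moral ⋙ PGM.moralFunctor G = PGM.bangHSyn G) ∧
    (∀ (N : PGM.BN.{w, v} U) (F : PGM.CDSyn N.G ⥤ PGM.FinStoch U)
      (hF : PGM.IsBNModel N.ω N.G N.τ F),
      PGM.IsMNModel N.ω N.G.moral N.τ (PGM.moralFunctor N.G ⋙ PGM.extend F hF.isCD)) ∧
    ∃ (hObj : ∀ N : PGM.BN.{w, v} U, ∃ Φ : PGM.Syn N.G.moral ⥤ PGM.MatCat U,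
        PGM.IsMNModel N.ω N.G.moral N.τ Φ)
      (hHom : ∀ {G G' : PGM.ODAG.{v}} (α : G ⟶ G'),
        PGM.OUGr.Preserves G.moral G'.moral α.map)
      (Mor : PGM.BN.{w, v} U ⥤ PGM.MN.{w, v} U),
      Mor.toPrefunctor =
        { obj := fun N => ⟨N.ω, N.ω_isCD, N.G.moral, N.τ, N.τ_isSym, hObj N⟩
          map := fun f => ⟨⟨f.α.map, hHom f.α⟩, f.sem⟩ } := by
  refine ⟨fun G l hl => PGM.graphCopyComp_eq_compComp G l hl,
    fun G => ⟨PGM.moralFunctor_isHyp G, PGM.bangUGr_comp_moralFunctor G⟩,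
    fun _ _ hF => hF.moral, ?_⟩
  have hObj : ∀ N : PGM.BN.{w, v} U, ∃ Φ : PGM.Syn N.G.moral ⥤ PGM.MatCat U,
      PGM.IsMNModel N.ω N.G.moral N.τ Φ := fun N =>
    let ⟨_, hF⟩ := N.factorises
    ⟨_, hF.moral⟩
  exact ⟨hObj, fun α => PGM.preserves_moral α,
    { obj := fun N => ⟨N.ω, N.ω_isCD, N.G.moral, N.τ, N.τ_isSym, hObj N⟩
      -- The semantic part `f.sem` is reused as it stands: `pre` forgets the edges, so a network and
      -- its moralisation have the same `pre` by definition. For the same reason both functor laws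
      -- hold by `rfl`.
      map := fun f => ⟨⟨f.α.map, PGM.preserves_moral f.α⟩, f.sem⟩
      map_id := fun _ => rfl
      map_comp := fun _ _ => rfl }, rfl⟩
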